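/- **Setting.** Let $H_S\ge 0$ be a Hamiltonian on a finite-dimensional Hilbert space with a nondegenerate ground state $|0\rangle$ of energy $0$. Let $\omega_1>0$, let $P_1$ be the spectral projector of $H_S$ for energies in $(\omega_1-\delta\omega,\omega_1+\delta\omega)$, let $P_2=1-|0\rangle\langle0|-P_1$, and let $\Delta=\min\{\omega_1,E,|E-\omega_1| : E\in\mathrm{Spec}(H_S|_{P_2})\}>0$. Let $T_S$ be Hermitian, $\Omega_0=\|T_S\|$ (operator norm), $r=\Omega_0/\Delta$, and $P_1T_S|0\rangle=\Omega|1\rangle$ with $\Omega>0$ and $\||1\rangle\|=1$. Let $|F\rangle$ be a unit vector and $f_1=\langle1|F\rangle$. The bath is a qutrit with orthonormal basis $|C\rangle,|L\rangle,|R\rangle$; put $|B\rangle=(|L\rangle+|R\rangle)/\sqrt2$, $|D\rangle=(|L\rangle-|R\rangle)/\sqrt2$, and $$H=H_S\otimes(|C\rangle\langle C|+|R\rangle\langle R|-|L\rangle\langle L|)+\omega_1 1\otimes(|R\rangle\langle R|+|L\rangle\langle L|),$$ $$X=T_S\otimes(|C\rangle\langle B|+|B\rangle\langle C|),\qquad Y=\Omega_0\,1\otimes(|L\rangle\langle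 R|+|R\rangle\langle L|).$$ Let $\hat\delta_X,\hat\delta_Y$ be Hermitian simulation errors, and let $\mathbf S_1=(|0\rangle\langle0|+P_1)\otimes1$, $\mathbf S_2=P_2\otimes1$. Put $\Omega(X)=\Omega$ and $\Omega(Y)=\Omega_0$. Assume, for $(V,\hat\delta)=(X,\hat\delta_X)$ and for $(V,\hat\delta)=(Y,\hat\delta_Y)$, $$r<\tfrac18,\quad \delta\omega<r\,\Omega(V),\quad \frac{|\langle0|T_S|0\rangle|^2}{\omega_1}<r\,\Omega(V),\quad \frac{\|\mathbf S_1\hat\delta\mathbf S_1\|}{\Delta}<r\frac{\Omega(V)}{\Delta},$$ $$\frac{\|\mathbf S_1(V+\hat\delta)\mathbf S_2\|^2}{\Delta^2}<r\frac{\Omega(V)}{\Delta},\quad \frac{\|\mathbf S_2(V+\hat\delta)\mathbf S_2\|}{\Delta}<\tfrac12,$$ and moreover $\|\mathbf S_2(Y+\hat\delta_Y)\mathbf S_2\|/\Delta=O(r)$, so that the whole verification perturbation $Y+\hat\delta_Y$ has norm $O(r\Delta)$. **Scheme.** Let $0<\Omega^*<\Omega$. One attempt: prepare $|F\,C\rangle$;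 draw $\tau$ uniformly from $[\pi/\Omega^*,2\pi/\Omega^*]$; evolve under $H+X+\hat\delta_X$ for time $\tau$; measure whether the bath is in $|B\rangle$. If it is not, the attempt fails. If it is, apply the bath unitary $|B\rangle\mapsto|L\rangle,\ |D\rangle\mapsto|R\rangle,\ |C\rangle\mapsto|C\rangle$, evolve under $H+Y+\hat\delta_Y$ for time $\pi/(2\Omega_0)$, and measure whether the bath is in $|R\rangle$; the verification accepts if it is. Independent attempts are repeated until the first acceptance. **Theorem.** Suppose $r=O(|f_1|\varepsilon^{3/2})$ as $\varepsilon\to0^+$. Then: 1. an attempt ends in acceptance with probability $p_v=\Theta(|f_1|^2)$; 2. given acceptance, the system is in its ground state with probability $p_{\mathrm{success}}=1-O(\varepsilon)$; and the average over the uniformly drawn $\tau$ of the conditional probability given $\tau$ and acceptance is $1-O(\varepsilon)$ as well; 3. the expected total simulation time $\langle T\rangle$ until acceptance, which counts both kinds of evolution in all attempts, is $O\!\left(\frac{1}{|f_1|^2\,\Omega^*}\right)$, and it is at least a positive constant times $\frac{1}{|f_1|^3\varepsilon^{3/2}\Delta}$. The constants here, and how small $\varepsilon$ has to be, depend only on the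 constants implied in $r=O(|f_1|\varepsilon^{3/2})$ and in $\|\mathbf S_2(Y+\hat\delta_Y)\mathbf S_2\|/\Delta=O(r)$. -/

import Mathlib

namespace QSC

open scoped Matrix Kronecker ComplexOrder Matrix.Norms.L2Operator ENNReal
open MeasureTheory

noncomputable section

/-! ### Bath -/

/-- The qutrit bath: the basis vectors are `C = 0`, `L = 1`, `R = 2`. -/
abbrev Bath : Type := Fin 3

def ketC : Bath → ℂ := Pi.single 0 1
def ketL : Bath → ℂ := Pi.single 1 1
def ketR : Bath → ℂ := Pi.single 2 1
/-- `|B⟩ = (|L⟩ + |R⟩)/√2`. -/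
def ketB : Bath → ℂ := ((Real.sqrt 2 : ℂ)⁻¹) • (ketL + ketR)
/-- `|D⟩ = (|L⟩ - |R⟩)/√2`. -/
def ketD : Bath → ℂ := ((Real.sqrt 2 : ℂ)⁻¹) • (ketL - ketR)

/-- The operator `|u⟩⟨v|`. -/
def ketBra {m : Type} (u v : m → ℂ) : Matrix m m ℂ := Matrix.vecMulVec u (star v)

/-- The bath unitary `|B⟩ ↦ |L⟩`, `|D⟩ ↦ |R⟩`, `|C⟩ ↦ |C⟩`. -/
def bathSwap : Matrix Bath Bath ℂ := ketBra ketL ketB + ketBra ketR ketD + ketBra ketC ketC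

/-- The spectral projection of a Hermitian matrix onto the eigenspaces with eigenvalue in `s`. -/
def spectralProj {m : Type} [Fintype m] [DecidableEq m] {A : Matrix m m ℂ}
    (hA : A.IsHermitian) (s : Set ℝ) : Matrix m m ℂ :=
  hA.cfc (s.indicator 1)

/-- Time evolution `exp(-i t A)`. -/
def evolution {m : Type} [Fintype m] [DecidableEq m] (A : Matrix m m ℂ) (t : ℝ) :
    Matrix m m ℂ :=
  NormedSpace.exp ((-Complex.I * (t : ℂ)) • A)

/-- The squared Euclidean norm of a vector. -/
def normSq {m : Type} [Fintype m] (v : m → ℂ) : ℝ := ‖WithLp.toLp 2 v‖ ^ 2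

/-! ### System -/

/-- The data of the scheme: the system Hamiltonian `HS` on a finite-dimensional Hilbert space with
its nondegenerate ground state of energy `0`, the centre `ω₁` and half-width `δω` of the band `P₁`,
the Hermitian coupling `TS`, and the normalized fiducial state `F`. -/
structure System (ι : Type) [Fintype ι] [DecidableEq ι] where
  HS : Matrix ι ι ℂ
  posSemidef : HS.PosSemidef
  ground : ι → ℂ
  ground_norm : normSq ground = 1
  ground_eig : HS *ᵥ ground = 0
  ground_unique : ∀ v : ι → ℂ, HS *ᵥ v = 0 → ∃ a : ℂ, v = a • ground
  ω₁ : ℝ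
  δω : ℝ
  ω₁_pos : 0 < ω₁
  TS : Matrix ι ι ℂ
  TS_herm : TS.IsHermitian
  F : ι → ℂ
  F_norm : normSq F = 1

/-- The possible results of one attempt: the bath is not found in `B`; it is found in `B` but the
verification fails; the verification accepts and the system is in its ground state; the
verification accepts and the system is not in its ground state. -/
inductive Outcome : Type
  | noTransition
  | rejected
  | acceptedGround
  | acceptedExcited
  deriving DecidableEq

instance : Fintype Outcome where
  elems := {.noTransition, .rejected, .acceptedGround, .acceptedExcited}
  complete := by intro o; cases o <;> simp

instance : MeasurableSpace Outcome := ⊤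

/-- The verification accepted. -/
def Outcome.IsAccepted (o : Outcome) : Prop :=
  o = Outcome.acceptedGround ∨ o = Outcome.acceptedExcited

namespace System

variable {ι : Type} [Fintype ι] [DecidableEq ι] (S : System ι)

/-- Projector `|0⟩⟨0|`. -/
def P₀ : Matrix ι ι ℂ := ketBra S.ground S.ground

/-- Projector onto the eigenspace with energies in `(ω₁ - δω, ω₁ + δω)`. -/
def P₁ : Matrix ι ι ℂ :=
  spectralProj S.posSemidef.isHermitian (Set.Ioo (S.ω₁ - S.δω) (S.ω₁ + S.δω))

/-- Projector onto the complement of `span {|0⟩} ⊕ P₁`. -/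
def P₂ : Matrix ι ι ℂ := 1 - S.P₀ - S.P₁

/-- The spectrum of `HS` restricted to `P₂`. -/
def spec₂ : Set ℝ :=
  {E | ∃ v : ι → ℂ, v ≠ 0 ∧ S.P₂ *ᵥ v = v ∧ S.HS *ᵥ v = (E : ℂ) • v}

/-- The gap `Δ = min {ω₁, E, |E - ω₁| : E ∈ Spec(HS|P₂)}` (a finite nonempty set). -/
def Δ : ℝ := sInf ({S.ω₁} ∪ S.spec₂ ∪ (fun E => |E - S.ω₁|) '' S.spec₂)

/-- `Ω₀ = ‖TS‖`, operator norm. -/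
def Ω₀ : ℝ := ‖S.TS‖

/-- `r = Ω₀ / Δ`. -/
def r : ℝ := S.Ω₀ / S.Δ

/-- `Ω = ‖P₁ TS |0⟩‖`. -/
def Ω : ℝ := ‖WithLp.toLp 2 ((S.P₁ * S.TS) *ᵥ S.ground)‖

/-- The normalized state `|1⟩` with `P₁ TS |0⟩ = Ω |1⟩`. -/
def one : ι → ℂ := ((S.Ω : ℂ)⁻¹) • ((S.P₁ * S.TS) *ᵥ S.ground)

/-- The overlap `f₁ = ⟨1|F⟩`. -/
def f₁ : ℂ := star S.one ⬝ᵥ S.F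

/-- The projector `𝐒₁ = (|0⟩⟨0| + P₁) ⊗ 1`. -/
def S₁ : Matrix (ι × Bath) (ι × Bath) ℂ := (S.P₀ + S.P₁) ⊗ₖ (1 : Matrix Bath Bath ℂ)

/-- The projector `𝐒₂ = P₂ ⊗ 1`. -/
def S₂ : Matrix (ι × Bath) (ι × Bath) ℂ := S.P₂ ⊗ₖ (1 : Matrix Bath Bath ℂ)

/-- `H = HS ⊗ (|C⟩⟨C| + |R⟩⟨R| - |L⟩⟨L|) + ω₁ 1 ⊗ (|R⟩⟨R| + |L⟩⟨L|)`. -/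
def H : Matrix (ι × Bath) (ι × Bath) ℂ :=
  S.HS ⊗ₖ (ketBra ketC ketC + ketBra ketR ketR - ketBra ketL ketL) +
    (S.ω₁ : ℂ) • ((1 : Matrix ι ι ℂ) ⊗ₖ (ketBra ketR ketR + ketBra ketL ketL))

/-- `X = TS ⊗ (|C⟩⟨B| + |B⟩⟨C|)`. -/
def X : Matrix (ι × Bath) (ι × Bath) ℂ := S.TS ⊗ₖ (ketBra ketC ketB + ketBra ketB ketC)

/-- `Y = Ω₀ 1 ⊗ (|L⟩⟨R| + |R⟩⟨L|)`. -/
def Y : Matrix (ι × Bath) (ι × Bath) ℂ :=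
  (S.Ω₀ : ℂ) • ((1 : Matrix ι ι ℂ) ⊗ₖ (ketBra ketL ketR + ketBra ketR ketL))

/-- The error bounds for the evolution under `H + V + δ`, where `w` is the oscillation rate `Ω(V)`
belonging to the coupling `V`. -/
structure ErrorBound (V δ : Matrix (ι × Bath) (ι × Bath) ℂ) (w : ℝ) : Prop where
  small : S.r < 1 / 8
  width : S.δω < S.r * w
  shift : ‖star S.ground ⬝ᵥ (S.TS *ᵥ S.ground)‖ ^ 2 / S.ω₁ < S.r * w
  block₁₁ : ‖S.S₁ * δ * S.S₁‖ / S.Δ < S.r * (w / S.Δ)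
  block₁₂ : ‖S.S₁ * (V + δ) * S.S₂‖ ^ 2 / S.Δ ^ 2 < S.r * (w / S.Δ)
  block₂₂ : ‖S.S₂ * (V + δ) * S.S₂‖ / S.Δ < 1 / 2

/-- During the verification the perturbation is of order `r Δ` on `𝐒₂` as well. -/
def VerificationBound (δ : Matrix (ι × Bath) (ι × Bath) ℂ) (κ : ℝ) : Prop :=
  ‖S.S₂ * (S.Y + δ) * S.S₂‖ / S.Δ ≤ κ * S.r

/-! ### One attempt -/

/-- Duration `π / (2 Ω₀)` of the verification evolution. -/
def verificationTime : ℝ := Real.pi / (2 * S.Ω₀)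

/-- The initial state `|F⟩ ⊗ |C⟩`. -/
def initial : ι × Bath → ℂ := fun p => S.F p.1 * ketC p.2

/-- The (unnormalized) state after evolving for time `τ` under `H + X + δX`. -/
def evolved (δX : Matrix (ι × Bath) (ι × Bath) ℂ) (τ : ℝ) : ι × Bath → ℂ :=
  evolution (S.H + S.X + δX) τ *ᵥ S.initial

/-- The unnormalized state after the bath has moreover been found in `B`, the bath unitary has been
applied, and the system has evolved under `H + Y + δY` for the verification time. -/
def verified (δX δY : Matrix (ι × Bath) (ι × Bath) ℂ) (τ : ℝ) : ι × Bath → ℂ :=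
  (evolution (S.H + S.Y + δY) S.verificationTime *
    ((1 : Matrix ι ι ℂ) ⊗ₖ bathSwap) *
    ((1 : Matrix ι ι ℂ) ⊗ₖ ketBra ketB ketB)) *ᵥ S.evolved δX τ

/-- The Born probability of each outcome of an attempt with evolution time `τ`. -/
def outcomeProb (δX δY : Matrix (ι × Bath) (ι × Bath) ℂ) (τ : ℝ) : Outcome → ℝ
  | .noTransition =>
      normSq (((1 : Matrix ι ι ℂ) ⊗ₖ (1 - ketBra ketB ketB)) *ᵥ S.evolved δX τ)
  | .rejected =>
      normSq (((1 : Matrix ι ι ℂ) ⊗ₖ (1 - ketBra ketR ketR)) *ᵥ S.verified δX δY τ)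
  | .acceptedGround =>
      normSq ((S.P₀ ⊗ₖ ketBra ketR ketR) *ᵥ S.verified δX δY τ)
  | .acceptedExcited =>
      normSq (((1 - S.P₀) ⊗ₖ ketBra ketR ketR) *ᵥ S.verified δX δY τ)

/-- The uniform distribution on `[π/Ω*, 2π/Ω*]`. -/
def timeLaw (Ωs : ℝ) : Measure ℝ :=
  ProbabilityTheory.cond volume (Set.Icc (Real.pi / Ωs) (2 * Real.pi / Ωs))

/-- The joint law of the sampled evolution time and the outcome of one attempt. -/
def attemptLaw (δX δY : Matrix (ι × Bath) (ι × Bath) ℂ) (Ωs : ℝ) : Measure (ℝ × Outcome) :=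
  ∑ o : Outcome, ((timeLaw Ωs).withDensity
    (fun τ => ENNReal.ofReal (S.outcomeProb δX δY τ o))).map (fun τ => (τ, o))

/-- The probability that the verification accepts in one attempt. -/
def pAccept (δX δY : Matrix (ι × Bath) (ι × Bath) ℂ) (Ωs : ℝ) : ℝ :=
  (S.attemptLaw δX δY Ωs).real {a | a.2.IsAccepted}

/-- The probability that the system is in its ground state, given that the verification accepts. -/
def pSuccess (δX δY : Matrix (ι × Bath) (ι × Bath) ℂ) (Ωs : ℝ) : ℝ :=
  (ProbabilityTheory.cond (S.attemptLaw δX δY Ωs) {a | a.2.IsAccepted}).real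
    {a | a.2 = Outcome.acceptedGround}

/-- The probability that the system is in its ground state, given that the verification accepts in
an attempt whose evolution time is `τ`. -/
def pSuccessAt (δX δY : Matrix (ι × Bath) (ι × Bath) ℂ) (τ : ℝ) : ℝ :=
  S.outcomeProb δX δY τ .acceptedGround /
    (S.outcomeProb δX δY τ .acceptedGround + S.outcomeProb δX δY τ .acceptedExcited)

/-! ### Repetition until acceptance -/

/-- The simulation time used by an attempt: the verification is run only if the bath was found in
`B`. -/
def duration (a : ℝ × Outcome) : ℝ :=
  a.1 + match a.2 with
    | .noTransition => 0
    | _ => S.verificationTime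

open Classical in
/-- The total simulation time of a sequence of attempts: attempt `n` is made if and only if no
earlier attempt was accepted. -/
def totalTime (a : ℕ → ℝ × Outcome) : ℝ≥0∞ :=
  ∑' n, if ∀ m < n, ¬ (a m).2.IsAccepted then ENNReal.ofReal (S.duration (a n)) else 0

end System

end

end QSC

namespace QSC

open scoped Matrix Kronecker ComplexOrder Matrix.Norms.L2Operator ENNReal
open MeasureTheory

noncomputable section

/-! ### Schur complement estimate for a resonant block -/

section Resonance

variable {E : Type*} [NormedAddCommGroup E] [InnerProductSpace ℂ E]

/-! Measured from `ω₁`, the Hamiltonian is `HS - ω₁` on the bath level C, `HS` on R and `-HS` on L.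
The levels near energy 0 are `P₁ ⊗ C` and the ground state with L or R. The other levels of `S₁` lie
near `±ω₁`, and those of `S₂` at distance at least `Δ` from 0. Compressed to the resonant levels,
`X` only couples `|1 C⟩` to `|0 B⟩`, at rate `Ω`, and `Y` only couples `|0 L⟩` to `|0 R⟩`, at rate
`Ω₀`. Each evolution is therefore a Rabi oscillation, provided that the other levels act back
weakly.

"Weakly" means small against `Ω`, which may be far below `Ω₀`, so the generic second-order size `Ω₀²
/ Δ` is not good enough. The coupling to `S₂` is small by hypothesis. The second-order shift through
the levels near `±ω₁` cancels, since B has equal weights on L and R, whose detunings are opposite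
(`bX_bZ_bX`); only `⟨0|TS|0⟩² / ω₁` survives, and it is small by hypothesis. `Resonant.schur` turns
this into a back action of order `r w`, where `w` is the coupling rate.

The sampled times may be very long, so errors must not accumulate. Hence the comparison is made with
exact eigenvectors: each eigenvector of the compressed coupling is within `O(r)` of a multiple of an
exact eigenvector (`Resonant.exists_nearly_stationary`). Then `Resonant.rabi` holds with an error
`O(r)` uniform in time, and only the frequency moves, by a relative `O(r)`.

The verification takes `|0 L⟩` to `|0 R⟩` by a quarter of a Rabi period. An excited state with L
cannot reach an excited state with R: the former has energy at most `ω₁`, the latter at least `ω₁ +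
3Δ/4`, and a perturbation of norm `O(r Δ)` leaks across this gap only with amplitude `O(r)`
(`excited_amplitude`, by the `sin θ` theorem).

So at time `τ` the accepted ground state has probability `g²` with `g = |sin (w' τ)| |f₁| + O(r)`,
and the accepted excited states have probability `O(r²)`. A uniform time is within `x` of a node of
the sine, in the sense `|sin (w' τ)| < x`, with probability `O(x)`. Averaging gives an acceptance
probability of order `|f₁|²`. The ratio of averages fails by `O(r² / |f₁|²)`. The average of ratios
fails by `O(x + r² / (x² |f₁|²))`; with `x = ε` this is `O(ε)` precisely when `r = O(|f₁| ε^(3/2))`.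
Finally the expected number of attempts is the inverse acceptance probability, every attempt lasts a
time of order `1 / Ω*`, and `Ω* < Ω₀ = r Δ` gives the lower bound. -/

lemma norm_apply_le_of_le {A : E →L[ℂ] E} {c : ℝ} (hA : ‖A‖ ≤ c) (x : E) : ‖A x‖ ≤ c * ‖x‖ :=
  (A.le_opNorm x).trans (by gcongr)

lemma apply_eq {A B C : E →L[ℂ] E} (h : A * B = C) (x : E) : A (B x) = C x := by
  rw [← h]; rfl

variable [CompleteSpace E]

/-- A block decomposition `Q + G + S = 1` adapted to a Hamiltonian `h + V + δ`: the levels of `h`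
in `Q` are resonant (energy close to `0`), those in `G` are close to the levels `±ω` of `ω σ`, and
those in `S` are at distance at least `D` from `0`. The coupling inside `Q` is `V`, of strength
`w`, and all other effects on `Q` are small compared with `w`. -/
structure Resonant (h V δ Q G S σ : E →L[ℂ] E) (ω r w D : ℝ) : Prop where
  sum_eq : Q + G + S = 1
  projQ : IsStarProjection Q
  projG : IsStarProjection G
  projS : IsStarProjection S
  QG : Q * G = 0
  GQ : G * Q = 0
  QS : Q * S = 0
  SQ : S * Q = 0
  GS : G * S = 0
  SG : S * G = 0
  commQ : h * Q = Q * h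
  commG : h * G = G * h
  commS : h * S = S * h
  σG : σ * G = σ
  σσ : σ * σ = G
  norm_σ : ‖σ‖ ≤ 1
  norm_hQ : ‖h * Q‖ ≤ r * w
  norm_hG : ‖h * G - (ω : ℂ) • σ‖ ≤ r * w
  gap : ∀ x, S x = x → D * ‖x‖ ≤ ‖h x‖
  crossSF : ‖S * (V + δ) * (Q + G)‖ ^ 2 ≤ r * w * D
  crossFS : ‖(Q + G) * (V + δ) * S‖ ^ 2 ≤ r * w * D
  far : ‖S * (V + δ) * S‖ ≤ D / 2
  near : ‖(Q + G) * δ * (Q + G)‖ ≤ r * w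
  norm_GVG : ‖G * V * G‖ ≤ 2 * w
  norm_QVG : ‖Q * V * G‖ ≤ r * D
  norm_GVQ : ‖G * V * Q‖ ≤ r * D
  second_order : ‖Q * V * σ * V * Q‖ ≤ r * w * ω
  D_pos : 0 < D
  D_le : D ≤ ω
  w_pos : 0 < w
  w_le : w ≤ r * D
  r_pos : 0 < r
  r_le : r ≤ 1 / 1000

namespace Resonant

variable {h V δ Q G S σ : E →L[ℂ] E} {ω r w D : ℝ}

/-- The scalar bookkeeping of `Resonant.schur`: `a`, `b`, `c` are the norms of the components in
`Q`, `G`, `S`, while `d` and `e` are those of the first-order response in `G` and of the remainder.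
The bounds on `κ * c` and `D * e` are sharper than those on `c` and `b` suggest, and they are what
makes the back action of order `r w`. -/
lemma schur_bounds {a b c e d r w D ω κ : ℝ} (ha : 0 ≤ a) (hb : 0 ≤ b) (hc : 0 ≤ c) (he : 0 ≤ e)
    (hκ : 0 ≤ κ) (hκ2 : κ ^ 2 = r * w * D) (hD : 0 < D) (hDω : D ≤ ω) (hw : 0 < w)
    (hwr : w ≤ r * D) (hr : 0 < r) (hr1 : r ≤ 1 / 1000)
    (hs : D * c ≤ 2 * w * c + D / 2 * c + κ * (a + b))
    (hbe : b ≤ d + e) (hd : d ≤ r * a)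
    (hE : ω * e ≤ 5 * w * b + κ * c + r * w * a) :
    b ≤ 2 * r * a ∧ c ≤ 4 * r * a ∧ κ * c ≤ 4 * r * w * a ∧ D * e ≤ 11 * r * w * a := by
  have hw1 : w ≤ D / 1000 := by nlinarith
  have hb' : b ≤ r * a + e := by linarith
  -- The terms `2 w c` and `D c / 2` are absorbed on the left, which leaves more than a third of `D
  -- c`.
  have hs1 : D * c ≤ 3 * κ * (a + b) := by
    have := mul_le_mul_of_nonneg_right hw1 hc
    have : 0 ≤ κ * (a + b) := by positivity
    nlinarith
  have hrw : 0 < r * w := by positivity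
  have hks : κ * c ≤ 3 * (r * w) * (a + b) := by
    have h1 : D * (κ * c) ≤ D * (3 * (r * w) * (a + b)) := by
      calc D * (κ * c) = κ * (D * c) := by ring
        _ ≤ κ * (3 * κ * (a + b)) := by gcongr
        _ = 3 * κ ^ 2 * (a + b) := by ring
        _ = _ := by rw [hκ2]; ring
    exact le_of_mul_le_mul_left h1 hD
  have hrw' : r * w ≤ w / 1000 := by nlinarith
  have hra : 0 ≤ r * a := by positivity
  have hDe : D * e ≤ ω * e := by gcongr
  have hrwb : r * w * b ≤ w / 1000 * b := by gcongr
  have h2 : D * e ≤ 10 * (r * w) * a + 6 * w * e := by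
    have : w * b ≤ w * (r * a + e) := by gcongr
    nlinarith [mul_nonneg hw.le hb, mul_nonneg hrw.le ha]
  have h3 : D * e ≤ 11 * r * w * a := by
    have : w * e ≤ D / 1000 * e := by gcongr
    nlinarith [mul_nonneg hrw.le ha, mul_nonneg hD.le he]
  have h4 : e ≤ 11 * r * r * a := by
    have : D * e ≤ D * (11 * r * r * a) := by
      calc D * e ≤ 11 * r * w * a := h3
        _ ≤ 11 * r * (r * D) * a := by gcongr
        _ = _ := by ring
    exact le_of_mul_le_mul_left this hD
  have hrra : r * (r * a) ≤ 1 / 1000 * (r * a) := by gcongr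
  have hb2 : b ≤ 2 * r * a := by nlinarith
  have hrab : r * a ≤ 1 / 1000 * a := by gcongr
  have hκD : κ ≤ r * D := by
    apply le_of_sq_le_sq _ (by positivity)
    calc κ ^ 2 = r * w * D := hκ2
      _ ≤ r * (r * D) * D := by gcongr
      _ = (r * D) ^ 2 := by ring
  refine ⟨hb2, ?_, ?_, h3⟩
  · have : D * c ≤ D * (4 * r * a) := by
      calc D * c ≤ 3 * κ * (a + b) := hs1
        _ ≤ 3 * (r * D) * (a + b) := by gcongr
        _ ≤ 3 * (r * D) * (4 / 3 * a) := by gcongr; linarith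
        _ = _ := by ring
    exact le_of_mul_le_mul_left this hD
  · calc κ * c ≤ 3 * (r * w) * (a + b) := hks
      _ ≤ 3 * (r * w) * (4 / 3 * a) := by gcongr; linarith
      _ = _ := by ring

/-- If `q + p` solves the eigenvalue equation on the complement of `Q`, then `p` is small and it
acts back on `Q` only weakly. -/
theorem schur (R : Resonant h V δ Q G S σ ω r w D) {μ : ℝ} (hμ : |μ| ≤ 2 * w) {q p : E}
    (hq : Q q = q) (hp : Q p = 0)
    (heq : (h + V + δ) (q + p) - (μ : ℂ) • (q + p)
      = Q ((h + V + δ) (q + p) - (μ : ℂ) • (q + p))) :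
    ‖p‖ ≤ 6 * r * ‖q‖ ∧ ‖Q ((V + δ) p)‖ ≤ 6 * r * w * ‖q‖ := by
  have hD := R.D_pos
  have hDω := R.D_le
  have hw := R.w_pos
  have hwr := R.w_le
  have hr := R.r_pos
  have hr1 := R.r_le
  have hω : 0 < ω := hD.trans_le hDω
  set g := G p with hg
  set s := S p with hs
  have hGq : G q = 0 := by rw [← hq, apply_eq R.GQ]; rfl
  have hSq : S q = 0 := by rw [← hq, apply_eq R.SQ]; rfl
  have hpgs : p = g + s := by
    have := congrArg (fun A : E →L[ℂ] E => A p) R.sum_eq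
    simp only [add_apply, one_apply_eq_self, hp, zero_add] at this
    exact this.symm
  have hGg : G g = g := apply_eq R.projG.isIdempotentElem.eq p
  have hSs : S s = s := apply_eq R.projS.isIdempotentElem.eq p
  have hQg : Q g = 0 := by rw [hg, apply_eq R.QG]; rfl
  have hSg : S g = 0 := by rw [hg, apply_eq R.SG]; rfl
  have hGs : G s = 0 := by rw [hs, apply_eq R.GS]; rfl
  have hQs : Q s = 0 := by rw [hs, apply_eq R.QS]; rfl
  have hFq : (Q + G) q = q := by simp [hq, hGq]
  have hFg : (Q + G) g = g := by simp [hQg, hGg]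
  -- The size allowed for the coupling to `S`. A response of relative size `κ / D`, fed back through
  -- another `κ`, returns `κ² / D = r w`.
  set κ := √(r * w * D) with hκ
  have hκ2 : κ ^ 2 = r * w * D := Real.sq_sqrt (by positivity)
  have hcr1 : ‖S * (V + δ) * (Q + G)‖ ≤ κ := Real.le_sqrt_of_sq_le R.crossSF
  have hcr2 : ‖(Q + G) * (V + δ) * S‖ ≤ κ := Real.le_sqrt_of_sq_le R.crossFS
  have nQ : ‖Q‖ ≤ 1 := R.projQ.norm_le
  have nG : ‖G‖ ≤ 1 := R.projG.norm_le
  -- the equation on `S`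
  have hS0 : h s - (μ : ℂ) • s + (S * (V + δ) * S) s + (S * (V + δ) * (Q + G)) (q + g) = 0 := by
    have h1 := congrArg S heq
    rw [apply_eq R.SQ, zero_apply] at h1
    have h2 : S (h (q + p)) = h s := by
      rw [apply_eq R.commS.symm]
      change h (S (q + p)) = _
      rw [map_add, hSq, zero_add]
    have h3 : S (q + p) = s := by rw [map_add, hSq, zero_add]
    simp only [mul_apply_eq_comp, map_add (Q + G), hFq, hFg, hSs]
    simp only [map_sub, map_smul, h3] at h1
    rw [add_assoc h, add_apply, map_add, h2] at h1
    rw [← h1, hpgs]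
    simp only [map_add]
    abel
  have hSb : D * ‖s‖ ≤ 2 * w * ‖s‖ + D / 2 * ‖s‖ + κ * (‖q‖ + ‖g‖) := by
    have e1 : h s = (μ : ℂ) • s - (S * (V + δ) * S) s - (S * (V + δ) * (Q + G)) (q + g) := by
      rw [← sub_eq_zero, ← hS0]; abel
    calc D * ‖s‖ ≤ ‖h s‖ := R.gap s hSs
      _ ≤ ‖(μ : ℂ) • s‖ + ‖(S * (V + δ) * S) s‖ + ‖(S * (V + δ) * (Q + G)) (q + g)‖ := by
        rw [e1]; exact (norm_sub_le _ _).trans (by gcongr; exact norm_sub_le _ _)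
      _ ≤ 2 * w * ‖s‖ + D / 2 * ‖s‖ + κ * (‖q‖ + ‖g‖) := by
        gcongr
        · rw [norm_smul, Complex.norm_real, Real.norm_eq_abs]; gcongr
        · exact norm_apply_le_of_le R.far s
        · exact (norm_apply_le_of_le hcr1 _).trans (by gcongr; exact norm_add_le _ _)
  -- the equation on `G`
  set g₀ := -((ω : ℂ)⁻¹ • σ (V q)) with hg₀
  have hσG : ∀ x, σ (G x) = σ x := apply_eq R.σG
  have hσσ : ∀ x, σ (σ x) = G x := apply_eq R.σσ
  have hGσ : ∀ x, G (σ x) = σ x := fun x => by rw [← hσσ (σ x), hσσ x, hσG]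
  have hGg₀ : G g₀ = g₀ := by simp [hg₀, hGσ]
  have hωc : (ω : ℂ) ≠ 0 := by exact_mod_cast hω.ne'
  set e := g - g₀ with he
  have hGe : G e = e := by rw [he, map_sub, hGg, hGg₀]
  have hσg₀ : (ω : ℂ) • σ g₀ = -G (V q) := by
    simp [hg₀, hσσ, smul_smul, hωc]
  have hG0 : (ω : ℂ) • σ e + ((h * G - (ω : ℂ) • σ) g - (μ : ℂ) • g + (G * V * G) g
      + G (((Q + G) * δ * (Q + G)) (q + g)) + G (((Q + G) * (V + δ) * S) s)) = 0 := by
    have h1 := congrArg G heq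
    rw [apply_eq R.GQ, zero_apply] at h1
    have h2 : G (h (q + p)) = h g := by
      rw [apply_eq R.commG.symm]
      change h (G (q + p)) = _
      rw [map_add, hGq, zero_add]
    have h3 : G (q + p) = g := by rw [map_add, hGq, zero_add]
    have hGF : ∀ x, G ((Q + G) x) = G x := fun x => by
      rw [← mul_apply_eq_comp, mul_add, R.GQ, zero_add, R.projG.isIdempotentElem.eq]
    simp only [map_sub, map_smul, h3] at h1
    rw [add_assoc h, add_apply, map_add, h2] at h1
    simp only [mul_apply_eq_comp, map_add (Q + G), hFq, hFg, hSs, hGF, hGg,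
      sub_apply, smul_apply]
    rw [he, map_sub, smul_sub, hσg₀, ← h1, hpgs]
    simp only [map_add, add_apply]
    abel
  have hrw : 0 < r * w := by positivity
  have hrw' : r * w ≤ w / 1000 := by nlinarith
  have nδ : ‖((Q + G) * δ * (Q + G)) (q + g)‖ ≤ r * w * (‖q‖ + ‖g‖) :=
    (norm_apply_le_of_le R.near _).trans (by gcongr; exact norm_add_le _ _)
  have nW : ‖((Q + G) * (V + δ) * S) s‖ ≤ κ * ‖s‖ := norm_apply_le_of_le hcr2 _
  have hEb : ω * ‖e‖ ≤ 5 * w * ‖g‖ + κ * ‖s‖ + r * w * ‖q‖ := by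
    have e0 : ‖e‖ ≤ ‖σ e‖ := by
      conv_lhs => rw [← hGe, ← hσσ]
      simpa using norm_apply_le_of_le R.norm_σ (σ e)
    have e1 := eq_neg_of_add_eq_zero_left hG0
    calc ω * ‖e‖ ≤ ω * ‖σ e‖ := by gcongr
      _ = ‖(ω : ℂ) • σ e‖ := by rw [norm_smul, Complex.norm_real, Real.norm_of_nonneg hω.le]
      _ ≤ r * w * ‖g‖ + 2 * w * ‖g‖ + 2 * w * ‖g‖ + 1 * (r * w * (‖q‖ + ‖g‖))
          + 1 * (κ * ‖s‖) := by
        rw [e1, norm_neg]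
        refine (norm_add_le _ _).trans (add_le_add ((norm_add_le _ _).trans (add_le_add
          ((norm_add_le _ _).trans (add_le_add ((norm_sub_le _ _).trans (add_le_add ?_ ?_)) ?_))
          ?_)) ?_)
        · exact norm_apply_le_of_le R.norm_hG g
        · rw [norm_smul, Complex.norm_real, Real.norm_eq_abs]; gcongr
        · exact norm_apply_le_of_le R.norm_GVG g
        · exact (norm_apply_le_of_le nG _).trans (by gcongr)
        · exact (norm_apply_le_of_le nG _).trans (by gcongr)
      _ ≤ _ := by
        have := mul_le_mul_of_nonneg_right hrw' (norm_nonneg g)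
        nlinarith [mul_nonneg hw.le (norm_nonneg g)]
  have hd : ‖g₀‖ ≤ r * ‖q‖ := by
    have h1 : σ (V q) = σ ((G * V * Q) q) := by
      simp [hq, hσG]
    rw [hg₀, norm_neg, norm_smul, norm_inv, Complex.norm_real, Real.norm_of_nonneg hω.le, h1,
      inv_mul_le_iff₀ hω]
    calc _ ≤ 1 * ‖(G * V * Q) q‖ := norm_apply_le_of_le R.norm_σ _
      _ ≤ 1 * (r * D * ‖q‖) := by gcongr; exact norm_apply_le_of_le R.norm_GVQ q
      _ ≤ 1 * (r * ω * ‖q‖) := by gcongr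
      _ = _ := by ring
  have hbe : ‖g‖ ≤ ‖g₀‖ + ‖e‖ := by
    have : g = g₀ + e := by rw [he]; abel
    rw [this]; exact norm_add_le _ _
  obtain ⟨k1, k2, k3, k4⟩ := schur_bounds (norm_nonneg q) (norm_nonneg g) (norm_nonneg s)
    (norm_nonneg e) (Real.sqrt_nonneg _) hκ2 hD hDω hw hwr hr hr1 hSb hbe hd hEb
  refine ⟨?_, ?_⟩
  · rw [hpgs]
    exact (norm_add_le _ _).trans (by linarith)
  -- The part of `V g` due to `g₀` is the second-order shift `Q V σ V Q`. The other part involves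
  -- only the remainder `e`, for which the crude bound `r D` on the coupling suffices.
  · have e1 : Q ((V + δ) p) = Q (((Q + G) * (V + δ) * S) s) + Q (((Q + G) * δ * (Q + G)) g)
        + (Q * V * G) e - (ω : ℂ)⁻¹ • (Q * V * σ * V * Q) q := by
      have hQF : ∀ x, Q ((Q + G) x) = Q x := fun x => by
        rw [← mul_apply_eq_comp, mul_add, R.QG, add_zero, R.projQ.isIdempotentElem.eq]
      simp only [mul_apply_eq_comp, hFg, hSs, hQF, hGe, hq]
      have : g = e - (ω : ℂ)⁻¹ • σ (V q) := by rw [he, hg₀]; abel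
      have hV : Q (V g) = Q (V e) - (ω : ℂ)⁻¹ • Q (V (σ (V q))) := by
        conv_lhs => rw [this]
        simp
      rw [hpgs, map_add (V + δ), add_apply _ _ g, map_add, map_add, hV]
      abel
    have hrwq : 0 ≤ r * w * ‖q‖ := by positivity
    have t1 : ‖Q (((Q + G) * (V + δ) * S) s)‖ ≤ 4 * r * w * ‖q‖ := by
      refine (norm_apply_le_of_le nQ _).trans ?_
      linarith
    have t2 : ‖Q (((Q + G) * δ * (Q + G)) g)‖ ≤ r * w * (2 * r * ‖q‖) := by
      refine (norm_apply_le_of_le nQ _).trans ?_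
      rw [one_mul]
      exact (norm_apply_le_of_le R.near _).trans (by gcongr)
    have t3 : ‖(Q * V * G) e‖ ≤ r * (11 * r * w * ‖q‖) := by
      refine (norm_apply_le_of_le R.norm_QVG _).trans ?_
      rw [mul_assoc]; gcongr
    have t4 : ‖(ω : ℂ)⁻¹ • (Q * V * σ * V * Q) q‖ ≤ r * w * ‖q‖ := by
      rw [norm_smul, norm_inv, Complex.norm_real, Real.norm_of_nonneg hω.le, inv_mul_le_iff₀ hω]
      refine (norm_apply_le_of_le R.second_order _).trans (le_of_eq (by ring))
    rw [e1]
    have := mul_le_mul_of_nonneg_right hr1 hrwq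
    refine (norm_sub_le _ _).trans ?_
    refine (add_le_add ((norm_add_le _ _).trans (add_le_add ((norm_add_le _ _).trans
      (add_le_add t1 t2)) t3)) t4).trans ?_
    nlinarith

end Resonant

end Resonance

end

noncomputable section

/-! ### Nearly stationary states and Rabi oscillations -/

section Flow

variable {E : Type*} [NormedAddCommGroup E] [InnerProductSpace ℂ E]

lemma norm_le_of_inner_le {κ : Type*} [Fintype κ] (b : OrthonormalBasis κ ℂ E) {c : ℝ}
    (hc : 0 ≤ c) {x y : E} (h : ∀ i, c * ‖inner ℂ (b i) x‖ ≤ ‖inner ℂ (b i) y‖) :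
    c * ‖x‖ ≤ ‖y‖ := by
  refine le_of_sq_le_sq ?_ (norm_nonneg _)
  rw [mul_pow, ← b.sum_sq_norm_inner_right, ← b.sum_sq_norm_inner_right, Finset.mul_sum]
  refine Finset.sum_le_sum fun i _ => ?_
  rw [← mul_pow]
  exact pow_le_pow_left₀ (by positivity) (h i) 2

/-- The operator `1 + |v⟩⟨v|` is bounded below by 1. This expresses the gap between the eigenvalue
`ν` of the effective Hamiltonian and its other eigenvalues `-ν` and 0. -/
lemma sub_inner_smul_norm_sq {v : E} (hv : ‖v‖ = 1) (y : E) :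
    ‖y‖ ^ 2 ≤ ‖y + (inner ℂ v y : ℂ) • v‖ ^ 2 := by
  rw [@norm_add_sq ℂ, inner_smul_right, norm_smul, hv]
  have : RCLike.re ((inner ℂ v y : ℂ) * inner ℂ y v) = ‖(inner ℂ v y : ℂ)‖ ^ 2 := by
    rw [← inner_conj_symm y v, RCLike.mul_conj]
    norm_cast
  rw [this]
  nlinarith [sq_nonneg ‖(inner ℂ v y : ℂ)‖]

variable [CompleteSpace E]

lemma inner_apply_left {A : E →L[ℂ] E} (hA : IsSelfAdjoint A) (x y : E) :
    (inner ℂ (A x) y : ℂ) = inner ℂ x (A y) :=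
  (ContinuousLinearMap.isSelfAdjoint_iff_isSymmetric.mp hA) x y

/-- Expand in an eigenbasis: if every eigenvalue were further than `η` from `μ`, each coefficient of
the residual would be too large. Nothing is claimed about how close the eigenvector is to `x`. -/
lemma eigenvalue_quasimode [FiniteDimensional ℂ E] {A : E →L[ℂ] E} (hA : IsSelfAdjoint A)
    {x : E} {μ η : ℝ} (hx : 1 ≤ ‖x‖) (h : ‖A x - (μ : ℂ) • x‖ ≤ η) :
    ∃ (ev : ℝ) (u : E), ‖u‖ = 1 ∧ A u = (ev : ℂ) • u ∧ |ev - μ| ≤ η := by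
  have hs : (A : E →ₗ[ℂ] E).IsSymmetric := ContinuousLinearMap.isSelfAdjoint_iff_isSymmetric.mp hA
  set b := hs.eigenvectorBasis rfl
  set ev := hs.eigenvalues rfl
  have hb : ∀ i, A (b i) = (ev i : ℂ) • b i := fun i => hs.apply_eigenvectorBasis rfl i
  have hne : Nonempty (Fin (Module.finrank ℂ E)) := by
    by_contra hcon
    rw [not_nonempty_iff] at hcon
    have := b.sum_sq_norm_inner_right x
    rw [Finset.univ_eq_empty, Finset.sum_empty] at this
    nlinarith
  obtain ⟨i, hi⟩ := Finite.exists_min (fun i => |ev i - μ|)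
  refine ⟨ev i, b i, b.orthonormal.1 i, hb i, ?_⟩
  have key : |ev i - μ| * ‖x‖ ≤ ‖A x - (μ : ℂ) • x‖ := by
    refine norm_le_of_inner_le b (abs_nonneg _) fun j => ?_
    have : (inner ℂ (b j) (A x - (μ : ℂ) • x) : ℂ) = ((ev j - μ : ℝ) : ℂ) * inner ℂ (b j) x := by
      rw [inner_sub_right, ← inner_apply_left hA, hb, inner_smul_left, inner_smul_right]
      simp; ring
    rw [this, norm_mul, Complex.norm_real, Real.norm_eq_abs]
    exact mul_le_mul_of_nonneg_right (hi j) (norm_nonneg _)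
  nlinarith [abs_nonneg (ev i - μ)]

/-- The unitary group `exp(-i t A)`. -/
def flow (A : E →L[ℂ] E) (t : ℝ) : E →L[ℂ] E := NormedSpace.exp ((-Complex.I * (t : ℂ)) • A)

lemma flow_eigenvector {A : E →L[ℂ] E} {u : E} {c : ℂ} (h : A u = c • u) (t : ℝ) :
    flow A t u = Complex.exp (-Complex.I * t * c) • u := by
  have hpow : ∀ n : ℕ, (((-Complex.I * (t : ℂ)) • A) ^ n) u = (-Complex.I * t * c) ^ n • u := by
    intro n
    induction n with
    | zero => simp
    | succ n ih =>
      rw [pow_succ, mul_apply_eq_comp, smul_apply, h, smul_smul, map_smul, ih, smul_smul,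
        pow_succ, mul_comm]
  have h1 := (ContinuousLinearMap.apply ℂ E u).hasSum
    (NormedSpace.exp_series_hasSum_exp' (𝕂 := ℂ) ((-Complex.I * (t : ℂ)) • A))
  have h2 := (NormedSpace.exp_series_hasSum_exp' (𝕂 := ℂ) (-Complex.I * t * c)).smul_const u
  have h3 : (fun n : ℕ => (ContinuousLinearMap.apply ℂ E u)
      (((n.factorial : ℂ)⁻¹) • ((-Complex.I * (t : ℂ)) • A) ^ n))
      = fun n : ℕ => (((n.factorial : ℂ)⁻¹) • (-Complex.I * t * c) ^ n) • u := by
    funext n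
    simp only [ContinuousLinearMap.apply_apply, smul_apply, hpow, smul_assoc]
  have h4 := h1.unique (h3 ▸ h2)
  rw [← Complex.exp_eq_exp_ℂ] at h4
  exact h4

lemma flow_mem_unitary {A : E →L[ℂ] E} (hA : IsSelfAdjoint A) (t : ℝ) :
    flow A t ∈ unitary (E →L[ℂ] E) := by
  let _ : NormedAlgebra ℚ (E →L[ℂ] E) := NormedAlgebra.restrictScalars ℚ ℂ _
  refine NormedSpace.exp_mem_unitary_of_mem_skewAdjoint ?_
  rw [skewAdjoint.mem_iff, star_smul, hA.star_eq, ← neg_smul]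
  simp

lemma norm_flow_apply {A : E →L[ℂ] E} (hA : IsSelfAdjoint A) (t : ℝ) (x : E) :
    ‖flow A t x‖ = ‖x‖ :=
  ContinuousLinearMap.norm_map_of_mem_unitary (flow_mem_unitary hA t) x

lemma star_flow {A : E →L[ℂ] E} (hA : IsSelfAdjoint A) (t : ℝ) : star (flow A t) = flow A (-t) := by
  rw [flow, NormedSpace.star_exp, star_smul, hA.star_eq, flow]
  simp

lemma inner_flow_right {A : E →L[ℂ] E} (hA : IsSelfAdjoint A) (t : ℝ) (x y : E) :
    (inner ℂ x (flow A t y) : ℂ) = inner ℂ (flow A (-t) x) y := by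
  rw [← star_flow hA, ContinuousLinearMap.star_eq_adjoint, ContinuousLinearMap.adjoint_inner_left]

namespace Resonant

variable {h V δ Q G S σ : E →L[ℂ] E} {ω r w D : ℝ}

/-- Inside the resonant block, `h` and `δ` contribute at most `r w` each, so the compressed
Hamiltonian is `Q V Q` up to `2 r w`. -/
lemma Q_eq (R : Resonant h V δ Q G S σ ω r w D) {q : E} (hq : Q q = q) {ν : ℂ} :
    ‖Q ((h + V + δ) q - ν • q) - (Q (V q) - ν • q)‖ ≤ 2 * r * w * ‖q‖ := by
  have hGq : G q = 0 := by rw [← hq, apply_eq R.GQ]; rfl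
  have e : Q ((h + V + δ) q - ν • q) - (Q (V q) - ν • q)
      = (h * Q) q + Q (((Q + G) * δ * (Q + G)) q) := by
    have hQF : ∀ x, Q ((Q + G) x) = Q x := fun x => by
      rw [← mul_apply_eq_comp, mul_add, R.QG, add_zero, R.projQ.isIdempotentElem.eq]
    rw [R.commQ]
    simp only [mul_apply_eq_comp, hQF]
    simp only [map_sub, map_add, map_smul, hq, add_apply, hGq, add_zero]
    abel
  rw [e]
  have h1 := norm_apply_le_of_le R.norm_hQ q
  have h2 := norm_apply_le_of_le R.near q
  have h3 := norm_apply_le_of_le R.projQ.norm_le (((Q + G) * δ * (Q + G)) q)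
  refine (norm_add_le _ _).trans ?_
  linarith

/-- The equation off `Q` is a square linear system for `p`. A homogeneous solution would satisfy
`Resonant.schur` with `q = 0` and so vanish; in finite dimension, injectivity gives solvability. -/
lemma exists_dressing [FiniteDimensional ℂ E] (R : Resonant h V δ Q G S σ ω r w D) {ν : ℝ}
    (hν : |ν| ≤ 2 * w) (v : E) :
    ∃ p, Q p = 0 ∧ (h + V + δ) (v + p) - (ν : ℂ) • (v + p)
      = Q ((h + V + δ) (v + p) - (ν : ℂ) • (v + p)) := by
  have hQQ : ∀ x, Q (Q x) = Q x := apply_eq R.projQ.isIdempotentElem.eq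
  set B : E →L[ℂ] E := h + V + δ - (ν : ℂ) • 1 with hB
  have hBx : ∀ x, B x = (h + V + δ) x - (ν : ℂ) • x := fun x => by simp [hB]
  -- Adding `Q` to the compression of `B` to the complement makes the system an endomorphism of the
  -- whole space, so that injectivity implies surjectivity.
  set L : E →L[ℂ] E := (1 - Q) * B * (1 - Q) + Q with hL
  have hQL : ∀ x, Q (L x) = Q x := fun x => by simp [hL, hQQ]
  have hinj : Function.Injective (L : E →ₗ[ℂ] E) := by
    rw [injective_iff_map_eq_zero]
    intro p hp
    have hp' : L p = 0 := hp
    have hQp : Q p = 0 := by rw [← hQL, hp', map_zero]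
    have hBp : B p = Q (B p) := by
      rw [hL] at hp'
      simpa [hQp, sub_eq_zero] using hp'
    have := (R.schur hν (q := 0) (p := p) (map_zero _) hQp (by
      rw [zero_add, ← hBx]; exact hBp)).1
    simpa using this
  obtain ⟨p, hp⟩ := LinearMap.surjective_of_injective hinj (-(B v - Q (B v)))
  have hp' : L p = -(B v - Q (B v)) := hp
  have hQp : Q p = 0 := by rw [← hQL, hp']; simp [hQQ]
  refine ⟨p, hQp, ?_⟩
  rw [← hBx, map_add B, map_add Q]
  have : B p - Q (B p) = -(B v - Q (B v)) := by
    rw [← hp', hL]; simp [hQp]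
  rw [← sub_eq_zero] at this ⊢
  rw [← this]; abel

/-- A simple eigenvector of the effective Hamiltonian `Q V Q` persists as a nearly stationary
state of the full evolution. -/
theorem exists_nearly_stationary [FiniteDimensional ℂ E]
    (R : Resonant h V δ Q G S σ ω r w D) (hA : IsSelfAdjoint (h + V + δ)) {ν : ℝ} (hν : |ν| = w)
    {v v' : E} (hv : ‖v‖ = 1) (hv' : ‖v'‖ = 1) (hvv : (inner ℂ v' v : ℂ) = 0) (hQv : Q v = v)
    (hM : ∀ x, Q x = x →
      Q (V x) = (ν : ℂ) • ((inner ℂ v x : ℂ) • v - (inner ℂ v' x : ℂ) • v')) :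
    ∃ ev : ℝ, |ev - ν| ≤ 8 * r * w ∧
      ∀ t, ‖flow (h + V + δ) t v - Complex.exp (-Complex.I * t * ev) • v‖ ≤ 100 * r := by
  have hw := R.w_pos
  have hr := R.r_pos
  have hr1 := R.r_le
  have hQQ : ∀ x, Q (Q x) = Q x := apply_eq R.projQ.isIdempotentElem.eq
  have hQp : ∀ x, Q (x - Q x) = 0 := fun x => by rw [map_sub, hQQ, sub_self]
  have hMv : Q (V v) = (ν : ℂ) • v := by
    rw [hM v hQv, hvv, inner_self_eq_norm_sq_to_K, hv]; simp
  obtain ⟨p, hp, hpe⟩ := R.exists_dressing (hν.le.trans (by linarith)) v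
  obtain ⟨-, b2⟩ := R.schur (hν.le.trans (by linarith)) hQv hp hpe
  have hsplit : ∀ (μ : ℂ) (x y : E), Q y = 0 → Q ((h + V + δ) (x + y) - μ • (x + y))
      = Q ((h + V + δ) x - μ • x) + Q ((V + δ) y) := by
    intro μ x y hy
    have hhy : Q (h y) = 0 := by
      rw [apply_eq R.commQ.symm]; change h (Q y) = 0; rw [hy, map_zero]
    have : (h + V + δ) y = h y + (V + δ) y := by simp [add_assoc]
    rw [map_add (h + V + δ), smul_add, add_sub_add_comm, map_add Q, map_sub Q ((h + V + δ) y),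
      map_smul, hy, this, map_add Q (h y), hhy]
    simp
  -- The compressed Hamiltonian contributes `2 r w` and the back action of the dressing `6 r w`.
  have hres : ‖(h + V + δ) (v + p) - (ν : ℂ) • (v + p)‖ ≤ 8 * r * w := by
    rw [hpe, hsplit _ _ _ hp]
    have := R.Q_eq hQv (ν := ν)
    rw [hMv, sub_self, sub_zero, hv] at this
    rw [hv] at b2
    exact (norm_add_le _ _).trans (by linarith)
  have hvp : 1 ≤ ‖v + p‖ := by
    have := norm_apply_le_of_le R.projQ.norm_le (v + p)
    rwa [map_add, hQv, hp, add_zero, hv, one_mul] at this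
  obtain ⟨ev, u, hu, hAu, hev⟩ := eigenvalue_quasimode hA hvp hres
  refine ⟨ev, hev, ?_⟩
  have hev2 : |ev| ≤ 2 * w := by
    have h1 : |ev| ≤ |ev - ν| + |ν| := by
      simpa using abs_add_le (ev - ν) ν
    have : 8 * r * w ≤ w := by nlinarith
    linarith
  set q := Q u with hq
  have hQq : Q q = q := hQQ u
  have hqn : ‖q‖ ≤ 1 := by
    have := norm_apply_le_of_le R.projQ.norm_le u
    rwa [hu, one_mul] at this
  have huq : q + (u - q) = u := by abel
  have hz : (h + V + δ) (q + (u - q)) - (ev : ℂ) • (q + (u - q)) = 0 := by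
    rw [huq, hAu, sub_self]
  -- The estimate is now applied to the exact eigenvector `u`. Its resonant part `q` is therefore an
  -- approximate eigenvector of `Q V Q` for `ν`, with error `(8 + 6 + 2) r w`, and the gap `w`
  -- around `ν` forces `q` to be close to a multiple of `v`.
  obtain ⟨c1, c2⟩ := R.schur hev2 hQq (hQp u) (by rw [hz, map_zero])
  have hq1 : ‖Q (V q) - (ν : ℂ) • q‖ ≤ 16 * r * w * ‖q‖ := by
    have h0 := hsplit ev q (u - q) (hQp u)
    rw [hz, map_zero] at h0
    have h1 := R.Q_eq hQq (ν := ev)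
    have h2 : Q (V q) - (ν : ℂ) • q = ((ev - ν : ℝ) : ℂ) • q - Q ((V + δ) (u - q))
        - (Q ((h + V + δ) q - (ev : ℂ) • q) - (Q (V q) - (ev : ℂ) • q)) := by
      rw [eq_neg_of_add_eq_zero_left h0.symm, Complex.ofReal_sub, sub_smul]
      abel
    rw [h2]
    refine (norm_sub_le _ _).trans ((add_le_add ((norm_sub_le _ _).trans (add_le_add ?_ c2))
      h1).trans (le_of_eq (?_ : 8 * r * w * ‖q‖ + _ + _ = _)))
    · rw [norm_smul, Complex.norm_real, Real.norm_eq_abs]; gcongr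
    · ring
  set a : ℂ := inner ℂ v q with ha
  have hqa : ‖q - a • v‖ ≤ 16 * r := by
    have h1 : Q (V q) - (ν : ℂ) • q
        = -((ν : ℂ) • ((q - a • v) + (inner ℂ v' (q - a • v) : ℂ) • v')) := by
      rw [hM q hQq, inner_sub_right, inner_smul_right, hvv, mul_zero, sub_zero, ← smul_sub,
        ← smul_neg]
      congr 1; abel
    have h2 := sub_inner_smul_norm_sq hv' (q - a • v)
    have h3 := le_of_sq_le_sq h2 (norm_nonneg _)
    rw [h1, norm_neg, norm_smul, Complex.norm_real, Real.norm_eq_abs, hν] at hq1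
    have h4 : w * ‖q - a • v‖ ≤ w * (16 * r) := by
      calc _ ≤ _ := mul_le_mul_of_nonneg_left h3 hw.le
        _ ≤ 16 * r * w * ‖q‖ := hq1
        _ ≤ 16 * r * w * 1 := by gcongr
        _ = _ := by ring
    exact le_of_mul_le_mul_left h4 hw
  have hua : ‖u - a • v‖ ≤ 22 * r := by
    have : u - a • v = (u - q) + (q - a • v) := by abel
    rw [this]
    have : 6 * r * ‖q‖ ≤ 6 * r * 1 := by gcongr
    exact (norm_add_le _ _).trans (by linarith)
  have ha1 : 1 / 2 ≤ ‖a‖ := by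
    have h1 : ‖u‖ ≤ ‖u - a • v‖ + ‖a • v‖ := by simpa using norm_add_le (u - a • v) (a • v)
    rw [hu, norm_smul, hv, mul_one] at h1
    linarith
  intro t
  -- The exact eigenvector only acquires a phase, so the error of `a • v` at any time is at most
  -- twice its initial distance `22 r` from `u`.
  have hfl : flow (h + V + δ) t (a • v) - Complex.exp (-Complex.I * t * ev) • (a • v)
      = Complex.exp (-Complex.I * t * ev) • (u - a • v) - flow (h + V + δ) t (u - a • v) := by
    rw [map_sub, flow_eigenvector hAu, smul_sub]; abel
  have hn : ‖a‖ * ‖flow (h + V + δ) t v - Complex.exp (-Complex.I * t * ev) • v‖ ≤ 44 * r := by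
    rw [← norm_smul, smul_sub, ← map_smul, smul_comm a, hfl]
    refine (norm_sub_le _ _).trans ?_
    have hexp : ‖Complex.exp (-Complex.I * t * ev)‖ = 1 := by
      rw [show -Complex.I * t * ev = ((-t * ev : ℝ) : ℂ) * Complex.I by push_cast; ring]
      exact Complex.norm_exp_ofReal_mul_I _
    rw [norm_flow_apply hA, norm_smul, hexp]
    linarith
  nlinarith [norm_nonneg (flow (h + V + δ) t v - Complex.exp (-Complex.I * t * ev) • v)]

/-- Two resonant states coupled with strength `w` undergo Rabi oscillations for all times. -/
theorem rabi [FiniteDimensional ℂ E]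
    (R : Resonant h V δ Q G S σ ω r w D) (hA : IsSelfAdjoint (h + V + δ))
    {e₁ e₂ : E} (h1 : ‖e₁‖ = 1) (h2 : ‖e₂‖ = 1) (h12 : (inner ℂ e₁ e₂ : ℂ) = 0) (hQ1 : Q e₁ = e₁)
    (hQ2 : Q e₂ = e₂)
    (hM : ∀ x, Q x = x →
      Q (V x) = (w : ℂ) • ((inner ℂ e₂ x : ℂ) • e₁ + (inner ℂ e₁ x : ℂ) • e₂)) :
    ∃ w' : ℝ, |w' - w| ≤ 8 * r * w ∧ ∀ t, ∃ z : ℂ, ‖z‖ = 1 ∧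
      ‖flow (h + V + δ) t e₂ -
        z • ((Real.cos (w' * t) : ℂ) • e₂ - (Complex.I * Real.sin (w' * t)) • e₁)‖ ≤ 200 * r := by
  have h21 : (inner ℂ e₂ e₁ : ℂ) = 0 := by rw [← inner_conj_symm, h12, map_zero]
  have h11 : (inner ℂ e₁ e₁ : ℂ) = 1 := by rw [inner_self_eq_norm_sq_to_K, h1]; simp
  have h22 : (inner ℂ e₂ e₂ : ℂ) = 1 := by rw [inner_self_eq_norm_sq_to_K, h2]; simp
  set s : ℂ := (((√2)⁻¹ : ℝ) : ℂ) with hs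
  have hss : s * s = 2⁻¹ := by
    rw [hs, ← Complex.ofReal_mul, ← mul_inv, Real.mul_self_sqrt (by norm_num)]; simp
  have hsc : (starRingEnd ℂ) s = s := Complex.conj_ofReal _
  have hsn : ‖s‖ ≤ 1 := by
    rw [hs, Complex.norm_real, Real.norm_of_nonneg (by positivity)]
    exact inv_le_one_of_one_le₀ (Real.one_le_sqrt.mpr (by norm_num))
  set v := s • (e₁ + e₂) with hv
  set v' := s • (e₁ - e₂) with hv'
  have nv : ‖v‖ = 1 := by
    rw [← pow_left_inj₀ (norm_nonneg _) zero_le_one two_ne_zero, one_pow]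
    have : ((‖v‖ ^ 2 : ℝ) : ℂ) = 1 := by
      have := inner_self_eq_norm_sq_to_K (𝕜 := ℂ) v
      push_cast
      rw [← Complex.coe_algebraMap] at *
      rw [← this, hv, inner_smul_left, inner_smul_right, hsc, ← mul_assoc, hss]
      simp only [inner_add_left, inner_add_right, h11, h12, h21, h22]; norm_num
    exact_mod_cast this
  have nv' : ‖v'‖ = 1 := by
    rw [← pow_left_inj₀ (norm_nonneg _) zero_le_one two_ne_zero, one_pow]
    have : ((‖v'‖ ^ 2 : ℝ) : ℂ) = 1 := by
      have := inner_self_eq_norm_sq_to_K (𝕜 := ℂ) v'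
      push_cast
      rw [← Complex.coe_algebraMap] at *
      rw [← this, hv', inner_smul_left, inner_smul_right, hsc, ← mul_assoc, hss]
      simp only [inner_sub_left, inner_sub_right, h11, h12, h21, h22]; norm_num
    exact_mod_cast this
  have hvv : (inner ℂ v' v : ℂ) = 0 := by
    rw [hv, hv', inner_smul_left, inner_smul_right]
    simp only [inner_add_right, inner_sub_left, h11, h12, h21, h22]; simp
  have hvv' : (inner ℂ v v' : ℂ) = 0 := by rw [← inner_conj_symm, hvv, map_zero]
  have hM1 : ∀ x, Q x = x →
      Q (V x) = (w : ℂ) • ((inner ℂ v x : ℂ) • v - (inner ℂ v' x : ℂ) • v') := by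
    intro x hx
    rw [hM x hx, hv, hv', inner_smul_left, inner_smul_left, hsc, inner_add_left, inner_sub_left,
      smul_smul, smul_smul, mul_right_comm s,
      mul_right_comm s (inner ℂ e₁ x - inner ℂ e₂ x), hss]
    module
  have hM2 : ∀ x, Q x = x →
      Q (V x) = ((-w : ℝ) : ℂ) • ((inner ℂ v' x : ℂ) • v' - (inner ℂ v x : ℂ) • v) := by
    intro x hx
    rw [hM1 x hx]; push_cast; module
  obtain ⟨ev1, d1, f1⟩ := R.exists_nearly_stationary hA (abs_of_pos R.w_pos) nv nv' hvv
    (by rw [hv, map_smul, map_add, hQ1, hQ2]) hM1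
  obtain ⟨ev2, d2, f2⟩ := R.exists_nearly_stationary hA
    (by rw [abs_neg]; exact abs_of_pos R.w_pos) nv' nv hvv'
    (by rw [hv', map_smul, map_sub, hQ1, hQ2]) hM2
  -- The half difference of the two energies, near `w` and `-w`, is the Rabi frequency; their mean
  -- only enters the common phase `z`.
  refine ⟨(ev1 - ev2) / 2, ?_, fun t => ?_⟩
  · rw [abs_le] at *
    constructor <;> linarith [d1.1, d1.2, d2.1, d2.2]
  · refine ⟨Complex.exp (((-(t * (ev1 + ev2) / 2) : ℝ) : ℂ) * Complex.I),
      Complex.norm_exp_ofReal_mul_I _, ?_⟩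
    set z := Complex.exp (((-(t * (ev1 + ev2) / 2) : ℝ) : ℂ) * Complex.I)
    set θ : ℝ := (ev1 - ev2) / 2 * t with hθ
    have x1 : Complex.exp (-Complex.I * t * ev1)
        = z * (Real.cos θ - Complex.I * Real.sin θ) := by
      have : (Real.cos θ - Complex.I * Real.sin θ : ℂ) = Complex.exp (-θ * Complex.I) := by
        rw [Complex.exp_mul_I, Complex.cos_neg, Complex.sin_neg]; push_cast; ring
      rw [this, ← Complex.exp_add]
      congr 1; rw [hθ]; push_cast; ring
    have x2 : Complex.exp (-Complex.I * t * ev2)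
        = z * (Real.cos θ + Complex.I * Real.sin θ) := by
      have : (Real.cos θ + Complex.I * Real.sin θ : ℂ) = Complex.exp (θ * Complex.I) := by
        rw [Complex.exp_mul_I]; push_cast; ring
      rw [this, ← Complex.exp_add]
      congr 1; rw [hθ]; push_cast; ring
    have e2 : e₂ = s • (v - v') := by
      rw [hv, hv', ← smul_sub, smul_smul, hss]; module
    have key : flow (h + V + δ) t e₂ -
        z • ((Real.cos θ : ℂ) • e₂ - (Complex.I * Real.sin θ) • e₁)
        = s • ((flow (h + V + δ) t v - Complex.exp (-Complex.I * t * ev1) • v)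
          - (flow (h + V + δ) t v' - Complex.exp (-Complex.I * t * ev2) • v')) := by
      have e3 : z • ((Real.cos θ : ℂ) • e₂ - (Complex.I * Real.sin θ) • e₁) =
          s • (Complex.exp (-Complex.I * t * ev1) • v
            - Complex.exp (-Complex.I * t * ev2) • v') := by
        rw [x1, x2, smul_sub s, smul_comm s _ v, smul_comm s _ v', hv, hv', smul_smul s, smul_smul s,
          hss]
        module
      rw [e3]
      conv_lhs => rw [e2]
      rw [map_smul, map_sub]
      module
    rw [key, norm_smul]
    have := norm_sub_le (flow (h + V + δ) t v - Complex.exp (-Complex.I * t * ev1) • v)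
      (flow (h + V + δ) t v' - Complex.exp (-Complex.I * t * ev2) • v')
    calc _ ≤ 1 * (100 * r + 100 * r) := by
          gcongr
          exact this.trans (add_le_add (f1 t) (f2 t))
      _ = _ := by ring

end Resonant

end Flow

end

noncomputable section

/-! ### A one-sided `sin θ` theorem -/

section DavisKahan

variable {E : Type*} [NormedAddCommGroup E] [InnerProductSpace ℂ E]

lemma exists_norm_eq_opNorm [FiniteDimensional ℂ E] [Nontrivial E] (X : E →L[ℂ] E) : ∃ y, ‖y‖ = 1 ∧ ‖X y‖ = ‖X‖ := by
  have : ProperSpace E := FiniteDimensional.proper ℂ E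
  obtain ⟨y, hy, hmax⟩ := (isCompact_sphere (0 : E) 1).exists_isMaxOn
    (by
      obtain ⟨v, hv⟩ := exists_norm_eq E zero_le_one
      exact ⟨v, by simpa using hv⟩)
    X.continuous.norm.continuousOn
  have hy1 : ‖y‖ = 1 := by simpa using hy
  refine ⟨y, hy1, le_antisymm (by simpa [hy1] using X.le_opNorm y) ?_⟩
  refine X.opNorm_le_bound (norm_nonneg _) fun x => ?_
  by_cases hx : x = 0
  · simp [hx]
  have hx0 : 0 < ‖x‖ := norm_pos_iff.mpr hx
  have h1 : ‖X (((‖x‖⁻¹ : ℝ) : ℂ) • x)‖ ≤ ‖X y‖ := hmax (by simp [norm_smul, hx0.ne'])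
  rw [map_smul, norm_smul, Complex.norm_real, norm_inv, norm_norm, inv_mul_le_iff₀ hx0] at h1
  linarith

variable [CompleteSpace E]

/-- At a maximizing unit vector, `X* X y` has norm at most `‖X‖²` and its inner product with `y`
equals `‖X‖²`. This is the case of equality in Cauchy-Schwarz. -/
lemma adjoint_apply_of_norm_eq {X : E →L[ℂ] E} {y : E} (hy : ‖y‖ = 1) (h : ‖X y‖ = ‖X‖) :
    (star X) (X y) = ((‖X‖ ^ 2 : ℝ) : ℂ) • y := by
  rw [← sub_eq_zero, ← norm_eq_zero]
  have h1 : ‖(star X) (X y)‖ ≤ ‖X‖ ^ 2 := by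
    have := (star X).le_opNorm (X y)
    rw [norm_star, h] at this
    nlinarith
  have h2 : (RCLike.re (inner ℂ ((star X) (X y)) (((‖X‖ ^ 2 : ℝ) : ℂ) • y) : ℂ) : ℝ)
      = ‖X‖ ^ 4 := by
    rw [ContinuousLinearMap.star_eq_adjoint, ContinuousLinearMap.adjoint_inner_left, map_smul,
      inner_smul_right, inner_self_eq_norm_sq_to_K, h]
    change (((‖X‖ ^ 2 : ℝ) : ℂ) * (‖X‖ : ℂ) ^ 2).re = _
    rw [← Complex.ofReal_pow, ← Complex.ofReal_mul, Complex.ofReal_re]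
    ring
  have h3 := @norm_sub_sq ℂ E _ _ _ ((star X) (X y)) (((‖X‖ ^ 2 : ℝ) : ℂ) • y)
  rw [h2, norm_smul, hy, Complex.norm_real, Real.norm_of_nonneg (by positivity)] at h3
  have h4 := norm_nonneg ((star X) (X y))
  have h5 : ‖(star X) (X y)‖ ^ 2 ≤ (‖X‖ ^ 2) ^ 2 := pow_le_pow_left₀ h4 h1 2
  have h6 : ‖(star X) (X y) - ((‖X‖ ^ 2 : ℝ) : ℂ) • y‖ ^ 2 ≤ 0 := by nlinarith
  exact pow_eq_zero_iff two_ne_zero |>.mp (le_antisymm h6 (sq_nonneg _))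

/-- The `sin θ` theorem for spectral subspaces separated by a gap. -/
theorem norm_mul_le_of_gap [FiniteDimensional ℂ E] {A B P R : E →L[ℂ] E} {a b : ℝ} (hP : IsStarProjection P)
    (hR : IsStarProjection R) (hAP : A * P = P * A)
    (hBR : B * R = R * B) (ha : ∀ x, P x = x → a * ‖x‖ ^ 2 ≤ RCLike.re (inner ℂ x (A x) : ℂ))
    (hb : ∀ y, R y = y → RCLike.re (inner ℂ y (B y) : ℂ) ≤ b * ‖y‖ ^ 2) (hab : b < a) :
    ‖P * R‖ ≤ ‖A - B‖ / (a - b) := by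
  rw [le_div_iff₀ (sub_pos.mpr hab)]
  by_cases h0 : ‖P * R‖ = 0
  · rw [h0, zero_mul]; exact norm_nonneg _
  have hpos : 0 < ‖P * R‖ := lt_of_le_of_ne (norm_nonneg _) (Ne.symm h0)
  have : Nontrivial E := by
    by_contra hE
    rw [not_nontrivial_iff_subsingleton] at hE
    exact h0 (by rw [Subsingleton.elim (P * R) 0, norm_zero])
  obtain ⟨y, hy, hXy⟩ := exists_norm_eq_opNorm (P * R)
  have hstar := adjoint_apply_of_norm_eq hy hXy
  set s := ‖P * R‖ with hs
  have hPP : ∀ x, P (P x) = P x := apply_eq hP.isIdempotentElem.eq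
  have hRR : ∀ x, R (R x) = R x := apply_eq hR.isIdempotentElem.eq
  rw [star_mul, hP.isSelfAdjoint.star_eq, hR.isSelfAdjoint.star_eq] at hstar
  have hstar' : R (P (R y)) = ((s ^ 2 : ℝ) : ℂ) • y := by
    simpa [mul_apply_eq_comp, hPP] using hstar
  have hs2 : ((s ^ 2 : ℝ) : ℂ) ≠ 0 := by exact_mod_cast (pow_pos hpos 2).ne'
  -- The maximizer is an eigenvector of `R P R` with nonzero eigenvalue `s ^ 2`, so it lies in the
  -- range of `R`.
  have hRy : R y = y := by
    have h1 := congrArg R hstar'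
    rw [hRR, hstar', map_smul] at h1
    exact (smul_right_injective E hs2 h1).symm
  rw [hRy] at hstar'
  set x := P y with hx
  have hPx : P x = x := hPP y
  have hxn : ‖x‖ = s := by
    rw [← hXy, mul_apply_eq_comp, hRy]
  -- With `x = P y`, commutation turns `⟨x, A y⟩` into `⟨x, A x⟩` and `⟨x, B y⟩` into `s² ⟨y, B y⟩`.
  -- Their difference is at least `s² (a - b)` and at most `s ‖A - B‖`.
  have i1 : (inner ℂ x (A x) : ℂ) = inner ℂ x (A y) := by
    rw [hx, apply_eq hAP, mul_apply_eq_comp, ← inner_apply_left hP.isSelfAdjoint, hPP]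
  have i2 : (inner ℂ x (B y) : ℂ) = (s ^ 2 : ℝ) * inner ℂ y (B y) := by
    conv_lhs => rw [← hRy, apply_eq hBR, mul_apply_eq_comp, ← inner_apply_left hR.isSelfAdjoint,
      hstar', inner_smul_left]
    simp
  have k1 := ha x hPx
  have k2 := hb y hRy
  rw [hy, one_pow, mul_one] at k2
  have k3 : RCLike.re (inner ℂ x ((A - B) y) : ℂ) ≤ s * ‖A - B‖ := by
    refine (re_inner_le_norm _ _).trans ?_
    rw [hxn]
    gcongr
    simpa [hy] using (A - B).le_opNorm y
  rw [sub_apply, inner_sub_right, ← i1, i2, map_sub] at k3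
  have k4 : RCLike.re (((s ^ 2 : ℝ) : ℂ) * inner ℂ y (B y))
      = s ^ 2 * RCLike.re (inner ℂ y (B y) : ℂ) := Complex.re_ofReal_mul _ _
  rw [k4, sub_le_iff_le_add] at k3
  rw [hxn] at k1
  have k5 : s * (s * (a - b)) ≤ s * ‖A - B‖ := by nlinarith [sq_nonneg s]
  exact le_of_mul_le_mul_left k5 hpos

end DavisKahan

/-! ### Spectral projections of Hermitian matrices -/

section Spectral

variable {m : Type} [Fintype m] [DecidableEq m]

/-- The operator on Euclidean space given by a matrix. -/
abbrev op : Matrix m m ℂ ≃⋆ₐ[ℂ] (EuclideanSpace ℂ m →L[ℂ] EuclideanSpace ℂ m) :=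
  Matrix.toEuclideanCLM (n := m) (𝕜 := ℂ)

lemma norm_op (M : Matrix m m ℂ) : ‖op M‖ = ‖M‖ := rfl

lemma isSelfAdjoint_op {M : Matrix m m ℂ} (hM : M.IsHermitian) : IsSelfAdjoint (op M) := by
  rw [isSelfAdjoint_iff, ← map_star]
  exact congrArg op hM

lemma isStarProjection_op {M : Matrix m m ℂ} (hM : IsStarProjection M) :
    IsStarProjection (op M) where
  isIdempotentElem := by
    rw [IsIdempotentElem, ← map_mul, hM.isIdempotentElem.eq]
  isSelfAdjoint := isSelfAdjoint_op hM.isSelfAdjoint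

variable {A : Matrix m m ℂ} (hA : A.IsHermitian) (s : Set ℝ)

lemma op_eigenvectorBasis (i : m) :
    op A (hA.eigenvectorBasis i) = (hA.eigenvalues i : ℂ) • hA.eigenvectorBasis i := by
  apply WithLp.ofLp_injective
  rw [Matrix.ofLp_toEuclideanCLM, hA.mulVec_eigenvectorBasis]
  rfl

lemma isStarProjection_spectralProj : IsStarProjection (spectralProj hA s) where
  isIdempotentElem := by
    rw [IsIdempotentElem, spectralProj, Matrix.IsHermitian.cfc, ← map_mul,
      Matrix.diagonal_mul_diagonal]
    congr 2
    funext i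
    by_cases h : hA.eigenvalues i ∈ s <;> simp [h]
  isSelfAdjoint := by
    rw [isSelfAdjoint_iff, spectralProj, Matrix.IsHermitian.cfc, ← map_star,
      Matrix.star_eq_conjTranspose, Matrix.diagonal_conjTranspose]
    congr 2
    funext i
    simp

lemma spectralProj_comm : A * spectralProj hA s = spectralProj hA s * A := by
  rw [spectralProj, Matrix.IsHermitian.cfc]
  conv_lhs => enter [1]; rw [hA.spectral_theorem]
  conv_rhs => enter [2]; rw [hA.spectral_theorem]
  rw [← map_mul, ← map_mul, Matrix.diagonal_mul_diagonal, Matrix.diagonal_mul_diagonal]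
  congr 2
  funext i
  exact mul_comm _ _

lemma spectralProj_eigenvectorBasis (i : m) :
    op (spectralProj hA s) (hA.eigenvectorBasis i)
      = ((s.indicator 1 (hA.eigenvalues i) : ℝ) : ℂ) • hA.eigenvectorBasis i := by
  apply WithLp.ofLp_injective
  rw [Matrix.ofLp_toEuclideanCLM, spectralProj, Matrix.IsHermitian.cfc,
    Unitary.conjStarAlgAut_apply, ← Matrix.mulVec_mulVec, ← Matrix.mulVec_mulVec,
    hA.star_eigenvectorUnitary_mulVec, Matrix.diagonal_mulVec_single]
  rw [show ∀ c : ℂ, (Pi.single i (c * 1) : m → ℂ) = c • Pi.single i 1 from fun c => by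
    rw [← Pi.single_smul, smul_eq_mul], Matrix.mulVec_smul, hA.eigenvectorUnitary_mulVec]
  rfl

lemma inner_eigenvectorBasis_op (i : m) (x : EuclideanSpace ℂ m) :
    (inner ℂ (hA.eigenvectorBasis i) (op A x) : ℂ)
      = hA.eigenvalues i * inner ℂ (hA.eigenvectorBasis i) x := by
  rw [← inner_apply_left (isSelfAdjoint_op hA), op_eigenvectorBasis, inner_smul_left]
  simp

lemma inner_spectralProj (i : m) (x : EuclideanSpace ℂ m) :
    (inner ℂ (hA.eigenvectorBasis i) (op (spectralProj hA s) x) : ℂ)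
      = ((s.indicator 1 (hA.eigenvalues i) : ℝ) : ℂ) * inner ℂ (hA.eigenvectorBasis i) x := by
  rw [← inner_apply_left (isStarProjection_op (isStarProjection_spectralProj hA s)).isSelfAdjoint,
    spectralProj_eigenvectorBasis, inner_smul_left]
  simp

lemma re_inner_op (x : EuclideanSpace ℂ m) : RCLike.re (inner ℂ x (op A x) : ℂ)
    = ∑ i, hA.eigenvalues i * ‖(inner ℂ (hA.eigenvectorBasis i) x : ℂ)‖ ^ 2 := by
  rw [← hA.eigenvectorBasis.sum_inner_mul_inner, map_sum]
  refine Finset.sum_congr rfl fun i _ => ?_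
  rw [inner_eigenvectorBasis_op, mul_left_comm, ← inner_conj_symm x, RCLike.conj_mul]
  change ((hA.eigenvalues i : ℂ) * (‖(inner ℂ (hA.eigenvectorBasis i) x : ℂ)‖ : ℂ) ^ 2).re = _
  rw [← Complex.ofReal_pow, ← Complex.ofReal_mul, Complex.ofReal_re]

lemma re_inner_op_le_of_spectralProj {c : ℝ} {x : EuclideanSpace ℂ m}
    (hx : op (1 - spectralProj hA (Set.Ioi c)) x = x) :
    RCLike.re (inner ℂ x (op A x) : ℂ) ≤ c * ‖x‖ ^ 2 := by
  rw [re_inner_op hA, ← hA.eigenvectorBasis.sum_sq_norm_inner_right, Finset.mul_sum]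
  refine Finset.sum_le_sum fun i _ => ?_
  by_cases h : hA.eigenvalues i ∈ Set.Ioi c
  · have : (inner ℂ (hA.eigenvectorBasis i) x : ℂ) = 0 := by
      rw [← hx, map_sub, map_one, sub_apply, inner_sub_right, inner_spectralProj]
      simp [h]
    simp [this]
  · gcongr
    exact not_lt.mp h

lemma le_re_inner_op_of_spectralProj {c : ℝ} {x : EuclideanSpace ℂ m}
    (hx : op (spectralProj hA (Set.Ioi c)) x = x) :
    c * ‖x‖ ^ 2 ≤ RCLike.re (inner ℂ x (op A x) : ℂ) := by
  rw [re_inner_op hA, ← hA.eigenvectorBasis.sum_sq_norm_inner_right, Finset.mul_sum]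
  refine Finset.sum_le_sum fun i _ => ?_
  by_cases h : hA.eigenvalues i ∈ Set.Ioi c
  · gcongr
    exact (Set.mem_Ioi.mp h).le
  · have : (inner ℂ (hA.eigenvectorBasis i) x : ℂ) = 0 := by
      rw [← hx, inner_spectralProj]
      simp [h]
    simp [this]

end Spectral

/-! ### Rank-one operators -/

section KetBra

variable {m : Type}

lemma star_ketBra (u v : m → ℂ) : star (ketBra u v) = ketBra v u := by
  rw [ketBra, Matrix.star_eq_conjTranspose, Matrix.conjTranspose_vecMulVec, star_star]
  rfl

variable [Fintype m]

lemma ketBra_mul_ketBra (u v u' v' : m → ℂ) :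
    ketBra u v * ketBra u' v' = (star v ⬝ᵥ u') • ketBra u v' := by
  rw [ketBra, ketBra, Matrix.vecMulVec_mul_vecMulVec, Matrix.vecMulVec_smul]
  rfl

lemma ketBra_mulVec (u v x : m → ℂ) : ketBra u v *ᵥ x = (star v ⬝ᵥ x) • u := by
  rw [ketBra, Matrix.vecMulVec_mulVec]
  funext i
  simp [mul_comm]

lemma mul_ketBra (M : Matrix m m ℂ) (u v : m → ℂ) : M * ketBra u v = ketBra (M *ᵥ u) v := by
  rw [ketBra, Matrix.mul_vecMulVec]; rfl

variable [DecidableEq m]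

lemma norm_ketBra_le (u v : m → ℂ) :
    ‖ketBra u v‖ ≤ ‖WithLp.toLp 2 u‖ * ‖WithLp.toLp 2 v‖ := by
  rw [← norm_op]
  refine ContinuousLinearMap.opNorm_le_bound _ (by positivity) fun x => ?_
  have : op (ketBra u v) x = (inner ℂ (WithLp.toLp 2 v) x : ℂ) • WithLp.toLp 2 u := by
    apply WithLp.ofLp_injective
    rw [Matrix.ofLp_toEuclideanCLM, ketBra_mulVec, EuclideanSpace.inner_eq_star_dotProduct,
      dotProduct_comm]
    rfl
  rw [this, norm_smul]
  calc _ ≤ ‖WithLp.toLp 2 v‖ * ‖x‖ * ‖WithLp.toLp 2 u‖ := by gcongr; exact norm_inner_le_norm _ _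
    _ = _ := by ring

end KetBra

/-! ### Energy levels of the system Hamiltonian -/

namespace System

variable {ι : Type} [Fintype ι] [DecidableEq ι] (S : System ι)

/-- The ground state as a vector of Euclidean space. -/
abbrev gs : EuclideanSpace ℂ ι := WithLp.toLp 2 S.ground

lemma norm_gs : ‖S.gs‖ = 1 := by
  have := S.ground_norm
  rw [normSq] at this
  exact (pow_eq_one_iff_of_nonneg (norm_nonneg _) two_ne_zero).mp this

lemma star_ground_dotProduct : star S.ground ⬝ᵥ S.ground = 1 := by
  have := inner_self_eq_norm_sq_to_K (𝕜 := ℂ) S.gs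
  rw [S.norm_gs, EuclideanSpace.inner_toLp_toLp, dotProduct_comm] at this
  simpa using this

lemma op_P₀ (x : EuclideanSpace ℂ ι) : op S.P₀ x = (inner ℂ S.gs x : ℂ) • S.gs := by
  apply WithLp.ofLp_injective
  rw [Matrix.ofLp_toEuclideanCLM, P₀, ketBra_mulVec, EuclideanSpace.inner_eq_star_dotProduct,
    dotProduct_comm]
  rfl

lemma op_HS_gs : op S.HS S.gs = 0 := by
  rw [Matrix.toEuclideanCLM_toLp, S.ground_eig]; rfl

lemma isStarProjection_P₀ : IsStarProjection S.P₀ where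
  isIdempotentElem := by
    rw [IsIdempotentElem, P₀, ketBra_mul_ketBra, S.star_ground_dotProduct, one_smul]
  isSelfAdjoint := star_ketBra _ _

lemma isStarProjection_P₁ : IsStarProjection S.P₁ := isStarProjection_spectralProj _ _

lemma HS_mul_P₀ : S.HS * S.P₀ = 0 := by
  rw [P₀, mul_ketBra, S.ground_eig]
  simp [ketBra]

lemma P₀_mul_HS : S.P₀ * S.HS = 0 := by
  have := congrArg star S.HS_mul_P₀
  rwa [star_mul, S.isStarProjection_P₀.isSelfAdjoint.star_eq, star_zero,
    (S.posSemidef.isHermitian.isSelfAdjoint).star_eq] at this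

lemma HS_comm_P₁ : S.HS * S.P₁ = S.P₁ * S.HS := spectralProj_comm _ _

lemma Δ_le {x : ℝ} (hΔ : 0 < S.Δ)
    (hx : x ∈ {S.ω₁} ∪ S.spec₂ ∪ (fun E => |E - S.ω₁|) '' S.spec₂) : S.Δ ≤ x := by
  refine csInf_le ?_ hx
  -- A real set that is not bounded below has `sInf` equal to 0 by convention, so `0 < Δ` already
  -- gives boundedness.
  by_contra h
  exact hΔ.ne' (Real.sInf_of_not_bddBelow h)

lemma Δ_le_ω₁ (hΔ : 0 < S.Δ) : S.Δ ≤ S.ω₁ := S.Δ_le hΔ (by simp)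

/-- The eigenbasis of `HS`. -/
abbrev eb : OrthonormalBasis ι ℂ (EuclideanSpace ℂ ι) := S.posSemidef.isHermitian.eigenvectorBasis

/-- The eigenvalues of `HS`. -/
abbrev ev : ι → ℝ := S.posSemidef.isHermitian.eigenvalues

lemma op_HS_eb (i : ι) : op S.HS (S.eb i) = (S.ev i : ℂ) • S.eb i := op_eigenvectorBasis _ i

/-- Nondegeneracy makes each eigenvector of energy 0 a multiple of the ground state. Any other
eigenvector is orthogonal to the ground state; if its energy is outside the band, it is fixed by
`P₂`, and its energy enters the definition of `Δ`. -/
lemma ev_cases (hΔ : 0 < S.Δ) (i : ι) :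
    (∃ a : ℂ, S.eb i = a • S.gs) ∨
      ((inner ℂ S.gs (S.eb i) : ℂ) = 0 ∧
        (S.ev i ∈ Set.Ioo (S.ω₁ - S.δω) (S.ω₁ + S.δω) ∨
          (S.Δ ≤ S.ev i ∧ S.Δ ≤ |S.ev i - S.ω₁|))) := by
  by_cases h0 : S.ev i = 0
  · left
    obtain ⟨a, ha⟩ := S.ground_unique (S.eb i) (by
      have := S.op_HS_eb i
      rw [h0, Complex.ofReal_zero, zero_smul] at this
      exact congrArg WithLp.ofLp this)
    exact ⟨a, WithLp.ofLp_injective 2 ha⟩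
  right
  have hg : (inner ℂ S.gs (S.eb i) : ℂ) = 0 := by
    have h1 : (S.ev i : ℂ) * inner ℂ S.gs (S.eb i) = 0 := by
      rw [← inner_smul_right, ← S.op_HS_eb,
        ← inner_apply_left (isSelfAdjoint_op S.posSemidef.isHermitian), S.op_HS_gs,
        inner_zero_left]
    exact (mul_eq_zero.mp h1).resolve_left (by exact_mod_cast h0)
  refine ⟨hg, ?_⟩
  by_cases h1 : S.ev i ∈ Set.Ioo (S.ω₁ - S.δω) (S.ω₁ + S.δω)
  · exact Or.inl h1
  right
  have hmem : S.ev i ∈ S.spec₂ := by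
    refine ⟨S.eb i, ?_, ?_, ?_⟩
    · intro h
      have h2 : S.eb i = 0 := WithLp.ofLp_injective 2 h
      have := S.eb.orthonormal.1 i
      rw [h2, norm_zero] at this
      exact zero_ne_one this
    · have : op S.P₂ (S.eb i) = S.eb i := by
        rw [P₂, map_sub, map_sub, map_one, sub_apply, sub_apply, S.op_P₀, hg, P₁,
          spectralProj_eigenvectorBasis, Set.indicator_of_notMem h1]
        simp
      exact congrArg WithLp.ofLp this
    · exact congrArg WithLp.ofLp (S.op_HS_eb i)
  exact ⟨S.Δ_le hΔ (by simp [hmem]), S.Δ_le hΔ (Or.inr ⟨_, hmem, rfl⟩)⟩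

lemma inner_eb_P₁ (i : ι) (x : EuclideanSpace ℂ ι) : (inner ℂ (S.eb i) (op S.P₁ x) : ℂ)
    = (((Set.Ioo (S.ω₁ - S.δω) (S.ω₁ + S.δω)).indicator 1 (S.ev i) : ℝ) : ℂ)
      * inner ℂ (S.eb i) x := inner_spectralProj _ _ i x

lemma inner_eb_HS (i : ι) (x : EuclideanSpace ℂ ι) (c : ℝ) :
    (inner ℂ (S.eb i) (op (S.HS - (c : ℂ) • 1) x) : ℂ)
      = ((S.ev i - c : ℝ) : ℂ) * inner ℂ (S.eb i) x := by
  rw [map_sub, map_smul, map_one, sub_apply, inner_sub_right, smul_apply, one_apply_eq_self,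
    inner_smul_right, inner_eigenvectorBasis_op]
  push_cast; ring

lemma norm_HS_sub_mul_P₁ (hδ : 0 ≤ S.δω) : ‖(S.HS - (S.ω₁ : ℂ) • 1) * S.P₁‖ ≤ S.δω := by
  rw [← norm_op]
  refine ContinuousLinearMap.opNorm_le_bound _ hδ fun x => ?_
  have h := norm_le_of_inner_le S.eb zero_le_one
    (x := op ((S.HS - (S.ω₁ : ℂ) • 1) * S.P₁) x) (y := (S.δω : ℂ) • x) fun i => ?_
  · rwa [one_mul, norm_smul, Complex.norm_real, Real.norm_of_nonneg hδ] at h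
  rw [one_mul, map_mul, mul_apply_eq_comp, inner_eb_HS, inner_eb_P₁, inner_smul_right, norm_mul,
    norm_mul, norm_mul, ← mul_assoc, Complex.norm_real, Complex.norm_real, Complex.norm_real,
    Real.norm_eq_abs, Real.norm_of_nonneg hδ]
  gcongr
  by_cases h1 : S.ev i ∈ Set.Ioo (S.ω₁ - S.δω) (S.ω₁ + S.δω)
  · rw [Set.indicator_of_mem h1]
    simp only [Pi.one_apply, norm_one, mul_one]
    rw [abs_le]
    constructor <;> linarith [h1.1, h1.2]
  · rw [Set.indicator_of_notMem h1]; simpa using hδ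

/-- The condition `δω ≤ ω₁` keeps the energy 0 out of the open band. -/
lemma P₁_mul_P₀ (h : S.δω ≤ S.ω₁) : S.P₁ * S.P₀ = 0 := by
  apply (op (m := ι)).injective
  ext1 x
  change op (S.P₁ * S.P₀) x = op 0 x
  rw [map_mul, mul_apply_eq_comp, S.op_P₀, map_smul, map_zero, zero_apply]
  have : op S.P₁ S.gs = 0 := by
    apply S.eb.repr.injective
    ext i
    rw [map_zero, OrthonormalBasis.repr_apply_apply, inner_eb_P₁]
    change _ = (0 : ℂ)
    by_cases h1 : S.ev i ∈ Set.Ioo (S.ω₁ - S.δω) (S.ω₁ + S.δω)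
    · have h2 := inner_eigenvectorBasis_op S.posSemidef.isHermitian i S.gs
      rw [S.op_HS_gs, inner_zero_right] at h2
      have h3 : S.ev i ≠ 0 := by
        have := h1.1
        intro h0; rw [h0] at this; linarith
      have := (mul_eq_zero.mp h2.symm).resolve_left (by exact_mod_cast h3)
      rw [this, mul_zero]
    · rw [Set.indicator_of_notMem h1]; simp
  rw [this, smul_zero]

lemma P₀_mul_P₁ (h : S.δω ≤ S.ω₁) : S.P₀ * S.P₁ = 0 := by
  have := congrArg star (S.P₁_mul_P₀ h)
  rwa [star_mul, S.isStarProjection_P₀.isSelfAdjoint.star_eq,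
    S.isStarProjection_P₁.isSelfAdjoint.star_eq, star_zero] at this

lemma isStarProjection_P₂ (h : S.δω ≤ S.ω₁) : IsStarProjection S.P₂ where
  isIdempotentElem := by
    have h1 := S.isStarProjection_P₀.isIdempotentElem.eq
    have h2 := S.isStarProjection_P₁.isIdempotentElem.eq
    rw [IsIdempotentElem, P₂]
    simp only [mul_sub, sub_mul, mul_one, one_mul, h1, h2, S.P₁_mul_P₀ h, S.P₀_mul_P₁ h]
    abel
  isSelfAdjoint := by
    rw [isSelfAdjoint_iff, P₂, star_sub, star_sub, star_one,
      S.isStarProjection_P₀.isSelfAdjoint.star_eq, S.isStarProjection_P₁.isSelfAdjoint.star_eq]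

/-- Both distances are needed: the energies of `P₂` measured from `ω₁` are `E - ω₁` when the bath is
in C, and `E` up to sign when it is in L or R. -/
lemma gap_P₂ (hΔ : 0 < S.Δ) (h : S.δω ≤ S.ω₁) {x : EuclideanSpace ℂ ι} (hx : op S.P₂ x = x) :
    S.Δ * ‖x‖ ≤ ‖op S.HS x‖ ∧ S.Δ * ‖x‖ ≤ ‖op (S.HS - (S.ω₁ : ℂ) • 1) x‖ := by
  have hz : ∀ i, (inner ℂ (S.eb i) x : ℂ) = 0 ∨ (S.Δ ≤ S.ev i ∧ S.Δ ≤ |S.ev i - S.ω₁|) := by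
    intro i
    rcases S.ev_cases hΔ i with ⟨a, ha⟩ | ⟨-, h1 | h1⟩
    · left
      have h2 : (inner ℂ S.gs x : ℂ) • S.gs = 0 := by
        rw [← S.op_P₀, ← hx, ← mul_apply_eq_comp, ← map_mul]
        have : S.P₀ * S.P₂ = 0 := by
          rw [P₂, mul_sub, mul_sub, mul_one, S.isStarProjection_P₀.isIdempotentElem.eq,
            S.P₀_mul_P₁ h]
          simp
        rw [this, map_zero]; rfl
      have h3 : (inner ℂ S.gs x : ℂ) = 0 := by
        refine (smul_eq_zero.mp h2).resolve_right fun h4 => ?_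
        have := S.norm_gs
        rw [h4, norm_zero] at this
        exact zero_ne_one this
      rw [ha, inner_smul_left, h3, mul_zero]
    · left
      have h2 : op S.P₁ x = 0 := by
        rw [← hx, ← mul_apply_eq_comp, ← map_mul]
        have : S.P₁ * S.P₂ = 0 := by
          rw [P₂, mul_sub, mul_sub, mul_one, S.isStarProjection_P₁.isIdempotentElem.eq,
            S.P₁_mul_P₀ h]
          simp
        rw [this, map_zero]; rfl
      have h3 := S.inner_eb_P₁ i x
      rw [h2, inner_zero_right, Set.indicator_of_mem h1] at h3
      simpa using h3.symm
    · exact Or.inr h1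
  refine ⟨norm_le_of_inner_le S.eb hΔ.le fun i => ?_, norm_le_of_inner_le S.eb hΔ.le fun i => ?_⟩
  · rw [inner_eigenvectorBasis_op, norm_mul]
    rcases hz i with h0 | h0
    · simp [h0]
    · gcongr
      rw [Complex.norm_real]
      exact h0.1.trans (le_abs_self _)
  · rw [inner_eb_HS, norm_mul]
    rcases hz i with h0 | h0
    · simp [h0]
    · gcongr
      rw [Complex.norm_real]
      exact h0.2

/-- The band may reach below `Δ`, but not below `ω₁ - δω ≥ Δ - Δ / 4`. -/
lemma re_inner_HS_ge (hΔ : 0 < S.Δ) (hδ : S.δω ≤ S.Δ / 4) {x : EuclideanSpace ℂ ι}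
    (hx : op (1 - S.P₀) x = x) :
    3 / 4 * S.Δ * ‖x‖ ^ 2 ≤ RCLike.re (inner ℂ x (op S.HS x) : ℂ) := by
  rw [re_inner_op S.posSemidef.isHermitian, ← S.eb.sum_sq_norm_inner_right, Finset.mul_sum]
  refine Finset.sum_le_sum fun i _ => ?_
  rcases S.ev_cases hΔ i with ⟨a, ha⟩ | ⟨-, h1⟩
  · have h3 : (inner ℂ S.gs x : ℂ) = 0 := by
      rw [← hx, map_sub, map_one, sub_apply, inner_sub_right, S.op_P₀, inner_smul_right,
        inner_self_eq_norm_sq_to_K, S.norm_gs]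
      simp
    have h4 : (inner ℂ (S.eb i) x : ℂ) = 0 := by rw [ha, inner_smul_left, h3, mul_zero]
    simp [h4]
  · gcongr
    have := S.Δ_le_ω₁ hΔ
    rcases h1 with h1 | h1
    · have := h1.1
      change _ ≤ S.ev i
      linarith
    · change _ ≤ S.ev i
      linarith [h1.1]

end System

end

noncomputable section

/-! ### Tensor products with the bath -/

section Kron

variable {m n : Type}

lemma star_kronecker (M : Matrix m m ℂ) (N : Matrix n n ℂ) :
    star (M ⊗ₖ N) = star M ⊗ₖ star N := Matrix.conjTranspose_kronecker M N

/-- The product vector `x ⊗ b`. -/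
def tens (x : EuclideanSpace ℂ m) (b : n → ℂ) : EuclideanSpace ℂ (m × n) :=
  WithLp.toLp 2 fun p => x p.1 * b p.2

/-- The component of a vector along the basis vector `b` of the second factor. -/
def slice (x : EuclideanSpace ℂ (m × n)) (b : n) : EuclideanSpace ℂ m :=
  WithLp.toLp 2 fun i => x (i, b)

lemma tens_smul_right (c : ℂ) (x : EuclideanSpace ℂ m) (b : n → ℂ) :
    tens x (c • b) = c • tens x b := by
  apply WithLp.ofLp_injective
  funext p
  simp [tens]; ring

lemma slice_add (x y : EuclideanSpace ℂ (m × n)) (b : n) :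
    slice (x + y) b = slice x b + slice y b := rfl

variable [Fintype m] [Fintype n]

lemma inner_tens (x y : EuclideanSpace ℂ m) (b c : n → ℂ) :
    (inner ℂ (tens x b) (tens y c) : ℂ) = inner ℂ x y * (star b ⬝ᵥ c) := by
  simp only [tens, EuclideanSpace.inner_eq_star_dotProduct, dotProduct,
    Fintype.sum_prod_type, Finset.sum_mul_sum, Pi.star_apply, star_mul']
  refine Finset.sum_congr rfl fun i _ => Finset.sum_congr rfl fun j _ => ?_
  ring

lemma norm_sq_eq_sum_slice (x : EuclideanSpace ℂ (m × n)) :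
    ‖x‖ ^ 2 = ∑ b, ‖slice x b‖ ^ 2 := by
  simp only [EuclideanSpace.norm_sq_eq, slice, Fintype.sum_prod_type]
  exact Finset.sum_comm

lemma norm_tens {x : EuclideanSpace ℂ m} {b : n → ℂ} (hb : star b ⬝ᵥ b = 1) :
    ‖tens x b‖ = ‖x‖ := by
  rw [← pow_left_inj₀ (norm_nonneg _) (norm_nonneg _) two_ne_zero]
  have h1 := inner_self_eq_norm_sq_to_K (𝕜 := ℂ) (tens x b)
  rw [inner_tens, hb, mul_one, inner_self_eq_norm_sq_to_K] at h1
  exact_mod_cast h1.symm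

variable [DecidableEq m] [DecidableEq n]

/-- The embedding `M ↦ M ⊗ 1`. -/
def kronLeft : Matrix m m ℂ →⋆ₙₐ[ℂ] Matrix (m × n) (m × n) ℂ where
  toFun M := M ⊗ₖ (1 : Matrix n n ℂ)
  map_smul' c M := Matrix.smul_kronecker c M 1
  map_zero' := Matrix.zero_kronecker _
  map_add' M N := Matrix.add_kronecker M N 1
  map_mul' M N := by rw [← Matrix.mul_kronecker_mul, mul_one]
  map_star' M := by
    rw [Matrix.star_eq_conjTranspose, Matrix.star_eq_conjTranspose, Matrix.conjTranspose_kronecker,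
      Matrix.conjTranspose_one]

/-- The embedding `N ↦ 1 ⊗ N`. -/
def kronRight : Matrix n n ℂ →⋆ₙₐ[ℂ] Matrix (m × n) (m × n) ℂ where
  toFun N := (1 : Matrix m m ℂ) ⊗ₖ N
  map_smul' c N := Matrix.kronecker_smul c 1 N
  map_zero' := Matrix.kronecker_zero _
  map_add' M N := Matrix.kronecker_add 1 M N
  map_mul' M N := by rw [← Matrix.mul_kronecker_mul, mul_one]
  map_star' M := by
    rw [Matrix.star_eq_conjTranspose, Matrix.star_eq_conjTranspose, Matrix.conjTranspose_kronecker,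
      Matrix.conjTranspose_one]

/-- `M ⊗ N` is the product of `M ⊗ 1` and `1 ⊗ N`, and the two embeddings, being star homomorphisms,
do not increase norms. -/
lemma norm_kronecker_le (M : Matrix m m ℂ) (N : Matrix n n ℂ) : ‖M ⊗ₖ N‖ ≤ ‖M‖ * ‖N‖ := by
  have h : M ⊗ₖ N = (kronLeft M : Matrix (m × n) (m × n) ℂ) * kronRight N := by
    change _ = (M ⊗ₖ (1 : Matrix n n ℂ)) * ((1 : Matrix m m ℂ) ⊗ₖ N)
    rw [← Matrix.mul_kronecker_mul, mul_one, one_mul]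
  rw [h]
  refine (norm_mul_le _ _).trans ?_
  gcongr
  · exact NonUnitalStarAlgHom.norm_apply_le _ _
  · exact NonUnitalStarAlgHom.norm_apply_le _ _

lemma norm_le_one_of_sq {M P : Matrix m m ℂ} (hM : IsSelfAdjoint M) (hP : IsStarProjection P)
    (h : M * M = P) : ‖M‖ ≤ 1 := by
  have h1 : ‖M‖ * ‖M‖ = ‖P‖ := by
    rw [← CStarRing.norm_star_mul_self, hM.star_eq, h]
  nlinarith [hP.norm_le, norm_nonneg M]

lemma op_kronecker_tens (M : Matrix m m ℂ) (N : Matrix n n ℂ) (x : EuclideanSpace ℂ m)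
    (b : n → ℂ) : op (M ⊗ₖ N) (tens x b) = tens (op M x) (N *ᵥ b) := by
  apply WithLp.ofLp_injective
  rw [Matrix.ofLp_toEuclideanCLM]
  funext p
  simp only [tens, Matrix.ofLp_toEuclideanCLM, Matrix.mulVec, dotProduct, Matrix.kroneckerMap_apply,
    Fintype.sum_prod_type, Finset.sum_mul_sum]
  refine Finset.sum_congr rfl fun i _ => Finset.sum_congr rfl fun j _ => ?_
  ring

lemma op_ketBra_kronecker (u v : m → ℂ) (b c : n → ℂ) (x : EuclideanSpace ℂ (m × n)) :
    op (ketBra u v ⊗ₖ ketBra b c) x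
      = (inner ℂ (tens (WithLp.toLp 2 v) c) x : ℂ) • tens (WithLp.toLp 2 u) b := by
  apply WithLp.ofLp_injective
  funext p
  simp only [Matrix.ofLp_toEuclideanCLM, Matrix.mulVec, dotProduct, Matrix.kroneckerMap_apply,
    ketBra, Matrix.vecMulVec_apply, EuclideanSpace.inner_eq_star_dotProduct, tens,
    WithLp.ofLp_smul, Pi.smul_apply, Pi.star_apply, star_mul', smul_eq_mul, Finset.sum_mul]
  refine Finset.sum_congr rfl fun q _ => ?_
  ring

lemma slice_op_kronecker_diagonal (M : Matrix m m ℂ) (d : n → ℂ)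
    (x : EuclideanSpace ℂ (m × n)) (b : n) :
    slice (op (M ⊗ₖ Matrix.diagonal d) x) b = d b • op M (slice x b) := by
  apply WithLp.ofLp_injective
  funext i
  simp only [slice, Matrix.ofLp_toEuclideanCLM, Matrix.mulVec, dotProduct,
    Matrix.kroneckerMap_apply, Fintype.sum_prod_type, WithLp.ofLp_smul, Pi.smul_apply, smul_eq_mul,
    Finset.mul_sum]
  refine Finset.sum_congr rfl fun j _ => ?_
  rw [Finset.sum_eq_single b]
  · rw [Matrix.diagonal_apply_eq]; ring
  · intro c _ hc
    rw [Matrix.diagonal_apply_ne _ hc.symm]; ring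
  · simp

end Kron

/-! ### Matrix algebra of the qutrit -/

section BathAlgebra

/-- The coupling `|C⟩⟨B| + |B⟩⟨C|` of the bath levels. -/
def bX : Matrix Bath Bath ℂ := ketBra ketC ketB + ketBra ketB ketC
/-- The flip `|L⟩⟨R| + |R⟩⟨L|`. -/
def bY : Matrix Bath Bath ℂ := ketBra ketL ketR + ketBra ketR ketL
/-- The projector onto `C`. -/
def bC : Matrix Bath Bath ℂ := ketBra ketC ketC
/-- The projector onto the span of `L` and `R`. -/
def bN : Matrix Bath Bath ℂ := ketBra ketR ketR + ketBra ketL ketL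
/-- `|R⟩⟨R| - |L⟩⟨L|`. -/
def bZ : Matrix Bath Bath ℂ := ketBra ketR ketR - ketBra ketL ketL

lemma ketBra_apply (u v : Bath → ℂ) (i j : Bath) : ketBra u v i j = u i * star (v j) := rfl

/-- `1/√2`. -/
def isq : ℂ := (Real.sqrt 2 : ℂ)⁻¹

lemma isq_mul_isq : isq * isq = 2⁻¹ := by
  rw [isq, ← mul_inv, ← Complex.ofReal_mul, Real.mul_self_sqrt (by norm_num)]; simp

lemma conj_isq : (starRingEnd ℂ) isq = isq := by
  rw [isq, map_inv₀, Complex.conj_ofReal]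

lemma ketC_eq : ketC = ![1, 0, 0] := by ext i; fin_cases i <;> simp [ketC]
lemma ketL_eq : ketL = ![0, 1, 0] := by ext i; fin_cases i <;> simp [ketL]
lemma ketR_eq : ketR = ![0, 0, 1] := by ext i; fin_cases i <;> simp [ketR]
lemma ketB_eq : ketB = ![0, isq, isq] := by
  ext i; fin_cases i <;> simp [ketB, ketL, ketR, isq]
lemma ketD_eq : ketD = ![0, isq, -isq] := by
  ext i; fin_cases i <;> simp [ketD, ketL, ketR, isq]

lemma bC_eq : bC = !![1, 0, 0; 0, 0, 0; 0, 0, 0] := by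
  ext i j; fin_cases i <;> fin_cases j <;> simp [bC, ketBra_apply, ketC_eq]
lemma bN_eq : bN = !![0, 0, 0; 0, 1, 0; 0, 0, 1] := by
  ext i j; fin_cases i <;> fin_cases j <;>
    simp [bN, ketBra_apply, ketL_eq, ketR_eq]
lemma bZ_eq : bZ = !![0, 0, 0; 0, -1, 0; 0, 0, 1] := by
  ext i j; fin_cases i <;> fin_cases j <;>
    simp [bZ, ketBra_apply, ketL_eq, ketR_eq]
lemma bX_eq : bX = !![0, isq, isq; isq, 0, 0; isq, 0, 0] := by
  ext i j; fin_cases i <;> fin_cases j <;>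
    simp [bX, ketBra_apply, ketC_eq, ketB_eq, conj_isq]
lemma bY_eq : bY = !![0, 0, 0; 0, 0, 1; 0, 1, 0] := by
  ext i j; fin_cases i <;> fin_cases j <;>
    simp [bY, ketBra_apply, ketL_eq, ketR_eq]
lemma bB_eq : ketBra ketB ketB = !![0, 0, 0; 0, 2⁻¹, 2⁻¹; 0, 2⁻¹, 2⁻¹] := by
  ext i j; fin_cases i <;> fin_cases j <;>
    simp [ketBra_apply, ketB_eq, conj_isq, isq_mul_isq]
lemma bCB_eq : ketBra ketC ketB = !![0, isq, isq; 0, 0, 0; 0, 0, 0] := by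
  ext i j; fin_cases i <;> fin_cases j <;>
    simp [ketBra_apply, ketC_eq, ketB_eq, conj_isq]
lemma bBC_eq : ketBra ketB ketC = !![0, 0, 0; isq, 0, 0; isq, 0, 0] := by
  ext i j; fin_cases i <;> fin_cases j <;>
    simp [ketBra_apply, ketC_eq, ketB_eq]

lemma bC_bC : bC * bC = bC := by
  rw [bC_eq]
  ext i j; fin_cases i <;> fin_cases j <;> simp [Matrix.mul_apply, Fin.sum_univ_three]
lemma bN_bN : bN * bN = bN := by
  rw [bN_eq]
  ext i j; fin_cases i <;> fin_cases j <;> simp [Matrix.mul_apply, Fin.sum_univ_three]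
lemma bC_bN : bC * bN = 0 := by
  rw [bC_eq, bN_eq]
  ext i j; fin_cases i <;> fin_cases j <;> simp [Matrix.mul_apply, Fin.sum_univ_three]
lemma bN_bC : bN * bC = 0 := by
  rw [bC_eq, bN_eq]
  ext i j; fin_cases i <;> fin_cases j <;> simp [Matrix.mul_apply, Fin.sum_univ_three]
lemma bC_bZ : bC * bZ = 0 := by
  rw [bC_eq, bZ_eq]
  ext i j; fin_cases i <;> fin_cases j <;> simp [Matrix.mul_apply, Fin.sum_univ_three]
lemma bZ_bC : bZ * bC = 0 := by
  rw [bC_eq, bZ_eq]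
  ext i j; fin_cases i <;> fin_cases j <;> simp [Matrix.mul_apply, Fin.sum_univ_three]
lemma bZ_bN : bZ * bN = bZ := by
  rw [bN_eq, bZ_eq]
  ext i j; fin_cases i <;> fin_cases j <;> simp [Matrix.mul_apply, Fin.sum_univ_three]
lemma bZ_bZ : bZ * bZ = bN := by
  rw [bN_eq, bZ_eq]
  ext i j; fin_cases i <;> fin_cases j <;> simp [Matrix.mul_apply, Fin.sum_univ_three]
lemma bC_add_bN : bC + bN = 1 := by
  rw [bC_eq, bN_eq]
  ext i j; fin_cases i <;> fin_cases j <;> simp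
lemma bC_bX_bC : bC * bX * bC = 0 := by
  rw [bC_eq, bX_eq]
  ext i j; fin_cases i <;> fin_cases j <;> simp [Matrix.mul_apply, Fin.sum_univ_three]
lemma bN_bX_bN : bN * bX * bN = 0 := by
  rw [bN_eq, bX_eq]
  ext i j; fin_cases i <;> fin_cases j <;> simp [Matrix.mul_apply, Fin.sum_univ_three]
lemma bC_bX_bN : bC * bX * bN = ketBra ketC ketB := by
  rw [bC_eq, bX_eq, bN_eq, bCB_eq]
  ext i j; fin_cases i <;> fin_cases j <;> simp [Matrix.mul_apply, Fin.sum_univ_three]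
lemma bN_bX_bC : bN * bX * bC = ketBra ketB ketC := by
  rw [bC_eq, bX_eq, bN_eq, bBC_eq]
  ext i j; fin_cases i <;> fin_cases j <;> simp [Matrix.mul_apply, Fin.sum_univ_three]
-- The cancellation behind the scheme: `⟨B|` and `|B⟩` give L and R equal weights, and these two
-- levels enter with opposite signs.
lemma bX_bZ_bX : bX * bZ * bX = 0 := by
  rw [bZ_eq, bX_eq]
  ext i j; fin_cases i <;> fin_cases j <;> simp [Matrix.mul_apply, Fin.sum_univ_three]
lemma bX_bC_bX : bX * bC * bX = ketBra ketB ketB := by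
  rw [bC_eq, bX_eq, bB_eq]
  ext i j; fin_cases i <;> fin_cases j <;>
    simp [Matrix.mul_apply, Fin.sum_univ_three, isq_mul_isq]
lemma bX_bX : bX * bX = bC + ketBra ketB ketB := by
  rw [bC_eq, bX_eq, bB_eq]
  ext i j; fin_cases i <;> fin_cases j <;>
    simp [Matrix.mul_apply, Fin.sum_univ_three, isq_mul_isq]
  norm_num
lemma bC_bB : bC * ketBra ketB ketB = 0 := by
  rw [bC_eq, bB_eq]
  ext i j; fin_cases i <;> fin_cases j <;> simp [Matrix.mul_apply, Fin.sum_univ_three]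
lemma bN_bB_bN : bN * ketBra ketB ketB * bN = ketBra ketB ketB := by
  rw [bN_eq, bB_eq]
  ext i j; fin_cases i <;> fin_cases j <;> simp [Matrix.mul_apply, Fin.sum_univ_three]
lemma bC_bY : bC * bY = 0 := by
  rw [bC_eq, bY_eq]
  ext i j; fin_cases i <;> fin_cases j <;> simp [Matrix.mul_apply, Fin.sum_univ_three]
lemma bY_bC : bY * bC = 0 := by
  rw [bC_eq, bY_eq]
  ext i j; fin_cases i <;> fin_cases j <;> simp [Matrix.mul_apply, Fin.sum_univ_three]
lemma bN_bY : bN * bY = bY := by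
  rw [bN_eq, bY_eq]
  ext i j; fin_cases i <;> fin_cases j <;> simp [Matrix.mul_apply, Fin.sum_univ_three]
lemma bY_bN : bY * bN = bY := by
  rw [bN_eq, bY_eq]
  ext i j; fin_cases i <;> fin_cases j <;> simp [Matrix.mul_apply, Fin.sum_univ_three]
lemma bY_bY : bY * bY = bN := by
  rw [bN_eq, bY_eq]
  ext i j; fin_cases i <;> fin_cases j <;> simp [Matrix.mul_apply, Fin.sum_univ_three]

lemma star_bC : star bC = bC := star_ketBra _ _
lemma star_bN : star bN = bN := by rw [bN, star_add, star_ketBra, star_ketBra]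
lemma star_bZ : star bZ = bZ := by rw [bZ, star_sub, star_ketBra, star_ketBra]
lemma star_bX : star bX = bX := by rw [bX, star_add, star_ketBra, star_ketBra, add_comm]
lemma star_bY : star bY = bY := by rw [bY, star_add, star_ketBra, star_ketBra, add_comm]

lemma ketC_ketC : star ketC ⬝ᵥ ketC = 1 := by simp [ketC_eq, dotProduct, Fin.sum_univ_three]
lemma ketL_ketL : star ketL ⬝ᵥ ketL = 1 := by simp [ketL_eq, dotProduct, Fin.sum_univ_three]
lemma ketR_ketR : star ketR ⬝ᵥ ketR = 1 := by simp [ketR_eq, dotProduct, Fin.sum_univ_three]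
lemma ketR_ketL : star ketR ⬝ᵥ ketL = 0 := by
  simp [ketR_eq, ketL_eq, dotProduct, Fin.sum_univ_three]
lemma ketC_ketB : star ketC ⬝ᵥ ketB = 0 := by
  simp [ketC_eq, ketB_eq, dotProduct, Fin.sum_univ_three]
lemma ketB_ketC : star ketB ⬝ᵥ ketC = 0 := by
  simp [ketC_eq, ketB_eq, dotProduct, Fin.sum_univ_three]
lemma ketB_ketB : star ketB ⬝ᵥ ketB = 1 := by
  simp [ketB_eq, dotProduct, Fin.sum_univ_three, conj_isq, isq_mul_isq]
  norm_num

lemma isStarProjection_ketBra {u : Bath → ℂ} (h : star u ⬝ᵥ u = 1) :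
    IsStarProjection (ketBra u u) where
  isIdempotentElem := by rw [IsIdempotentElem, ketBra_mul_ketBra, h, one_smul]
  isSelfAdjoint := star_ketBra _ _

lemma isStarProjection_bC : IsStarProjection bC := isStarProjection_ketBra ketC_ketC
lemma isStarProjection_bN : IsStarProjection bN := ⟨bN_bN, star_bN⟩

lemma norm_bX_le : ‖bX‖ ≤ 1 := by
  refine norm_le_one_of_sq star_bX (P := bC + ketBra ketB ketB) ?_ bX_bX
  refine ⟨?_, ?_⟩
  · have h1 := (isStarProjection_ketBra ketB_ketB).isIdempotentElem.eq
    have h2 : ketBra ketB ketB * bC = 0 := by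
      have := congrArg star bC_bB
      rwa [star_mul, star_bC, star_ketBra, star_zero] at this
    rw [IsIdempotentElem, add_mul, mul_add, mul_add, bC_bC, bC_bB, h1, h2]; simp
  · rw [isSelfAdjoint_iff, star_add, star_bC, star_ketBra]

lemma norm_bY_le : ‖bY‖ ≤ 1 := norm_le_one_of_sq star_bY isStarProjection_bN bY_bY
lemma norm_bZ_le : ‖bZ‖ ≤ 1 := norm_le_one_of_sq star_bZ isStarProjection_bN bZ_bZ

end BathAlgebra

end

/-! ### Resonant block structure of the Hamiltonian -/

noncomputable section

lemma sub_kronecker {m n : Type} (A B : Matrix m m ℂ) (N : Matrix n n ℂ) :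
    (A - B) ⊗ₖ N = A ⊗ₖ N - B ⊗ₖ N := by
  ext p q
  simp [Matrix.kroneckerMap_apply, sub_mul]

namespace System

variable {ι : Type} [Fintype ι] [DecidableEq ι] (S : System ι)

/-- The Hamiltonian measured from the resonant energy `ω₁`. -/
def hRes : Matrix (ι × Bath) (ι × Bath) ℂ :=
  (S.HS - (S.ω₁ : ℂ) • 1) ⊗ₖ bC + S.HS ⊗ₖ bZ

/-- The projector onto the levels near `ω₁`. -/
def Qres : Matrix (ι × Bath) (ι × Bath) ℂ := S.P₁ ⊗ₖ bC + S.P₀ ⊗ₖ bN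

/-- The projector onto the remaining levels of `𝐒₁`. -/
def Goff : Matrix (ι × Bath) (ι × Bath) ℂ := S.P₀ ⊗ₖ bC + S.P₁ ⊗ₖ bN

/-- The sign of the energy, measured from `ω₁`, on the range of `Goff`. -/
def σoff : Matrix (ι × Bath) (ι × Bath) ℂ := S.P₁ ⊗ₖ bZ - S.P₀ ⊗ₖ bC

lemma H_eq : S.H = S.hRes + (S.ω₁ : ℂ) • 1 := by
  have h1 : ketBra ketC ketC + ketBra ketR ketR - ketBra ketL ketL = bC + bZ := by
    rw [bC, bZ, add_sub_assoc]
  have h2 : (1 : Matrix (ι × Bath) (ι × Bath) ℂ) = (1 : Matrix ι ι ℂ) ⊗ₖ bC + 1 ⊗ₖ bN := by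
    rw [← Matrix.kronecker_add, bC_add_bN, Matrix.one_kronecker_one]
  rw [H, h1, hRes, h2, sub_kronecker, Matrix.kronecker_add, Matrix.smul_kronecker, smul_add]
  change _ + _ + (S.ω₁ : ℂ) • ((1 : Matrix ι ι ℂ) ⊗ₖ bN) = _
  abel

lemma Qres_add_Goff : S.Qres + S.Goff = S.S₁ := by
  rw [Qres, Goff, S₁, ← bC_add_bN, Matrix.add_kronecker, Matrix.kronecker_add,
    Matrix.kronecker_add]
  abel

lemma S₁_add_S₂ : S.S₁ + S.S₂ = 1 := by
  rw [S₁, S₂, ← Matrix.add_kronecker, P₂, ← Matrix.one_kronecker_one]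
  congr 1; abel

lemma isSelfAdjoint_P₀ : star S.P₀ = S.P₀ := S.isStarProjection_P₀.isSelfAdjoint.star_eq
lemma isSelfAdjoint_P₁ : star S.P₁ = S.P₁ := S.isStarProjection_P₁.isSelfAdjoint.star_eq
lemma P₀_mul_P₀ : S.P₀ * S.P₀ = S.P₀ := S.isStarProjection_P₀.isIdempotentElem.eq
lemma P₁_mul_P₁ : S.P₁ * S.P₁ = S.P₁ := S.isStarProjection_P₁.isIdempotentElem.eq
lemma norm_P₀_le : ‖S.P₀‖ ≤ 1 := S.isStarProjection_P₀.norm_le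
lemma norm_P₁_le : ‖S.P₁‖ ≤ 1 := S.isStarProjection_P₁.norm_le

lemma star_hRes : star S.hRes = S.hRes := by
  have : star S.HS = S.HS := S.posSemidef.isHermitian
  rw [hRes, star_add, star_kronecker, star_kronecker, star_bC, star_bZ, star_sub, this, star_smul,
    star_one]
  simp

lemma star_σoff : star S.σoff = S.σoff := by
  rw [σoff, star_sub, star_kronecker, star_kronecker, star_bC, star_bZ, S.isSelfAdjoint_P₀,
    S.isSelfAdjoint_P₁]

variable {S}

lemma isStarProjection_Qres : IsStarProjection S.Qres where
  isIdempotentElem := by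
    rw [IsIdempotentElem, Qres]
    simp only [add_mul, mul_add, ← Matrix.mul_kronecker_mul, bC_bC, bN_bN, bC_bN, bN_bC,
      S.P₀_mul_P₀, S.P₁_mul_P₁, Matrix.kronecker_zero, add_zero, zero_add]
  isSelfAdjoint := by
    rw [isSelfAdjoint_iff, Qres, star_add, star_kronecker, star_kronecker, star_bC, star_bN,
      S.isSelfAdjoint_P₀, S.isSelfAdjoint_P₁]

lemma isStarProjection_Goff : IsStarProjection S.Goff where
  isIdempotentElem := by
    rw [IsIdempotentElem, Goff]
    simp only [add_mul, mul_add, ← Matrix.mul_kronecker_mul, bC_bC, bN_bN, bC_bN, bN_bC,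
      S.P₀_mul_P₀, S.P₁_mul_P₁, Matrix.kronecker_zero, add_zero, zero_add]
  isSelfAdjoint := by
    rw [isSelfAdjoint_iff, Goff, star_add, star_kronecker, star_kronecker, star_bC, star_bN,
      S.isSelfAdjoint_P₀, S.isSelfAdjoint_P₁]

lemma isStarProjection_S₂ (h : S.δω ≤ S.ω₁) : IsStarProjection S.S₂ where
  isIdempotentElem := by
    rw [IsIdempotentElem, S₂, ← Matrix.mul_kronecker_mul, mul_one,
      (S.isStarProjection_P₂ h).isIdempotentElem.eq]
  isSelfAdjoint := by
    rw [isSelfAdjoint_iff, S₂, star_kronecker, (S.isStarProjection_P₂ h).isSelfAdjoint.star_eq,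
      star_one]

lemma P₀_mul_P₂ (h : S.δω ≤ S.ω₁) : S.P₀ * S.P₂ = 0 := by
  rw [P₂, mul_sub, mul_sub, mul_one, S.P₀_mul_P₀, S.P₀_mul_P₁ h]; simp

lemma P₁_mul_P₂ (h : S.δω ≤ S.ω₁) : S.P₁ * S.P₂ = 0 := by
  rw [P₂, mul_sub, mul_sub, mul_one, S.P₁_mul_P₁, S.P₁_mul_P₀ h]; simp

lemma Qres_mul_Goff (h : S.δω ≤ S.ω₁) : S.Qres * S.Goff = 0 := by
  rw [Qres, Goff]
  simp only [add_mul, mul_add, ← Matrix.mul_kronecker_mul, bC_bN, bN_bC, S.P₀_mul_P₁ h,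
    S.P₁_mul_P₀ h, Matrix.kronecker_zero, Matrix.zero_kronecker, add_zero]

lemma Qres_mul_S₂ (h : S.δω ≤ S.ω₁) : S.Qres * S.S₂ = 0 := by
  rw [Qres, S₂]
  simp only [add_mul, ← Matrix.mul_kronecker_mul, P₀_mul_P₂ h, P₁_mul_P₂ h,
    Matrix.zero_kronecker, add_zero]

lemma Goff_mul_S₂ (h : S.δω ≤ S.ω₁) : S.Goff * S.S₂ = 0 := by
  rw [Goff, S₂]
  simp only [add_mul, ← Matrix.mul_kronecker_mul, P₀_mul_P₂ h, P₁_mul_P₂ h,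
    Matrix.zero_kronecker, add_zero]

lemma mul_eq_zero_symm {m : Type} [Fintype m] {A B : Matrix m m ℂ} (hA : star A = A)
    (hB : star B = B) (h : A * B = 0) : B * A = 0 := by
  have := congrArg star h
  rwa [star_mul, hA, hB, star_zero] at this

lemma mul_comm_of_selfAdjoint {m : Type} [Fintype m] {A B : Matrix m m ℂ} (hA : star A = A)
    (hB : star B = B) (h : star (A * B) = A * B) : A * B = B * A := by
  rw [← h, star_mul, hA, hB]

lemma hRes_mul_Qres : S.hRes * S.Qres = ((S.HS - (S.ω₁ : ℂ) • 1) * S.P₁) ⊗ₖ bC := by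
  rw [hRes, Qres]
  simp only [add_mul, mul_add, ← Matrix.mul_kronecker_mul, bC_bC, bC_bN, bZ_bC, bZ_bN,
    S.HS_mul_P₀, Matrix.kronecker_zero, Matrix.zero_kronecker, add_zero]

lemma hRes_mul_Goff : S.hRes * S.Goff
    = (S.HS * S.P₁) ⊗ₖ bZ - (S.ω₁ : ℂ) • (S.P₀ ⊗ₖ bC) := by
  rw [hRes, Goff]
  simp only [add_mul, mul_add, ← Matrix.mul_kronecker_mul, bC_bC, bC_bN, bZ_bC, bZ_bN,
    sub_mul, S.HS_mul_P₀, Matrix.kronecker_zero, smul_mul_assoc, one_mul,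
    zero_sub, add_zero, zero_add]
  rw [← zero_sub, sub_kronecker, Matrix.zero_kronecker, Matrix.smul_kronecker]
  abel

lemma star_HS_sub_mul_P₁ : star ((S.HS - (S.ω₁ : ℂ) • 1) * S.P₁)
    = (S.HS - (S.ω₁ : ℂ) • 1) * S.P₁ := by
  have : star S.HS = S.HS := S.posSemidef.isHermitian
  rw [star_mul, S.isSelfAdjoint_P₁, star_sub, this, star_smul, star_one, mul_sub, sub_mul,
    S.HS_comm_P₁]
  simp

lemma star_HS_mul_P₁ : star (S.HS * S.P₁) = S.HS * S.P₁ := by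
  have : star S.HS = S.HS := S.posSemidef.isHermitian
  rw [star_mul, S.isSelfAdjoint_P₁, this, S.HS_comm_P₁]

lemma hRes_comm_Qres : S.hRes * S.Qres = S.Qres * S.hRes := by
  refine mul_comm_of_selfAdjoint S.star_hRes isStarProjection_Qres.isSelfAdjoint.star_eq ?_
  rw [hRes_mul_Qres, star_kronecker, star_bC, star_HS_sub_mul_P₁]

lemma hRes_comm_Goff : S.hRes * S.Goff = S.Goff * S.hRes := by
  refine mul_comm_of_selfAdjoint S.star_hRes isStarProjection_Goff.isSelfAdjoint.star_eq ?_
  rw [hRes_mul_Goff, star_sub, star_kronecker, star_bZ, star_HS_mul_P₁, star_smul, star_kronecker,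
    star_bC, S.isSelfAdjoint_P₀]
  simp

lemma hRes_comm_S₂ : S.hRes * S.S₂ = S.S₂ * S.hRes := by
  have : S.S₂ = 1 - (S.Qres + S.Goff) := by rw [S.Qres_add_Goff, ← S.S₁_add_S₂]; abel
  rw [this, mul_sub, sub_mul, mul_add, add_mul, hRes_comm_Qres, hRes_comm_Goff, mul_one,
    one_mul]

/-- `hRes` is diagonal in C, L, R, where it acts as `HS - ω₁`, `-HS` and `HS`; the gap is checked on
each component separately. -/
lemma gap_hRes (hΔ : 0 < S.Δ) (h : S.δω ≤ S.ω₁) {x : EuclideanSpace ℂ (ι × Bath)}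
    (hx : op S.S₂ x = x) : S.Δ * ‖x‖ ≤ ‖op S.hRes x‖ := by
  refine le_of_sq_le_sq ?_ (norm_nonneg _)
  have hC : bC = Matrix.diagonal ![1, 0, 0] := by
    rw [bC_eq]; ext i j; fin_cases i <;> fin_cases j <;> simp
  have hZ : bZ = Matrix.diagonal ![0, -1, 1] := by
    rw [bZ_eq]; ext i j; fin_cases i <;> fin_cases j <;> simp
  have hP : ∀ b, op S.P₂ (slice x b) = slice x b := by
    intro b
    conv_rhs => rw [← hx, S₂, ← Matrix.diagonal_one, slice_op_kronecker_diagonal, one_smul]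
  rw [mul_pow, norm_sq_eq_sum_slice, norm_sq_eq_sum_slice, Finset.mul_sum]
  refine Finset.sum_le_sum fun b _ => ?_
  rw [← mul_pow]
  refine pow_le_pow_left₀ (by positivity) ?_ 2
  obtain ⟨g1, g2⟩ := S.gap_P₂ hΔ h (hP b)
  rw [hRes, map_add, add_apply, slice_add, hC, hZ, slice_op_kronecker_diagonal,
    slice_op_kronecker_diagonal]
  fin_cases b
  · simpa using g2
  · simpa using g1
  · simpa using g1

lemma norm_σoff_le : ‖S.σoff‖ ≤ 1 ∧ S.σoff * S.σoff = S.Goff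
    ∧ S.σoff * S.Goff = S.σoff := by
  have h1 : S.σoff * S.σoff = S.Goff := by
    rw [σoff, Goff]
    simp only [sub_mul, mul_sub, ← Matrix.mul_kronecker_mul, bC_bC, bZ_bZ, bC_bZ, bZ_bC,
      S.P₀_mul_P₀, S.P₁_mul_P₁, Matrix.kronecker_zero]
    abel
  refine ⟨norm_le_one_of_sq S.star_σoff isStarProjection_Goff h1, h1, ?_⟩
  rw [σoff, Goff]
  simp only [sub_mul, mul_add, ← Matrix.mul_kronecker_mul, bC_bC, bZ_bN, bC_bN, bZ_bC,
    S.P₀_mul_P₀, S.P₁_mul_P₁, Matrix.kronecker_zero]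
  abel

lemma norm_bC_le : ‖bC‖ ≤ 1 := isStarProjection_bC.norm_le

lemma norm_kronecker_le_of_le {m n : Type} [Fintype m] [DecidableEq m] [Fintype n] [DecidableEq n]
    {M : Matrix m m ℂ} {N : Matrix n n ℂ} {c : ℝ} (hM : ‖M‖ ≤ c) (hN : ‖N‖ ≤ 1) :
    ‖M ⊗ₖ N‖ ≤ c :=
  (norm_kronecker_le M N).trans (by nlinarith [norm_nonneg M, norm_nonneg N])

lemma Ω₀_eq (hΔ : 0 < S.Δ) : S.Ω₀ = S.r * S.Δ := by
  rw [r, div_mul_cancel₀ _ hΔ.ne']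

lemma Ω_le_Ω₀ : S.Ω ≤ S.Ω₀ := by
  have h : S.Ω = ‖op (S.P₁ * S.TS) S.gs‖ := rfl
  rw [h]
  refine (norm_apply_le_of_le (c := S.Ω₀) ?_ _).trans (by rw [S.norm_gs, mul_one])
  rw [norm_op]
  refine (norm_mul_le _ _).trans ?_
  have := S.norm_P₁_le
  rw [Ω₀]
  nlinarith [norm_nonneg S.TS]

/-- A negative half-width makes the band empty, so that `P₁`, and with it `Ω`, would vanish. -/
lemma δω_nonneg (hΩ : 0 < S.Ω) : 0 ≤ S.δω := by
  by_contra hneg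
  have h0 : S.P₁ = 0 := by
    have : Set.Ioo (S.ω₁ - S.δω) (S.ω₁ + S.δω) = ∅ := Set.Ioo_eq_empty (by linarith)
    rw [P₁, this, spectralProj, Set.indicator_empty, Matrix.IsHermitian.cfc]
    have : Matrix.diagonal (RCLike.ofReal ∘ (fun _ : ℝ => (0 : ℝ)) ∘
        S.posSemidef.isHermitian.eigenvalues : ι → ℂ) = 0 := by
      rw [← Matrix.diagonal_zero]
      congr 1
    rw [this, map_zero]
  rw [Ω, h0, zero_mul, Matrix.zero_mulVec, WithLp.toLp_zero, norm_zero] at hΩ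
  exact lt_irrefl _ hΩ

/-- The resonant block decomposition for a coupling `V` of rate `w`. -/
theorem resonant {V δ : Matrix (ι × Bath) (ι × Bath) ℂ} {w : ℝ} (hΔ : 0 < S.Δ) (hΩ : 0 < S.Ω)
    (hr : S.r ≤ 1 / 1000) (hw : 0 < w) (hwΩ : w ≤ S.Ω₀) (EB : S.ErrorBound V δ w)
    (hV : star V = V) (hδ : star δ = δ)
    (hGVG : ‖S.Goff * V * S.Goff‖ ≤ 2 * w) (hQVG : ‖S.Qres * V * S.Goff‖ ≤ S.Ω₀)
    (hsec : ‖S.Qres * V * S.σoff * V * S.Qres‖ ≤ S.r * w * S.ω₁) :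
    Resonant (op S.hRes) (op V) (op δ) (op S.Qres) (op S.Goff) (op S.S₂) (op S.σoff)
      S.ω₁ S.r w S.Δ := by
  have hrpos : 0 < S.r := by
    have := hw.trans_le hwΩ
    rw [Ω₀_eq hΔ] at this
    exact pos_of_mul_pos_left this hΔ.le
  have hδ0 := δω_nonneg hΩ
  have hwr : w ≤ S.r * S.Δ := by rwa [← Ω₀_eq hΔ]
  have hδω : S.δω ≤ S.ω₁ := by
    have := EB.width
    have := S.Δ_le_ω₁ hΔ
    nlinarith [mul_pos hrpos hΔ]
  have hQ := isStarProjection_Qres (S := S)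
  have hG := isStarProjection_Goff (S := S)
  have hS := isStarProjection_S₂ hδω
  obtain ⟨hσ1, hσ2, hσ3⟩ := norm_σoff_le (S := S)
  have hcross : ‖(S.Qres + S.Goff) * (V + δ) * S.S₂‖ ^ 2 ≤ S.r * w * S.Δ := by
    have := EB.block₁₂
    rw [S.Qres_add_Goff]
    rw [div_lt_iff₀ (by positivity)] at this
    refine this.le.trans (le_of_eq ?_)
    field_simp
  have starFS : star ((S.Qres + S.Goff) * (V + δ) * S.S₂) = S.S₂ * (V + δ) * (S.Qres + S.Goff) := by
    rw [star_mul, star_mul, star_add, star_add, hV, hδ, hS.isSelfAdjoint.star_eq,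
      hQ.isSelfAdjoint.star_eq, hG.isSelfAdjoint.star_eq, mul_assoc]
  have starQG : star (S.Qres * V * S.Goff) = S.Goff * V * S.Qres := by
    rw [star_mul, star_mul, hV, hQ.isSelfAdjoint.star_eq, hG.isSelfAdjoint.star_eq, mul_assoc]
  refine
    { sum_eq := ?_
      projQ := isStarProjection_op hQ
      projG := isStarProjection_op hG
      projS := isStarProjection_op hS
      QG := ?_
      GQ := ?_
      QS := ?_
      SQ := ?_
      GS := ?_
      SG := ?_
      commQ := ?_
      commG := ?_
      commS := ?_
      σG := ?_
      σσ := ?_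
      norm_σ := hσ1
      norm_hQ := ?_
      norm_hG := ?_
      gap := fun x hx => gap_hRes hΔ hδω hx
      crossSF := ?_
      crossFS := ?_
      far := ?_
      near := ?_
      norm_GVG := ?_
      norm_QVG := ?_
      norm_GVQ := ?_
      second_order := ?_
      D_pos := hΔ
      D_le := S.Δ_le_ω₁ hΔ
      w_pos := hw
      w_le := hwr
      r_pos := hrpos
      r_le := hr }
  · rw [← map_add, ← map_add, S.Qres_add_Goff, S.S₁_add_S₂, map_one]
  · rw [← map_mul, Qres_mul_Goff hδω, map_zero]
  · rw [← map_mul, mul_eq_zero_symm hQ.isSelfAdjoint.star_eq hG.isSelfAdjoint.star_eq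
      (Qres_mul_Goff hδω), map_zero]
  · rw [← map_mul, Qres_mul_S₂ hδω, map_zero]
  · rw [← map_mul, mul_eq_zero_symm hQ.isSelfAdjoint.star_eq hS.isSelfAdjoint.star_eq
      (Qres_mul_S₂ hδω), map_zero]
  · rw [← map_mul, Goff_mul_S₂ hδω, map_zero]
  · rw [← map_mul, mul_eq_zero_symm hG.isSelfAdjoint.star_eq hS.isSelfAdjoint.star_eq
      (Goff_mul_S₂ hδω), map_zero]
  · rw [← map_mul, hRes_comm_Qres, map_mul]
  · rw [← map_mul, hRes_comm_Goff, map_mul]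
  · rw [← map_mul, hRes_comm_S₂, map_mul]
  · rw [← map_mul, hσ3]
  · rw [← map_mul, hσ2]
  · rw [← map_mul, norm_op, hRes_mul_Qres]
    exact norm_kronecker_le_of_le ((S.norm_HS_sub_mul_P₁ hδ0).trans EB.width.le) norm_bC_le
  · rw [← map_mul, ← map_smul, ← map_sub, norm_op, hRes_mul_Goff, σoff]
    have : (S.HS * S.P₁) ⊗ₖ bZ - (S.ω₁ : ℂ) • (S.P₀ ⊗ₖ bC)
        - (S.ω₁ : ℂ) • (S.P₁ ⊗ₖ bZ - S.P₀ ⊗ₖ bC)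
        = ((S.HS - (S.ω₁ : ℂ) • 1) * S.P₁) ⊗ₖ bZ := by
      rw [sub_mul, sub_kronecker, smul_mul_assoc, one_mul, Matrix.smul_kronecker, smul_sub]
      abel
    rw [this]
    exact norm_kronecker_le_of_le ((S.norm_HS_sub_mul_P₁ hδ0).trans EB.width.le) norm_bZ_le
  · rw [← map_add, ← map_add, ← map_mul, ← map_mul, norm_op, ← starFS, norm_star]
    exact hcross
  · rw [← map_add, ← map_add, ← map_mul, ← map_mul, norm_op]
    exact hcross
  · rw [← map_add, ← map_mul, ← map_mul, norm_op]
    have := EB.block₂₂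
    rw [div_lt_iff₀ hΔ] at this
    linarith
  · rw [← map_add, ← map_mul, ← map_mul, norm_op, S.Qres_add_Goff]
    have := EB.block₁₁
    rw [div_lt_iff₀ hΔ] at this
    refine this.le.trans (le_of_eq ?_)
    field_simp
  · rw [← map_mul, ← map_mul, norm_op]; exact hGVG
  · rw [← map_mul, ← map_mul, norm_op, ← Ω₀_eq hΔ]; exact hQVG
  · rw [← map_mul, ← map_mul, norm_op, ← starQG, norm_star, ← Ω₀_eq hΔ]; exact hQVG
  · rw [← map_mul, ← map_mul, ← map_mul, ← map_mul, norm_op]; exact hsec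

end System

end

noncomputable section

/-! ### The couplings `X` and `Y` on the resonant blocks -/

section FlowShift

variable {E : Type*} [NormedAddCommGroup E] [InnerProductSpace ℂ E] [CompleteSpace E]

lemma flow_add_smul_one (A : E →L[ℂ] E) (c : ℂ) (t : ℝ) :
    flow (A + c • 1) t = Complex.exp (-Complex.I * t * c) • flow A t := by
  let _ : NormedAlgebra ℚ (E →L[ℂ] E) := NormedAlgebra.restrictScalars ℚ ℂ _
  have h1 : NormedSpace.exp ((-Complex.I * (t : ℂ) * c) • (1 : E →L[ℂ] E))
      = Complex.exp (-Complex.I * t * c) • 1 := by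
    have := NormedSpace.algebraMap_exp_comm (𝔸 := E →L[ℂ] E) (-Complex.I * (t : ℂ) * c)
    rw [Algebra.algebraMap_eq_smul_one, Algebra.algebraMap_eq_smul_one] at this
    rw [← this, Complex.exp_eq_exp_ℂ]
  rw [flow, flow, smul_add, NormedSpace.exp_add_of_commute, smul_smul, h1, mul_smul_comm, mul_one]
  rw [smul_smul]
  exact (Commute.one_right _).smul_right _

end FlowShift

lemma op_evolution {m : Type} [Fintype m] [DecidableEq m] (A : Matrix m m ℂ) (t : ℝ) :
    op (evolution A t) = flow (op A) t := by
  let _ : NormedAlgebra ℚ (Matrix m m ℂ) := NormedAlgebra.restrictScalars ℚ ℂ _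
  let _ : NormedAlgebra ℚ (EuclideanSpace ℂ m →L[ℂ] EuclideanSpace ℂ m) :=
    NormedAlgebra.restrictScalars ℚ ℂ _
  rw [evolution, flow, ← map_smul]
  exact NormedSpace.map_exp (op (m := m))
    (AddMonoidHomClass.isometry_of_norm (op (m := m)) norm_op).continuous _

namespace System

variable {ι : Type} [Fintype ι] [DecidableEq ι] {S : System ι}

lemma P₁_TS_P₀ (hΩ : 0 < S.Ω) : S.P₁ * S.TS * S.P₀ = (S.Ω : ℂ) • ketBra S.one S.ground := by
  have : (S.Ω : ℂ) ≠ 0 := by exact_mod_cast hΩ.ne'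
  rw [P₀, mul_ketBra, one, ketBra, ketBra, ← Matrix.smul_vecMulVec, smul_smul, mul_inv_cancel₀ this,
    one_smul]

lemma P₀_TS_P₁ (hΩ : 0 < S.Ω) : S.P₀ * S.TS * S.P₁ = (S.Ω : ℂ) • ketBra S.ground S.one := by
  have h := congrArg star (P₁_TS_P₀ hΩ)
  have hT : star S.TS = S.TS := S.TS_herm
  rw [star_mul, star_mul, S.isSelfAdjoint_P₀, S.isSelfAdjoint_P₁, hT, star_smul, star_ketBra,
    ← mul_assoc] at h
  simpa using h

lemma norm_one_vec (hΩ : 0 < S.Ω) : ‖WithLp.toLp 2 S.one‖ = 1 := by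
  rw [one, WithLp.toLp_smul, norm_smul, norm_inv, Complex.norm_real, Real.norm_of_nonneg hΩ.le]
  exact inv_mul_cancel₀ hΩ.ne'

lemma P₁_one : S.P₁ *ᵥ S.one = S.one := by
  rw [one, Matrix.mulVec_smul, Matrix.mulVec_mulVec, ← mul_assoc, S.P₁_mul_P₁]

lemma P₀_ground : S.P₀ *ᵥ S.ground = S.ground := by
  rw [P₀, ketBra_mulVec, S.star_ground_dotProduct, one_smul]

lemma P₀_TS_P₀ : S.P₀ * S.TS * S.P₀ = (star S.ground ⬝ᵥ (S.TS *ᵥ S.ground)) • S.P₀ := by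
  rw [mul_assoc, P₀, mul_ketBra, ketBra_mul_ketBra]

lemma X_eq : S.X = S.TS ⊗ₖ bX := rfl

lemma star_X : star S.X = S.X := by
  have hT : star S.TS = S.TS := S.TS_herm
  rw [X_eq, star_kronecker, hT, star_bX]

lemma Y_eq : S.Y = (S.Ω₀ : ℂ) • ((1 : Matrix ι ι ℂ) ⊗ₖ bY) := rfl

lemma star_Y : star S.Y = S.Y := by
  rw [Y_eq, star_smul, star_kronecker, star_bY, star_one]
  simp

lemma norm_X_le : ‖S.X‖ ≤ S.Ω₀ := norm_kronecker_le_of_le le_rfl norm_bX_le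

lemma Ω₀_nonneg : 0 ≤ S.Ω₀ := norm_nonneg _

lemma norm_one_le : ‖(1 : Matrix ι ι ℂ)‖ ≤ 1 := (IsStarProjection.one _).norm_le

lemma norm_Y_le : ‖S.Y‖ ≤ S.Ω₀ := by
  rw [Y_eq, norm_smul, Complex.norm_real, Real.norm_of_nonneg Ω₀_nonneg]
  have := norm_kronecker_le_of_le (norm_one_le (ι := ι)) norm_bY_le
  nlinarith [Ω₀_nonneg (S := S)]

lemma norm_mul_mul_le {m : Type} [Fintype m] [DecidableEq m] {A B C : Matrix m m ℂ} {c : ℝ}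
    (hA : ‖A‖ ≤ 1) (hB : ‖B‖ ≤ c) (hC : ‖C‖ ≤ 1) : ‖A * B * C‖ ≤ c := by
  calc _ ≤ ‖A‖ * ‖B‖ * ‖C‖ := (norm_mul_le _ _).trans (by gcongr; exact norm_mul_le _ _)
    _ ≤ 1 * c * 1 := by
      have := (norm_nonneg B).trans hB
      gcongr
    _ = c := by ring

lemma norm_ketBra_bath_le {u v : Bath → ℂ} (hu : star u ⬝ᵥ u = 1) (hv : star v ⬝ᵥ v = 1) :
    ‖ketBra u v‖ ≤ 1 := by
  have hn : ∀ {b : Bath → ℂ}, star b ⬝ᵥ b = 1 → ‖WithLp.toLp 2 b‖ = 1 := by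
    intro b hb
    have h1 := inner_self_eq_norm_sq_to_K (𝕜 := ℂ) (WithLp.toLp 2 b)
    rw [EuclideanSpace.inner_toLp_toLp, dotProduct_comm, hb] at h1
    have h2 : (1 : ℝ) = ‖WithLp.toLp 2 b‖ ^ 2 := by
      have h3 : ((1 : ℝ) : ℂ) = ((‖WithLp.toLp 2 b‖ ^ 2 : ℝ) : ℂ) := by
        rw [Complex.ofReal_one, h1, Complex.ofReal_pow]; rfl
      exact Complex.ofReal_injective h3
    exact (pow_eq_one_iff_of_nonneg (norm_nonneg _) two_ne_zero).mp h2.symm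
  simpa [hn hu, hn hv] using norm_ketBra_le u v

/-- The bath factor of `X` exchanges C with the other levels, so only the matrix elements of `TS`
between `P₀` and `P₁` survive, and these have rank one. -/
lemma Qres_X_Qres (hΩ : 0 < S.Ω) : S.Qres * S.X * S.Qres
    = (S.Ω : ℂ) • (ketBra S.one S.ground ⊗ₖ ketBra ketC ketB
        + ketBra S.ground S.one ⊗ₖ ketBra ketB ketC) := by
  rw [Qres, X_eq]
  simp only [add_mul, mul_add, ← Matrix.mul_kronecker_mul]
  simp only [bC_bX_bC, bN_bX_bN, bC_bX_bN, bN_bX_bC, P₁_TS_P₀ hΩ, P₀_TS_P₁ hΩ,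
    Matrix.kronecker_zero, Matrix.smul_kronecker, zero_add, add_zero, smul_add]
  rw [add_comm]

/-- The same rank-one elements appear with the roles of `P₀` and `P₁` exchanged. It matters that the
bound involves `Ω` and not the possibly much larger `Ω₀`. -/
lemma norm_Goff_X_Goff (hΩ : 0 < S.Ω) : ‖S.Goff * S.X * S.Goff‖ ≤ 2 * S.Ω := by
  have h : S.Goff * S.X * S.Goff = (S.Ω : ℂ) • (ketBra S.ground S.one ⊗ₖ ketBra ketC ketB)
      + (S.Ω : ℂ) • (ketBra S.one S.ground ⊗ₖ ketBra ketB ketC) := by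
    rw [Goff, X_eq]
    simp only [add_mul, mul_add, ← Matrix.mul_kronecker_mul]
    simp only [bC_bX_bC, bN_bX_bN, bC_bX_bN, bN_bX_bC, P₁_TS_P₀ hΩ, P₀_TS_P₁ hΩ,
      Matrix.kronecker_zero, Matrix.smul_kronecker, zero_add, add_zero]
    rw [add_comm]
  have n1 : ‖ketBra S.ground S.one ⊗ₖ ketBra ketC ketB‖ ≤ 1 := by
    refine norm_kronecker_le_of_le ((norm_ketBra_le _ _).trans ?_)
      (norm_ketBra_bath_le ketC_ketC ketB_ketB)
    rw [S.norm_gs, norm_one_vec hΩ, mul_one]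
  have n2 : ‖ketBra S.one S.ground ⊗ₖ ketBra ketB ketC‖ ≤ 1 := by
    refine norm_kronecker_le_of_le ((norm_ketBra_le _ _).trans ?_)
      (norm_ketBra_bath_le ketB_ketB ketC_ketC)
    rw [S.norm_gs, norm_one_vec hΩ, mul_one]
  rw [h]
  refine (norm_add_le _ _).trans ?_
  rw [norm_smul, norm_smul, Complex.norm_real, Real.norm_of_nonneg hΩ.le]
  nlinarith

/-- The detunings of `P₁` with L and with R cancel. The only remaining intermediate state is the
ground state with C, reached through the diagonal element of `TS`; this is what the hypothesis
`shift` controls. -/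
lemma Qres_X_σoff_X_Qres : S.Qres * S.X * S.σoff * S.X * S.Qres
    = -((star S.ground ⬝ᵥ (S.TS *ᵥ S.ground)) ^ 2 • (S.P₀ ⊗ₖ ketBra ketB ketB)) := by
  have h1 : S.X * S.σoff * S.X = -((S.TS * S.P₀ * S.TS) ⊗ₖ ketBra ketB ketB) := by
    rw [X_eq, σoff]
    simp only [mul_sub, sub_mul, ← Matrix.mul_kronecker_mul]
    simp only [bX_bZ_bX, bX_bC_bX, Matrix.kronecker_zero, zero_sub]
  have h2 : ketBra ketB ketB * bC = 0 := by
    have := congrArg star bC_bB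
    rwa [star_mul, star_bC, star_ketBra, star_zero] at this
  have h3 : S.Qres * S.X * S.σoff * S.X * S.Qres
      = S.Qres * (S.X * S.σoff * S.X) * S.Qres := by simp only [mul_assoc]
  have h4 : S.P₀ * (S.TS * S.P₀ * S.TS) * S.P₀
      = (star S.ground ⬝ᵥ (S.TS *ᵥ S.ground)) ^ 2 • S.P₀ := by
    have : S.P₀ * (S.TS * S.P₀ * S.TS) * S.P₀
        = (S.P₀ * S.TS * S.P₀) * (S.P₀ * S.TS * S.P₀) := by
      conv_lhs => rw [← S.P₀_mul_P₀]
      rw [S.P₀_mul_P₀]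
      simp only [mul_assoc]
      rw [← mul_assoc S.P₀ S.P₀, S.P₀_mul_P₀]
    rw [this, P₀_TS_P₀, smul_mul_assoc, mul_smul_comm, S.P₀_mul_P₀, smul_smul, sq]
  rw [h3, h1, mul_neg, neg_mul, Qres]
  congr 1
  simp only [add_mul, mul_add, ← Matrix.mul_kronecker_mul, bC_bB, bN_bB_bN]
  rw [mul_assoc bN (ketBra ketB ketB) bC, h2]
  simp only [zero_mul, mul_zero, Matrix.kronecker_zero, zero_add]
  rw [h4, Matrix.smul_kronecker]

lemma δω_le (hΔ : 0 < S.Δ) {V δ : Matrix (ι × Bath) (ι × Bath) ℂ} {w : ℝ}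
    (hr : S.r ≤ 1 / 1000) (hw : 0 < w) (hwΩ : w ≤ S.Ω₀) (EB : S.ErrorBound V δ w) :
    S.δω ≤ S.Δ / 4 := by
  have h1 := EB.width
  rw [Ω₀_eq hΔ] at hwΩ
  have hrpos : 0 < S.r := pos_of_mul_pos_left (hw.trans_le hwΩ) hΔ.le
  nlinarith [mul_pos hrpos hΔ]

theorem resonant_X {δ : Matrix (ι × Bath) (ι × Bath) ℂ} (hΔ : 0 < S.Δ) (hΩ : 0 < S.Ω)
    (hr : S.r ≤ 1 / 1000) (hδ : δ.IsHermitian) (EB : S.ErrorBound S.X δ S.Ω) :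
    Resonant (op S.hRes) (op S.X) (op δ) (op S.Qres) (op S.Goff) (op S.S₂) (op S.σoff)
      S.ω₁ S.r S.Ω S.Δ := by
  refine resonant hΔ hΩ hr hΩ Ω_le_Ω₀ EB star_X hδ (norm_Goff_X_Goff hΩ)
    (norm_mul_mul_le isStarProjection_Qres.norm_le norm_X_le isStarProjection_Goff.norm_le) ?_
  rw [Qres_X_σoff_X_Qres, norm_neg, norm_smul, norm_pow]
  have h1 : ‖S.P₀ ⊗ₖ ketBra ketB ketB‖ ≤ 1 :=
    norm_kronecker_le_of_le S.norm_P₀_le (norm_ketBra_bath_le ketB_ketB ketB_ketB)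
  have h2 := EB.shift
  rw [div_lt_iff₀ S.ω₁_pos] at h2
  nlinarith [sq_nonneg ‖star S.ground ⬝ᵥ (S.TS *ᵥ S.ground)‖, norm_nonneg (S.P₀ ⊗ₖ ketBra ketB ketB)]

/-- `Y` vanishes on C and does not act on the system, so it cannot connect `P₀` to `P₁`. -/
lemma Qres_Y_Goff (h : S.δω ≤ S.ω₁) : S.Qres * S.Y * S.Goff = 0 := by
  rw [Qres, Goff, Y_eq]
  simp only [mul_smul_comm, smul_mul_assoc, add_mul, mul_add, ← Matrix.mul_kronecker_mul, bC_bY,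
    bN_bY, bY_bC, mul_one, S.P₀_mul_P₁ h, zero_mul, Matrix.kronecker_zero, Matrix.zero_kronecker,
    add_zero, smul_zero]

lemma Qres_Y_Qres : S.Qres * S.Y * S.Qres
    = (S.Ω₀ : ℂ) • (ketBra S.ground S.ground ⊗ₖ ketBra ketL ketR
        + ketBra S.ground S.ground ⊗ₖ ketBra ketR ketL) := by
  rw [Qres, Y_eq]
  simp only [mul_smul_comm, smul_mul_assoc, add_mul, mul_add, ← Matrix.mul_kronecker_mul, bC_bY,
    bN_bY, bY_bC, bY_bN, mul_one, Matrix.kronecker_zero, zero_add, S.P₀_mul_P₀]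
  rw [smul_zero, zero_add, ← Matrix.kronecker_add]
  rfl

theorem resonant_Y {δ : Matrix (ι × Bath) (ι × Bath) ℂ} (hΔ : 0 < S.Δ) (hΩ : 0 < S.Ω)
    (hr : S.r ≤ 1 / 1000) (hδ : δ.IsHermitian) (EB : S.ErrorBound S.Y δ S.Ω₀) :
    Resonant (op S.hRes) (op S.Y) (op δ) (op S.Qres) (op S.Goff) (op S.S₂) (op S.σoff)
      S.ω₁ S.r S.Ω₀ S.Δ := by
  have hΩ₀ : 0 < S.Ω₀ := hΩ.trans_le Ω_le_Ω₀
  have hδω : S.δω ≤ S.ω₁ := by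
    have := δω_le hΔ hr hΩ₀ le_rfl EB
    have := S.Δ_le_ω₁ hΔ
    linarith
  have hr0 : 0 < S.r := div_pos hΩ₀ hΔ
  refine resonant hΔ hΩ hr hΩ₀ le_rfl EB star_Y hδ ?_ ?_ ?_
  · have := norm_mul_mul_le (isStarProjection_Goff (S := S)).norm_le (norm_Y_le (S := S))
      (isStarProjection_Goff (S := S)).norm_le
    linarith
  · rw [Qres_Y_Goff hδω, norm_zero]; exact hΩ₀.le
  · obtain ⟨-, hσ2, hσ3⟩ := norm_σoff_le (S := S)
    have h1 : S.Goff * S.σoff = S.σoff := by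
      have := congrArg star hσ3
      rwa [star_mul, S.star_σoff, isStarProjection_Goff.isSelfAdjoint.star_eq] at this
    have h2 : S.Qres * S.Y * S.σoff = 0 := by
      rw [← h1, ← mul_assoc, Qres_Y_Goff hδω, zero_mul]
    rw [h2, zero_mul, zero_mul, norm_zero]
    have := S.ω₁_pos
    positivity

end System

end

noncomputable section

/-! ### Ground-state amplitudes of the two evolutions -/

section Contraction

variable {m n : Type} [Fintype n]

/-- The partial inner product `⟨c|x⟩` with a vector of the second factor. -/
def contr (c : n → ℂ) (x : EuclideanSpace ℂ (m × n)) : EuclideanSpace ℂ m :=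
  WithLp.toLp 2 fun i => ∑ b, star (c b) * x (i, b)

variable [Fintype m]

lemma inner_contr (c : n → ℂ) (x : EuclideanSpace ℂ (m × n)) (v : EuclideanSpace ℂ m) :
    (inner ℂ v (contr c x) : ℂ) = inner ℂ (tens v c) x := by
  simp only [contr, tens, EuclideanSpace.inner_eq_star_dotProduct, dotProduct,
    Fintype.sum_prod_type, Finset.sum_mul, Pi.star_apply, star_mul']
  refine Finset.sum_congr rfl fun i _ => Finset.sum_congr rfl fun j _ => ?_
  ring

lemma op_kronecker_ketBra [DecidableEq m] [DecidableEq n] (M : Matrix m m ℂ) (b c : n → ℂ) (x : EuclideanSpace ℂ (m × n)) :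
    op (M ⊗ₖ ketBra b c) x = tens (op M (contr c x)) b := by
  apply WithLp.ofLp_injective
  funext p
  simp only [Matrix.ofLp_toEuclideanCLM, Matrix.mulVec, dotProduct, Matrix.kroneckerMap_apply,
    ketBra, Matrix.vecMulVec_apply, tens, contr, Fintype.sum_prod_type, Finset.sum_mul,
    Finset.mul_sum, Pi.star_apply]
  refine Finset.sum_congr rfl fun i _ => Finset.sum_congr rfl fun j _ => ?_
  ring

lemma norm_contr_le {c : n → ℂ} (hc : star c ⬝ᵥ c = 1) (x : EuclideanSpace ℂ (m × n)) :
    ‖contr c x‖ ≤ ‖x‖ := by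
  have h1 : (inner ℂ (tens (contr c x) c) x : ℂ) = (‖contr c x‖ : ℂ) ^ 2 := by
    rw [← inner_contr, inner_self_eq_norm_sq_to_K]; rfl
  have h2 := norm_inner_le_norm (𝕜 := ℂ) (tens (contr c x) c) x
  rw [h1, norm_tens hc, norm_pow, Complex.norm_real, norm_norm, sq] at h2
  by_cases h0 : ‖contr c x‖ = 0
  · rw [h0]; exact norm_nonneg _
  · exact le_of_mul_le_mul_left h2 (lt_of_le_of_ne (norm_nonneg _) (Ne.symm h0))

end Contraction

lemma one_sub_abs_sin_le {x y : ℝ} (hx : |Real.sin y| = 1) : 1 - |Real.sin x| ≤ |x - y| := by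
  have h1 := Real.abs_sin_sub_sin_le x y
  have h2 := abs_sub_abs_le_abs_sub (Real.sin y) (Real.sin x)
  rw [hx, abs_sub_comm] at h2
  linarith

namespace System

variable {ι : Type} [Fintype ι] [DecidableEq ι] {S : System ι}

/-- The amplitude of finding the resonant partner of `e₁` oscillates as `sin (w' t)`. -/
theorem abs_amplitude {V δ : Matrix (ι × Bath) (ι × Bath) ℂ} {w : ℝ}
    (R : Resonant (op S.hRes) (op V) (op δ) (op S.Qres) (op S.Goff) (op S.S₂) (op S.σoff)
      S.ω₁ S.r w S.Δ) (hV : star V = V) (hδ : star δ = δ)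
    {e₁ e₂ : EuclideanSpace ℂ (ι × Bath)} (h1 : ‖e₁‖ = 1) (h2 : ‖e₂‖ = 1)
    (h12 : (inner ℂ e₁ e₂ : ℂ) = 0) (hQ1 : op S.Qres e₁ = e₁) (hQ2 : op S.Qres e₂ = e₂)
    (hM : ∀ x, op (S.Qres * V * S.Qres) x
      = (w : ℂ) • ((inner ℂ e₂ x : ℂ) • e₁ + (inner ℂ e₁ x : ℂ) • e₂)) :
    ∃ w' : ℝ, |w' - w| ≤ 8 * S.r * w ∧ ∀ (t : ℝ) (x : EuclideanSpace ℂ (ι × Bath)),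
      (inner ℂ e₂ x : ℂ) = 0 →
      |‖(inner ℂ e₂ (op (evolution (S.H + V + δ) t) x) : ℂ)‖
        - |Real.sin (w' * t)| * ‖(inner ℂ e₁ x : ℂ)‖| ≤ 200 * S.r * ‖x‖ := by
  have hsa : IsSelfAdjoint (op S.hRes + op V + op δ) := by
    rw [← map_add, ← map_add]
    refine isSelfAdjoint_op ?_
    change star _ = _
    rw [star_add, star_add, S.star_hRes, hV, hδ]
  obtain ⟨w', hw', hfl⟩ := R.rabi hsa h1 h2 h12 hQ1 hQ2 (fun x hx => by
    rw [← hM]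
    simp only [map_mul, mul_apply_eq_comp, hx])
  refine ⟨w', hw', fun t x hx => ?_⟩
  -- The evolution is moved, reversed in time, onto the resonant vector `e₂`. Thus nothing is needed
  -- about the nonresonant components of `x`.
  obtain ⟨z, hz, hfl⟩ := hfl (-t)
  have hH : op (S.H + V + δ) = (op S.hRes + op V + op δ) + (S.ω₁ : ℂ) • 1 := by
    rw [S.H_eq, map_add, map_add, map_add, map_smul, map_one]
    abel
  have hphase : ‖Complex.exp (-Complex.I * t * S.ω₁)‖ = 1 := by
    rw [show -Complex.I * t * S.ω₁ = ((-t * S.ω₁ : ℝ) : ℂ) * Complex.I by push_cast; ring]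
    exact Complex.norm_exp_ofReal_mul_I _
  rw [op_evolution, hH, flow_add_smul_one, smul_apply, inner_smul_right, norm_mul, hphase, one_mul,
    inner_flow_right hsa]
  set y := z • ((Real.cos (w' * -t) : ℂ) • e₂ - (Complex.I * Real.sin (w' * -t)) • e₁) with hy
  have hyx : ‖(inner ℂ y x : ℂ)‖ = |Real.sin (w' * t)| * ‖(inner ℂ e₁ x : ℂ)‖ := by
    rw [hy, inner_smul_left, inner_sub_left, inner_smul_left, inner_smul_left, hx, mul_zero,
      zero_sub, norm_mul, norm_neg, norm_mul, RCLike.norm_conj, RCLike.norm_conj, hz, norm_mul,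
      Complex.norm_I, Complex.norm_real, mul_neg, Real.sin_neg]
    simp
  rw [← hyx]
  calc _ ≤ ‖(inner ℂ (flow (op S.hRes + op V + op δ) (-t) e₂) x - inner ℂ y x : ℂ)‖ :=
        abs_norm_sub_norm_le _ _
    _ ≤ 200 * S.r * ‖x‖ := by
      rw [← inner_sub_left]
      refine (norm_inner_le_norm _ _).trans ?_
      gcongr

/-- The vector `|1⟩`. -/
abbrev vone (S : System ι) : EuclideanSpace ℂ ι := WithLp.toLp 2 S.one

/-- The vector `|F⟩`. -/
abbrev vF (S : System ι) : EuclideanSpace ℂ ι := WithLp.toLp 2 S.F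

lemma norm_vF : ‖S.vF‖ = 1 := by
  have := S.F_norm
  rw [normSq] at this
  exact (pow_eq_one_iff_of_nonneg (norm_nonneg _) two_ne_zero).mp this

lemma inner_vone_vF : (inner ℂ S.vone S.vF : ℂ) = S.f₁ := by
  rw [EuclideanSpace.inner_toLp_toLp, dotProduct_comm, f₁]

lemma bC_mulVec_ketC : bC *ᵥ ketC = ketC := by rw [bC, ketBra_mulVec, ketC_ketC, one_smul]
lemma bN_mulVec_ketC : bN *ᵥ ketC = 0 := by
  rw [bN_eq, ketC_eq]; ext i; fin_cases i <;> simp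
lemma bC_mulVec_of_bN {u : Bath → ℂ} (h : bN *ᵥ u = u) : bC *ᵥ u = 0 := by
  rw [← h, Matrix.mulVec_mulVec, bC_bN, Matrix.zero_mulVec]
lemma bN_mulVec_ketB : bN *ᵥ ketB = ketB := by
  rw [bN_eq, ketB_eq]; ext i; fin_cases i <;> simp
lemma bN_mulVec_ketL : bN *ᵥ ketL = ketL := by
  rw [bN_eq, ketL_eq]; ext i; fin_cases i <;> simp
lemma bN_mulVec_ketR : bN *ᵥ ketR = ketR := by
  rw [bN_eq, ketR_eq]; ext i; fin_cases i <;> simp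
lemma bZ_mulVec_ketL : bZ *ᵥ ketL = -ketL := by
  rw [bZ_eq, ketL_eq]; ext i; fin_cases i <;> simp
lemma bZ_mulVec_ketR : bZ *ᵥ ketR = ketR := by
  rw [bZ_eq, ketR_eq]; ext i; fin_cases i <;> simp

lemma tens_zero {m n : Type} (x : EuclideanSpace ℂ m) : tens x (0 : n → ℂ) = 0 := by
  apply WithLp.ofLp_injective
  funext p
  simp [tens]

lemma op_Qres_gs {u : Bath → ℂ} (h : bN *ᵥ u = u) : op S.Qres (tens S.gs u) = tens S.gs u := by
  have h1 : op S.P₀ S.gs = S.gs := by rw [Matrix.toEuclideanCLM_toLp, P₀_ground]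
  rw [Qres, map_add, add_apply, op_kronecker_tens, op_kronecker_tens, h, bC_mulVec_of_bN h,
    tens_zero, zero_add, h1]

lemma op_Qres_one : op S.Qres (tens S.vone ketC) = tens S.vone ketC := by
  have h1 : op S.P₁ S.vone = S.vone := by rw [Matrix.toEuclideanCLM_toLp, P₁_one]
  rw [Qres, map_add, add_apply, op_kronecker_tens, op_kronecker_tens, bN_mulVec_ketC,
    bC_mulVec_ketC, tens_zero, add_zero, h1]

/-- The amplitude of the ground state with the bath in `B` after the first evolution. -/
theorem evolved_amplitude {δ : Matrix (ι × Bath) (ι × Bath) ℂ} (hΔ : 0 < S.Δ) (hΩ : 0 < S.Ω)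
    (hr : S.r ≤ 1 / 1000) (hδ : δ.IsHermitian) (EB : S.ErrorBound S.X δ S.Ω) :
    ∃ w' : ℝ, |w' - S.Ω| ≤ 8 * S.r * S.Ω ∧ ∀ t : ℝ,
      |‖(inner ℂ S.gs (contr ketB (WithLp.toLp 2 (S.evolved δ t))) : ℂ)‖
        - |Real.sin (w' * t)| * ‖S.f₁‖| ≤ 200 * S.r := by
  obtain ⟨w', hw', h⟩ := abs_amplitude (resonant_X hΔ hΩ hr hδ EB) star_X hδ
    (e₁ := tens S.vone ketC) (e₂ := tens S.gs ketB)
    (by rw [norm_tens ketC_ketC, norm_one_vec hΩ]) (by rw [norm_tens ketB_ketB, S.norm_gs])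
    (by rw [inner_tens, ketC_ketB, mul_zero]) op_Qres_one (op_Qres_gs bN_mulVec_ketB)
    (fun x => by
      rw [Qres_X_Qres hΩ, map_smul, map_add, smul_apply, add_apply, op_ketBra_kronecker,
        op_ketBra_kronecker])
  refine ⟨w', hw', fun t => ?_⟩
  have h1 := h t (tens S.vF ketC) (by rw [inner_tens, ketB_ketC, mul_zero])
  rw [inner_tens, ketC_ketC, mul_one, inner_vone_vF, norm_tens ketC_ketC, norm_vF, mul_one] at h1
  rw [inner_contr]
  exact h1

lemma norm_evolved {δ : Matrix (ι × Bath) (ι × Bath) ℂ} (hδ : δ.IsHermitian) (t : ℝ) :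
    ‖WithLp.toLp 2 (S.evolved δ t)‖ = 1 := by
  have hsa : IsSelfAdjoint (op (S.H + S.X + δ)) := by
    refine isSelfAdjoint_op ?_
    have : star δ = δ := hδ
    change star _ = _
    rw [star_add, star_add, star_X, this, S.H_eq, star_add, S.star_hRes, star_smul, star_one]
    simp
  have h : WithLp.toLp 2 (S.evolved δ t)
      = op (evolution (S.H + S.X + δ) t) (tens S.vF ketC) := rfl
  rw [h, op_evolution, norm_flow_apply hsa, norm_tens ketC_ketC, norm_vF]

/-- The verification maps `|0 L⟩` to `|0 R⟩` up to a phase and a small error. -/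
theorem verification_amplitude {δ : Matrix (ι × Bath) (ι × Bath) ℂ} (hΔ : 0 < S.Δ) (hΩ : 0 < S.Ω)
    (hr : S.r ≤ 1 / 1000) (hδ : δ.IsHermitian) (EB : S.ErrorBound S.Y δ S.Ω₀)
    (φ : EuclideanSpace ℂ ι) :
    |‖(inner ℂ (tens S.gs ketR)
        (op (evolution (S.H + S.Y + δ) S.verificationTime) (tens φ ketL)) : ℂ)‖
      - ‖(inner ℂ S.gs φ : ℂ)‖| ≤ 220 * S.r * ‖φ‖ := by
  have hΩ₀ : 0 < S.Ω₀ := hΩ.trans_le Ω_le_Ω₀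
  have hrpos : 0 < S.r := div_pos hΩ₀ hΔ
  have hLR : star ketL ⬝ᵥ ketR = 0 := by
    simp [ketR_eq, ketL_eq, dotProduct, Fin.sum_univ_three]
  obtain ⟨w', hw', h⟩ := abs_amplitude (resonant_Y hΔ hΩ hr hδ EB) star_Y hδ
    (e₁ := tens S.gs ketL) (e₂ := tens S.gs ketR)
    (by rw [norm_tens ketL_ketL, S.norm_gs]) (by rw [norm_tens ketR_ketR, S.norm_gs])
    (by rw [inner_tens, hLR, mul_zero]) (op_Qres_gs bN_mulVec_ketL) (op_Qres_gs bN_mulVec_ketR)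
    (fun x => by
      rw [Qres_Y_Qres, map_smul, map_add, smul_apply, add_apply, op_ketBra_kronecker,
        op_ketBra_kronecker])
  have h1 := h S.verificationTime (tens φ ketL) (by rw [inner_tens, ketR_ketL, mul_zero])
  rw [inner_tens, ketL_ketL, mul_one, norm_tens ketL_ketL] at h1
  -- A frequency error of `8 r Ω₀` over the time `π / (2 Ω₀)` shifts the angle by at most `4 π r`.
  have h2 : |w' * S.verificationTime - Real.pi / 2| ≤ 20 * S.r := by
    have e : w' * S.verificationTime - Real.pi / 2 = (w' - S.Ω₀) * (Real.pi / (2 * S.Ω₀)) := by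
      rw [verificationTime]; field_simp
    rw [e, abs_mul, abs_of_pos (by positivity : 0 < Real.pi / (2 * S.Ω₀))]
    calc _ ≤ 8 * S.r * S.Ω₀ * (Real.pi / (2 * S.Ω₀)) := by gcongr
      _ = 4 * S.r * Real.pi := by field_simp; ring
      _ ≤ 20 * S.r := by nlinarith [Real.pi_lt_four]
  have h3 := one_sub_abs_sin_le (x := w' * S.verificationTime) (y := Real.pi / 2) (by simp)
  have h4 : ‖(inner ℂ S.gs φ : ℂ)‖ ≤ ‖φ‖ := by
    simpa [S.norm_gs] using norm_inner_le_norm (𝕜 := ℂ) S.gs φ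
  have h5 := Real.abs_sin_le_one (w' * S.verificationTime)
  set s := |Real.sin (w' * S.verificationTime)|
  set a := ‖(inner ℂ S.gs φ : ℂ)‖ with ha
  have ha0 : 0 ≤ a := norm_nonneg _
  have h6 : |s * a - a| ≤ 20 * S.r * ‖φ‖ := by
    rw [show s * a - a = -((1 - s) * a) by ring, abs_neg, abs_mul, abs_of_nonneg ha0,
      abs_of_nonneg (by linarith)]
    exact mul_le_mul (h3.trans h2) h4 ha0 (by positivity)
  calc _ ≤ _ := abs_sub_le _ (s * a) _
    _ ≤ 200 * S.r * ‖φ‖ + 20 * S.r * ‖φ‖ := add_le_add h1 h6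
    _ = _ := by ring

end System

end

/-! ### Energy conservation in the verification -/

noncomputable section

namespace System

variable {ι : Type} [Fintype ι] [DecidableEq ι] {S : System ι}

lemma star_H : star S.H = S.H := by
  rw [S.H_eq, star_add, S.star_hRes, star_smul, star_one]
  simp

lemma H_tens (v : EuclideanSpace ℂ ι) {b : Bath → ℂ} {s : ℂ} (hN : bN *ᵥ b = b)
    (hZ : bZ *ᵥ b = s • b) :
    op S.H (tens v b) = s • tens (op S.HS v) b + (S.ω₁ : ℂ) • tens v b := by
  rw [S.H_eq, hRes, map_add, map_add, map_smul, map_one, add_apply, add_apply, op_kronecker_tens,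
    op_kronecker_tens, hZ, bC_mulVec_of_bN hN, tens_zero, zero_add, smul_apply, one_apply_eq_self,
    tens_smul_right]

lemma re_inner_H_tens (v : EuclideanSpace ℂ ι) {b : Bath → ℂ} {s : ℝ} (hb : star b ⬝ᵥ b = 1)
    (hN : bN *ᵥ b = b) (hZ : bZ *ᵥ b = (s : ℂ) • b) :
    RCLike.re (inner ℂ (tens v b) (op S.H (tens v b)) : ℂ)
      = s * RCLike.re (inner ℂ v (op S.HS v) : ℂ) + S.ω₁ * ‖v‖ ^ 2 := by
  rw [H_tens v hN hZ, inner_add_right, inner_smul_right, inner_smul_right, inner_tens, hb, mul_one,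
    inner_self_eq_norm_sq_to_K, norm_tens hb, map_add]
  congr 1
  · exact Complex.re_ofReal_mul _ _
  · change ((S.ω₁ : ℂ) * (‖v‖ : ℂ) ^ 2).re = _
    rw [← Complex.ofReal_pow, ← Complex.ofReal_mul, Complex.ofReal_re]

lemma re_inner_HS_nonneg (v : EuclideanSpace ℂ ι) : 0 ≤ RCLike.re (inner ℂ v (op S.HS v) : ℂ) := by
  rw [re_inner_op S.posSemidef.isHermitian]
  exact Finset.sum_nonneg fun i _ =>
    mul_nonneg (S.posSemidef.eigenvalues_nonneg i) (sq_nonneg _)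

lemma isStarProjection_kronecker {m n : Type} [Fintype m] [Fintype n]
    {P : Matrix m m ℂ} {Q : Matrix n n ℂ} (hP : IsStarProjection P) (hQ : IsStarProjection Q) :
    IsStarProjection (P ⊗ₖ Q) where
  isIdempotentElem := by
    rw [IsIdempotentElem, ← Matrix.mul_kronecker_mul, hP.isIdempotentElem.eq,
      hQ.isIdempotentElem.eq]
  isSelfAdjoint := by
    rw [isSelfAdjoint_iff, star_kronecker, hP.isSelfAdjoint.star_eq, hQ.isSelfAdjoint.star_eq]

lemma H_comm_kronecker {P : Matrix ι ι ℂ} {b : Bath → ℂ} {s : ℂ} (hP : S.HS * P = P * S.HS)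
    (hPs : star P = P) (hN : bN *ᵥ b = b) (hZ : bZ *ᵥ b = s • b) (hs : star s = s) :
    S.H * (P ⊗ₖ ketBra b b) = (P ⊗ₖ ketBra b b) * S.H := by
  have e : S.H * (P ⊗ₖ ketBra b b)
      = s • ((S.HS * P) ⊗ₖ ketBra b b) + (S.ω₁ : ℂ) • (P ⊗ₖ ketBra b b) := by
    rw [S.H_eq, hRes, add_mul, add_mul, ← Matrix.mul_kronecker_mul, ← Matrix.mul_kronecker_mul,
      mul_ketBra, mul_ketBra, hZ, bC_mulVec_of_bN hN, smul_mul_assoc, one_mul]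
    have h0 : ketBra (0 : Bath → ℂ) b = 0 := Matrix.zero_vecMulVec _
    have h1 : ketBra (s • b) b = s • ketBra b b := Matrix.smul_vecMulVec _ _ _
    rw [h0, h1, Matrix.kronecker_zero, zero_add, Matrix.kronecker_smul]
  have hHS : star S.HS = S.HS := S.posSemidef.isHermitian
  refine mul_comm_of_selfAdjoint star_H (by rw [star_kronecker, hPs, star_ketBra]) ?_
  rw [e, star_add, star_smul, star_smul, star_kronecker, star_kronecker, star_ketBra, hPs,
    star_mul, hPs, hHS, hs, hP]
  simp

lemma norm_perturbation_le {V δ : Matrix (ι × Bath) (ι × Bath) ℂ} {a b c d : ℝ}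
    (h11 : ‖S.S₁ * (V + δ) * S.S₁‖ ≤ a) (h12 : ‖S.S₁ * (V + δ) * S.S₂‖ ≤ b)
    (h21 : ‖S.S₂ * (V + δ) * S.S₁‖ ≤ c) (h22 : ‖S.S₂ * (V + δ) * S.S₂‖ ≤ d) :
    ‖V + δ‖ ≤ a + b + c + d := by
  have e : V + δ = S.S₁ * (V + δ) * S.S₁ + S.S₁ * (V + δ) * S.S₂ + S.S₂ * (V + δ) * S.S₁
      + S.S₂ * (V + δ) * S.S₂ := by
    conv_lhs => rw [← one_mul (V + δ), ← mul_one (1 * (V + δ)), ← S.S₁_add_S₂]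
    noncomm_ring
  rw [e]
  exact norm_add₄_le.trans (by gcongr)

/-- The four blocks with respect to `S₁` and `S₂` contribute `2 r Δ`, `r Δ`, `r Δ` and `κ r Δ`. The
error bounds alone only give `Δ / 2` on the last block, which is why the verification bound is
required. -/
lemma norm_Y_add_le {δ : Matrix (ι × Bath) (ι × Bath) ℂ} {κ : ℝ} (hΔ : 0 < S.Δ) (hΩ : 0 < S.Ω)
    (hr : S.r ≤ 1 / 1000) (hδ : δ.IsHermitian) (EB : S.ErrorBound S.Y δ S.Ω₀)
    (VB : S.VerificationBound δ κ) : ‖S.Y + δ‖ ≤ (4 + κ) * S.r * S.Δ := by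
  have hΩ₀ : 0 < S.Ω₀ := hΩ.trans_le Ω_le_Ω₀
  have hrpos : 0 < S.r := div_pos hΩ₀ hΔ
  have hδω : S.δω ≤ S.ω₁ := by
    have := δω_le hΔ hr hΩ₀ le_rfl EB
    have := S.Δ_le_ω₁ hΔ
    linarith
  have hS1 : IsStarProjection S.S₁ := by
    have : S.S₁ = 1 - S.S₂ := by rw [← S.S₁_add_S₂]; abel
    rw [this]
    exact (isStarProjection_S₂ hδω).one_sub
  have hδs : star δ = δ := hδ
  have h12 : ‖S.S₁ * (S.Y + δ) * S.S₂‖ ≤ S.r * S.Δ := by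
    have h := EB.block₁₂
    rw [div_lt_iff₀ (by positivity), Ω₀_eq hΔ] at h
    refine le_of_sq_le_sq (h.le.trans (le_of_eq ?_)) (by positivity)
    field_simp
  have h21 : ‖S.S₂ * (S.Y + δ) * S.S₁‖ ≤ S.r * S.Δ := by
    have : star (S.S₁ * (S.Y + δ) * S.S₂) = S.S₂ * (S.Y + δ) * S.S₁ := by
      rw [star_mul, star_mul, star_add, star_Y, hδs, hS1.isSelfAdjoint.star_eq,
        (isStarProjection_S₂ hδω).isSelfAdjoint.star_eq, mul_assoc]
    rw [← this, norm_star]; exact h12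
  have h11 : ‖S.S₁ * (S.Y + δ) * S.S₁‖ ≤ 2 * S.r * S.Δ := by
    rw [mul_add, add_mul]
    have h1 := norm_mul_mul_le hS1.norm_le (norm_Y_le (S := S)) hS1.norm_le
    have h2 := EB.block₁₁
    rw [div_lt_iff₀ hΔ] at h2
    have h3 : S.r * (S.Ω₀ / S.Δ) * S.Δ = S.r * S.Ω₀ := by field_simp
    rw [h3] at h2
    rw [Ω₀_eq hΔ] at h1 h2
    have : S.r * (S.r * S.Δ) ≤ 1 / 1000 * (S.r * S.Δ) := by gcongr
    have : 0 < S.r * S.Δ := by positivity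
    exact (norm_add_le _ _).trans (by nlinarith)
  have h22 : ‖S.S₂ * (S.Y + δ) * S.S₂‖ ≤ κ * S.r * S.Δ := by
    have h : _ / _ ≤ _ := VB
    rwa [div_le_iff₀ hΔ] at h
  exact (norm_perturbation_le h11 h12 h21 h22).trans (le_of_eq (by ring))

/-- The verification hardly ever accepts an excited state. -/
theorem excited_amplitude {δ : Matrix (ι × Bath) (ι × Bath) ℂ} {κ : ℝ} (hΔ : 0 < S.Δ)
    (hΩ : 0 < S.Ω) (hr : S.r ≤ 1 / 1000) (hδ : δ.IsHermitian) (EB : S.ErrorBound S.Y δ S.Ω₀)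
    (VB : S.VerificationBound δ κ) (t : ℝ) (φ : EuclideanSpace ℂ ι) :
    ‖op ((1 - S.P₀) ⊗ₖ ketBra ketR ketR) (op (evolution (S.H + S.Y + δ) t) (tens φ ketL))‖
      ≤ 6 * (4 + κ) * S.r * ‖φ‖ := by
  have hδs : star δ = δ := hδ
  have hA : (S.H + S.Y + δ).IsHermitian := by
    change star _ = _
    rw [star_add, star_add, star_H, star_Y, hδs]
  set A := S.H + S.Y + δ with hAdef
  -- Midway between the energies at most `ω₁` of states with L and those at least `ω₁ + 3Δ/4` of
  -- excited states with R. Each half gap `3Δ/8` yields a leakage of at most `8/3 (4 + κ) r`.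
  set c := S.ω₁ + 3 / 8 * S.Δ with hc
  set P : Matrix (ι × Bath) (ι × Bath) ℂ := (1 - S.P₀) ⊗ₖ ketBra ketR ketR with hP
  set T : Matrix (ι × Bath) (ι × Bath) ℂ := (1 : Matrix ι ι ℂ) ⊗ₖ ketBra ketL ketL with hT
  set Pa := spectralProj hA (Set.Ioi c) with hPa
  have sP : IsStarProjection P :=
    isStarProjection_kronecker S.isStarProjection_P₀.one_sub (isStarProjection_ketBra ketR_ketR)
  have sT : IsStarProjection T :=
    isStarProjection_kronecker (.one _) (isStarProjection_ketBra ketL_ketL)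
  have sPa : IsStarProjection Pa := isStarProjection_spectralProj hA _
  have hZR : bZ *ᵥ ketR = ((1 : ℝ) : ℂ) • ketR := by rw [bZ_mulVec_ketR]; simp
  have hZL : bZ *ᵥ ketL = ((-1 : ℝ) : ℂ) • ketL := by rw [bZ_mulVec_ketL]; simp
  have cP : S.H * P = P * S.H := H_comm_kronecker
    (by rw [mul_sub, sub_mul, S.HS_mul_P₀, S.P₀_mul_HS, mul_one, one_mul])
    S.isStarProjection_P₀.one_sub.isSelfAdjoint.star_eq bN_mulVec_ketR hZR (by simp)
  have cT : S.H * T = T * S.H := H_comm_kronecker (by rw [mul_one, one_mul]) (star_one _)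
    bN_mulVec_ketL hZL (by simp)
  have cPa : A * Pa = Pa * A := spectralProj_comm hA _
  have hδω := δω_le hΔ hr (hΩ.trans_le Ω_le_Ω₀) le_rfl EB
  have lowT : ∀ y, op T y = y → RCLike.re (inner ℂ y (op S.H y) : ℂ) ≤ S.ω₁ * ‖y‖ ^ 2 := by
    intro y hy
    rw [hT, op_kronecker_ketBra] at hy
    rw [← hy, re_inner_H_tens _ ketL_ketL bN_mulVec_ketL hZL, norm_tens ketL_ketL]
    have := re_inner_HS_nonneg (S := S) (op 1 (contr ketL y))
    linarith
  have highP : ∀ x, op P x = x →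
      (S.ω₁ + 3 / 4 * S.Δ) * ‖x‖ ^ 2 ≤ RCLike.re (inner ℂ x (op S.H x) : ℂ) := by
    intro x hx
    rw [hP, op_kronecker_ketBra] at hx
    set v := op (1 - S.P₀) (contr ketR x) with hv
    have hv1 : op (1 - S.P₀) v = v := by
      rw [hv, ← mul_apply_eq_comp, ← map_mul, S.isStarProjection_P₀.one_sub.isIdempotentElem.eq]
    rw [← hx, re_inner_H_tens _ ketR_ketR bN_mulVec_ketR hZR, norm_tens ketR_ketR]
    have := S.re_inner_HS_ge hΔ hδω hv1
    linarith
  have hAH : ‖op A - op S.H‖ ≤ (4 + κ) * S.r * S.Δ := by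
    rw [← map_sub, norm_op, hAdef, add_assoc, add_sub_cancel_left]
    exact norm_Y_add_le hΔ hΩ hr hδ EB VB
  have k1 : ‖op P * op (1 - Pa)‖ ≤ 3 * (4 + κ) * S.r := by
    have h := norm_mul_le_of_gap (A := op S.H) (B := op A) (P := op P) (R := op (1 - Pa))
      (isStarProjection_op sP) (isStarProjection_op sPa.one_sub)
      (by rw [← map_mul, cP, map_mul])
      (by rw [← map_mul, ← map_mul, mul_sub, sub_mul, cPa, mul_one, one_mul])
      highP (fun y hy => re_inner_op_le_of_spectralProj hA hy) (by rw [hc]; linarith)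
    refine h.trans ?_
    rw [norm_sub_rev, div_le_iff₀ (by rw [hc]; linarith), hc]
    have h0 := norm_nonneg (op A - op S.H)
    refine hAH.trans ?_
    have : 0 ≤ (4 + κ) * S.r * S.Δ := h0.trans hAH
    nlinarith
  have k2 : ‖op Pa * op T‖ ≤ 3 * (4 + κ) * S.r := by
    have h := norm_mul_le_of_gap (A := op A) (B := op S.H) (P := op Pa) (R := op T)
      (isStarProjection_op sPa) (isStarProjection_op sT)
      (by rw [← map_mul, cPa, map_mul]) (by rw [← map_mul, cT, map_mul])
      (fun y hy => le_re_inner_op_of_spectralProj hA hy) lowT (by rw [hc]; linarith)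
    refine h.trans ?_
    rw [div_le_iff₀ (by rw [hc]; linarith), hc]
    have h0 := norm_nonneg (op A - op S.H)
    refine hAH.trans ?_
    have : 0 ≤ (4 + κ) * S.r * S.Δ := h0.trans hAH
    nlinarith
  have cflow : op Pa * flow (op A) t = flow (op A) t * op Pa := by
    let _ : NormedAlgebra ℚ (EuclideanSpace ℂ (ι × Bath) →L[ℂ] EuclideanSpace ℂ (ι × Bath)) :=
      NormedAlgebra.restrictScalars ℚ ℂ _
    have : Commute (op Pa) (op A) := by
      rw [Commute, SemiconjBy, ← map_mul, ← map_mul, cPa]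
    exact (this.smul_right _).exp_right
  have hTφ : op T (tens φ ketL) = tens φ ketL := by
    rw [hT, op_kronecker_tens, ketBra_mulVec, ketL_ketL, one_smul, map_one, one_apply_eq_self]
  set u := tens φ ketL with hu
  have hun : ‖u‖ = ‖φ‖ := norm_tens ketL_ketL
  rw [op_evolution]
  set M : EuclideanSpace ℂ (ι × Bath) →L[ℂ] EuclideanSpace ℂ (ι × Bath) :=
    op P * op (1 - Pa) with hM
  set N : EuclideanSpace ℂ (ι × Bath) →L[ℂ] EuclideanSpace ℂ (ι × Bath) := op Pa * op T with hN
  -- The evolved state is cut at the perturbed energy `c`. The low part barely meets `P`; the high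
  -- part was already present before the evolution, as `Pa` commutes with it, and barely meets `T`.
  have split : op P (flow (op A) t u)
      = M (flow (op A) t u) + op P (flow (op A) t (N u)) := by
    have h1 : flow (op A) t (N u) = op Pa (flow (op A) t u) := by
      rw [hN, mul_apply_eq_comp, hTφ, ← mul_apply_eq_comp, ← cflow, mul_apply_eq_comp]
    rw [h1, hM, mul_apply_eq_comp, map_sub, map_one, sub_apply, one_apply_eq_self, map_sub]
    abel
  rw [split]
  have b1 : ‖M (flow (op A) t u)‖ ≤ 3 * (4 + κ) * S.r * ‖φ‖ := by
    have := norm_apply_le_of_le k1 (flow (op A) t u)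
    rwa [norm_flow_apply (isSelfAdjoint_op hA), hun] at this
  have b2 : ‖op P (flow (op A) t (N u))‖ ≤ 3 * (4 + κ) * S.r * ‖φ‖ := by
    have h1 := norm_apply_le_of_le (isStarProjection_op sP).norm_le
      (flow (op A) t (N u))
    rw [norm_flow_apply (isSelfAdjoint_op hA), one_mul] at h1
    have := norm_apply_le_of_le k2 u
    rw [hun] at this
    exact h1.trans this
  exact (norm_add_le _ _).trans (by linarith)

/-- The acceptance probabilities of an attempt with evolution time `τ`. -/
theorem outcomeProb_bounds {δX δY : Matrix (ι × Bath) (ι × Bath) ℂ} {κ : ℝ} (hΔ : 0 < S.Δ)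
    (hΩ : 0 < S.Ω) (hr : S.r ≤ 1 / 1000) (hκ : 0 < κ) (hX : δX.IsHermitian)
    (hY : δY.IsHermitian) (EX : S.ErrorBound S.X δX S.Ω) (EY : S.ErrorBound S.Y δY S.Ω₀)
    (VB : S.VerificationBound δY κ) :
    ∃ w' : ℝ, |w' - S.Ω| ≤ 8 * S.r * S.Ω ∧ ∀ τ : ℝ,
      (∃ g : ℝ, 0 ≤ g ∧ S.outcomeProb δX δY τ .acceptedGround = g ^ 2 ∧
        |g - |Real.sin (w' * τ)| * ‖S.f₁‖| ≤ 420 * S.r) ∧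
      S.outcomeProb δX δY τ .acceptedExcited ≤ (6 * (4 + κ) * S.r) ^ 2 := by
  obtain ⟨w', hw', h⟩ := evolved_amplitude hΔ hΩ hr hX EX
  refine ⟨w', hw', fun τ => ?_⟩
  set ψ := WithLp.toLp 2 (S.evolved δX τ) with hψ
  set φ := contr ketB ψ with hφ
  have hrpos : 0 < S.r := div_pos (hΩ.trans_le Ω_le_Ω₀) hΔ
  have hφn : ‖φ‖ ≤ 1 := (norm_contr_le ketB_ketB ψ).trans (norm_evolved hX τ).le
  have hswap : bathSwap *ᵥ ketB = ketL := by
    have hDB : star ketD ⬝ᵥ ketB = 0 := by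
      simp [ketD_eq, ketB_eq, dotProduct, Fin.sum_univ_three, conj_isq]
    rw [bathSwap, Matrix.add_mulVec, Matrix.add_mulVec, ketBra_mulVec, ketBra_mulVec, ketBra_mulVec,
      ketB_ketB, hDB, ketC_ketB]
    simp
  have hver : WithLp.toLp 2 (S.verified δX δY τ)
      = op (evolution (S.H + S.Y + δY) S.verificationTime) (tens φ ketL) := by
    have h1 : WithLp.toLp 2 (S.verified δX δY τ)
        = op (evolution (S.H + S.Y + δY) S.verificationTime * ((1 : Matrix ι ι ℂ) ⊗ₖ bathSwap) *
          ((1 : Matrix ι ι ℂ) ⊗ₖ ketBra ketB ketB)) ψ := rfl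
    rw [h1, map_mul, map_mul, mul_apply_eq_comp, mul_apply_eq_comp, op_kronecker_ketBra,
      op_kronecker_tens, hswap, map_one, one_apply_eq_self, one_apply_eq_self]
  have hv := verification_amplitude hΔ hΩ hr hY EY φ
  have hgr : S.outcomeProb δX δY τ .acceptedGround
      = ‖(inner ℂ (tens S.gs ketR) (op (evolution (S.H + S.Y + δY) S.verificationTime)
          (tens φ ketL)) : ℂ)‖ ^ 2 := by
    have h1 : S.outcomeProb δX δY τ .acceptedGround
        = ‖op (S.P₀ ⊗ₖ ketBra ketR ketR) (WithLp.toLp 2 (S.verified δX δY τ))‖ ^ 2 := rfl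
    rw [h1, hver, P₀, op_ketBra_kronecker, norm_smul, norm_tens ketR_ketR, S.norm_gs, mul_one]
  have hex : S.outcomeProb δX δY τ .acceptedExcited
      = ‖op ((1 - S.P₀) ⊗ₖ ketBra ketR ketR) (WithLp.toLp 2 (S.verified δX δY τ))‖ ^ 2 := rfl
  refine ⟨⟨_, norm_nonneg _, hgr, ?_⟩, ?_⟩
  · have h2 : 220 * S.r * ‖φ‖ ≤ 220 * S.r * 1 := by gcongr
    -- The transition contributes `200 r` and the verification `220 r`; `φ` is not normalized, but
    -- its norm is at most 1.
    refine (abs_sub_le _ ‖(inner ℂ S.gs φ : ℂ)‖ _).trans ?_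
    have := h τ
    linarith
  · rw [hex, hver]
    refine pow_le_pow_left₀ (norm_nonneg _) ?_ 2
    refine (excited_amplitude hΔ hΩ hr hY EY VB _ φ).trans ?_
    have : 0 ≤ 6 * (4 + κ) * S.r := by positivity
    nlinarith

end System

end

/-! ### Averaging over the random time -/

noncomputable section

lemma two_div_pi_mul_abs_sub_round_le (u : ℝ) :
    2 / Real.pi * |u - round (u / Real.pi) * Real.pi| ≤ |Real.sin u| := by
  set k := round (u / Real.pi) with hk
  set v := u - k * Real.pi with hv
  have hπ := Real.pi_pos
  have hv2 : |v| ≤ Real.pi / 2 := by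
    have h := abs_sub_round (u / Real.pi)
    have e : v = (u / Real.pi - k) * Real.pi := by rw [hv]; field_simp
    rw [e, abs_mul, abs_of_pos hπ]
    nlinarith
  have hs : |Real.sin u| = |Real.sin v| := by
    rw [hv, Real.sin_sub_int_mul_pi, abs_mul, abs_zpow, abs_neg, abs_one, one_zpow, one_mul]
  rw [hs]
  exact Real.mul_abs_le_abs_sin hv2

/-- The set where a sine is small has small measure in any interval. -/
theorem volume_abs_sin_lt_le {w x a b : ℝ} (hw : 0 < w) (hx : 0 ≤ x) (hab : a ≤ b) :
    volume {τ ∈ Set.Icc a b | |Real.sin (w * τ)| < x}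
      ≤ ENNReal.ofReal ((w * (b - a) / Real.pi + 2) * (Real.pi * x / w)) := by
  have hπ := Real.pi_pos
  -- The node nearest to `w τ` may lie half a spacing outside the interval, hence the margins `1 /
  -- 2` and the extra 2 in the count.
  set s : Finset ℤ := Finset.Icc ⌈w * a / Real.pi - 1 / 2⌉ ⌊w * b / Real.pi + 1 / 2⌋ with hs
  have hsub : {τ ∈ Set.Icc a b | |Real.sin (w * τ)| < x}
      ⊆ ⋃ k ∈ s, Set.Icc (k * Real.pi / w - Real.pi * x / (2 * w))
          (k * Real.pi / w + Real.pi * x / (2 * w)) := by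
    rintro τ ⟨⟨ha, hb⟩, hτ⟩
    have h1 := (two_div_pi_mul_abs_sub_round_le (w * τ)).trans hτ.le
    have h2 := abs_sub_round (w * τ / Real.pi)
    set k := round (w * τ / Real.pi)
    rw [abs_le] at h2
    have ha' : w * a / Real.pi ≤ w * τ / Real.pi := by gcongr
    have hb' : w * τ / Real.pi ≤ w * b / Real.pi := by gcongr
    refine Set.mem_biUnion (x := k) ?_ ?_
    · rw [hs, Finset.mem_coe, Finset.mem_Icc, Int.ceil_le, Int.le_floor]
      constructor <;> linarith
    · have h3 : |τ - k * Real.pi / w| ≤ Real.pi * x / (2 * w) := by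
        have e : τ - k * Real.pi / w = (w * τ - k * Real.pi) / w := by field_simp
        rw [e, abs_div, abs_of_pos hw, div_le_div_iff₀ hw (by positivity)]
        have h4 : |w * τ - k * Real.pi| ≤ x * (Real.pi / 2) := by
          rw [div_mul_eq_mul_div, div_le_iff₀ hπ] at h1
          linarith
        nlinarith
      rw [abs_le] at h3
      constructor <;> linarith
  refine (measure_mono hsub).trans ((measure_biUnion_finset_le s _).trans ?_)
  have hlen : ∀ k ∈ s, volume (Set.Icc (k * Real.pi / w - Real.pi * x / (2 * w))
      (k * Real.pi / w + Real.pi * x / (2 * w))) = ENNReal.ofReal (Real.pi * x / w) := by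
    intro k _
    rw [Real.volume_Icc]
    congr 1
    field_simp
    ring
  rw [Finset.sum_congr rfl hlen, Finset.sum_const, nsmul_eq_mul,
    ← ENNReal.ofReal_natCast, ← ENNReal.ofReal_mul (Nat.cast_nonneg _)]
  refine ENNReal.ofReal_le_ofReal ?_
  gcongr
  have h0 : 0 ≤ w * (b - a) / Real.pi := by
    have : 0 ≤ b - a := by linarith
    positivity
  rw [hs, Int.card_Icc]
  have h1 := Int.floor_le (w * b / Real.pi + 1 / 2)
  have h2 := Int.le_ceil (w * a / Real.pi - 1 / 2)
  have e : w * (b - a) / Real.pi = w * b / Real.pi - w * a / Real.pi := by ring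
  rcases le_total 0 (⌊w * b / Real.pi + 1 / 2⌋ + 1 - ⌈w * a / Real.pi - 1 / 2⌉) with h | h
  · have h3 : (((⌊w * b / Real.pi + 1 / 2⌋ + 1 - ⌈w * a / Real.pi - 1 / 2⌉).toNat : ℕ) : ℝ)
        = ((⌊w * b / Real.pi + 1 / 2⌋ + 1 - ⌈w * a / Real.pi - 1 / 2⌉ : ℤ) : ℝ) := by
      exact_mod_cast congrArg (Int.cast : ℤ → ℝ) (Int.toNat_of_nonneg h)
    rw [h3]
    push_cast
    linarith
  · rw [Int.toNat_of_nonpos h]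
    push_cast
    linarith

/-- A random time for which an oscillation with angular frequency `w` is seldom close to a node. -/
def Spread (ν : Measure ℝ) (w : ℝ) : Prop :=
  ∀ x : ℝ, 0 ≤ x → ν {τ | |Real.sin (w * τ)| < x} ≤ ENNReal.ofReal (4 * x)

lemma measurableSet_abs_sin_lt (w y : ℝ) : MeasurableSet {τ | |Real.sin (w * τ)| < y} :=
  measurableSet_lt (by fun_prop) measurable_const

lemma real_abs_sin_lt_le {ν : Measure ℝ} {w : ℝ} (hν : Spread ν w) {y : ℝ} (hy : 0 ≤ y) :
    ν.real {τ | |Real.sin (w * τ)| < y} ≤ 4 * y :=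
  ENNReal.toReal_le_of_le_ofReal (by positivity) (hν y hy)

section Averages

variable {ν : Measure ℝ} [IsProbabilityMeasure ν] {p q : ℝ → ℝ} {w f r M : ℝ}

/-- The weights `p`, `q` of two outcomes, where `p` is a squared oscillation of amplitude `f` up to
an error of order `r` in the amplitude, and `q` is of order `r ^ 2`. -/
structure Oscillating (p q : ℝ → ℝ) (w f r M : ℝ) : Prop where
  continuous_left : Continuous p
  continuous_right : Continuous q
  nonneg_right : ∀ τ, 0 ≤ q τ
  amplitude : ∀ τ, ∃ g : ℝ, 0 ≤ g ∧ p τ = g ^ 2 ∧ |g - |Real.sin (w * τ)| * f| ≤ 420 * r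
  right_le : ∀ τ, q τ ≤ (M * r) ^ 2

namespace Oscillating

lemma nonneg_left (h : Oscillating p q w f r M) (τ : ℝ) : 0 ≤ p τ := by
  obtain ⟨g, -, e, -⟩ := h.amplitude τ
  rw [e]; positivity

lemma left_le (h : Oscillating p q w f r M) (hf : 0 < f) (hr : 420 * r ≤ f) (τ : ℝ) :
    p τ ≤ 4 * f ^ 2 := by
  obtain ⟨g, h0, e, hg⟩ := h.amplitude τ
  rw [abs_le] at hg
  have h1 : |Real.sin (w * τ)| * f ≤ 1 * f := by gcongr; exact Real.abs_sin_le_one _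
  have : g ≤ 2 * f := by linarith
  rw [e]
  nlinarith

/-- Away from the nodes, the error `420 r` uses up at most half of the amplitude. -/
lemma le_left (h : Oscillating p q w f r M) {y : ℝ} (hf : 0 < f) (hy : 0 ≤ y)
    (hr : 420 * r ≤ y / 2 * f) {τ : ℝ} (hτ : y ≤ |Real.sin (w * τ)|) :
    y ^ 2 / 4 * f ^ 2 ≤ p τ := by
  obtain ⟨g, h0, e, hg⟩ := h.amplitude τ
  rw [abs_le] at hg
  have h1 : y * f ≤ |Real.sin (w * τ)| * f := by gcongr
  have h2 : y / 2 * f ≤ g := by linarith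
  have h3 : 0 ≤ y / 2 * f := by positivity
  rw [e]
  nlinarith

lemma integrable_left (h : Oscillating p q w f r M) (hf : 0 < f) (hr : 420 * r ≤ f) :
    Integrable p ν :=
  .of_bound h.continuous_left.aestronglyMeasurable (4 * f ^ 2) (.of_forall fun τ => by
    rw [Real.norm_of_nonneg (h.nonneg_left τ)]; exact h.left_le hf hr τ)

lemma integrable_right (h : Oscillating p q w f r M) : Integrable q ν :=
  .of_bound h.continuous_right.aestronglyMeasurable ((M * r) ^ 2) (.of_forall fun τ => by
    rw [Real.norm_of_nonneg (h.nonneg_right τ)]; exact h.right_le τ)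

lemma integral_left_le (h : Oscillating p q w f r M) (hf : 0 < f) (hr : 420 * r ≤ f) :
    ∫ τ, p τ ∂ν ≤ 4 * f ^ 2 := by
  have := integral_mono (μ := ν) (h.integrable_left hf hr) (integrable_const _) (h.left_le hf hr)
  simpa using this

lemma integral_right_le (h : Oscillating p q w f r M) : ∫ τ, q τ ∂ν ≤ (M * r) ^ 2 := by
  have := integral_mono (μ := ν) h.integrable_right (integrable_const _) h.right_le
  simpa using this

/-- With threshold `1 / 8` for the sine, at least half of the times are good, and each contributes
at least `f² / 256`. -/
lemma le_integral_left (h : Oscillating p q w f r M) (hν : Spread ν w) (hf : 0 < f)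
    (hr : 420 * r ≤ f / 16) : f ^ 2 / 512 ≤ ∫ τ, p τ ∂ν := by
  set B := {τ | |Real.sin (w * τ)| < 1 / 8} with hB
  have hBm : MeasurableSet B := measurableSet_abs_sin_lt w _
  have hBν : ν.real B ≤ 1 / 2 := (real_abs_sin_lt_le hν (by norm_num)).trans (by norm_num)
  have hle : ∀ τ, f ^ 2 / 256 * (1 - B.indicator 1 τ) ≤ p τ := by
    intro τ
    by_cases hτ : τ ∈ B
    · simpa [hτ] using h.nonneg_left τ
    · have h1 : 1 / 8 ≤ |Real.sin (w * τ)| := not_lt.mp hτ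
      have := h.le_left hf (by norm_num) (by linarith) h1
      simp only [hτ, not_false_eq_true, Set.indicator_of_notMem]
      linarith
  have hi : Integrable (B.indicator (1 : ℝ → ℝ)) ν := (integrable_const (1 : ℝ)).indicator hBm
  have h2 := integral_mono (μ := ν) (((integrable_const (1 : ℝ)).sub hi).const_mul (f ^ 2 / 256))
    (h.integrable_left hf (by linarith)) hle
  refine le_trans ?_ h2
  have h3 : ∫ τ, f ^ 2 / 256 * (1 - B.indicator (1 : ℝ → ℝ) τ) ∂ν
      = f ^ 2 / 256 * (1 - ν.real B) := by
    rw [integral_const_mul, integral_sub (integrable_const _) hi, integral_indicator_one hBm]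
    simp
  change _ ≤ ∫ τ, f ^ 2 / 256 * (1 - B.indicator (1 : ℝ → ℝ) τ) ∂ν
  rw [h3]
  nlinarith [sq_nonneg f]

/-- The ratio of the averages. -/
lemma le_ratio (h : Oscillating p q w f r M) (hν : Spread ν w) (hf : 0 < f)
    (hr : 420 * r ≤ f / 16) :
    1 - 512 * (M * r) ^ 2 / f ^ 2 ≤ (∫ τ, p τ ∂ν) / (∫ τ, p τ ∂ν + ∫ τ, q τ ∂ν) := by
  have hp := h.le_integral_left hν hf hr
  have hq := h.integral_right_le (ν := ν)
  have hq0 : 0 ≤ ∫ τ, q τ ∂ν := integral_nonneg h.nonneg_right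
  have hp0 : 0 < ∫ τ, p τ ∂ν := lt_of_lt_of_le (by positivity) hp
  have e : (∫ τ, p τ ∂ν) / (∫ τ, p τ ∂ν + ∫ τ, q τ ∂ν)
      = 1 - (∫ τ, q τ ∂ν) / (∫ τ, p τ ∂ν + ∫ τ, q τ ∂ν) := by
    field_simp
    ring
  rw [e]
  have : (∫ τ, q τ ∂ν) / (∫ τ, p τ ∂ν + ∫ τ, q τ ∂ν) ≤ (M * r) ^ 2 / (f ^ 2 / 512) :=
    div_le_div₀ (by positivity) hq (by positivity) (by linarith)
  have e2 : (M * r) ^ 2 / (f ^ 2 / 512) = 512 * (M * r) ^ 2 / f ^ 2 := by field_simp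
  linarith

/-- The average of the ratio. -/
lemma le_integral_ratio (h : Oscillating p q w f r M) (hν : Spread ν w) (hf : 0 < f)
    {y : ℝ} (hy : 0 < y) (hr : 420 * r ≤ y / 2 * f) :
    1 - (4 * y + 4 * (M * r) ^ 2 / (y ^ 2 * f ^ 2)) ≤ ∫ τ, p τ / (p τ + q τ) ∂ν := by
  set B := {τ | |Real.sin (w * τ)| < y} with hB
  have hBm : MeasurableSet B := measurableSet_abs_sin_lt w _
  have hBν : ν.real B ≤ 4 * y := real_abs_sin_lt_le hν hy.le
  set d := 4 * (M * r) ^ 2 / (y ^ 2 * f ^ 2) with hd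
  have hd0 : 0 ≤ d := by positivity
  -- The quotient may be `0 / 0 = 0`, but only on `B`, where nothing better than nonnegativity is
  -- used.
  have h01 : ∀ τ, 0 ≤ p τ / (p τ + q τ) := fun τ =>
    div_nonneg (h.nonneg_left τ) (add_nonneg (h.nonneg_left τ) (h.nonneg_right τ))
  have hle : ∀ τ, 1 - d - B.indicator 1 τ ≤ p τ / (p τ + q τ) := by
    intro τ
    by_cases hτ : τ ∈ B
    · have := h01 τ
      simp only [hτ, Set.indicator_of_mem, Pi.one_apply]
      linarith
    · have h1 : y ≤ |Real.sin (w * τ)| := not_lt.mp hτ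
      have h2 := h.le_left hf hy.le hr h1
      have hp0 : 0 < p τ := lt_of_lt_of_le (by positivity) h2
      have hq0 := h.nonneg_right τ
      have e : p τ / (p τ + q τ) = 1 - q τ / (p τ + q τ) := by
        field_simp
        ring
      have h3 : q τ / (p τ + q τ) ≤ (M * r) ^ 2 / (y ^ 2 / 4 * f ^ 2) :=
        div_le_div₀ (by positivity) (h.right_le τ) (by positivity) (by linarith)
      have e2 : (M * r) ^ 2 / (y ^ 2 / 4 * f ^ 2) = d := by rw [hd]; field_simp
      simp only [hτ, not_false_eq_true, Set.indicator_of_notMem]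
      linarith
  have hi : Integrable (B.indicator (1 : ℝ → ℝ)) ν := (integrable_const (1 : ℝ)).indicator hBm
  have hr : Integrable (fun τ => p τ / (p τ + q τ)) ν :=
    .of_bound (h.continuous_left.measurable.div
      (h.continuous_left.add h.continuous_right).measurable).aestronglyMeasurable 1
      (.of_forall fun τ => by
        rw [Real.norm_of_nonneg (h01 τ)]
        exact div_le_one_of_le₀ (by linarith [h.nonneg_right τ])
          (add_nonneg (h.nonneg_left τ) (h.nonneg_right τ)))
  have h2 := integral_mono (μ := ν) ((integrable_const (1 - d)).sub hi) hr hle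
  refine le_trans ?_ h2
  have h3 : ∫ τ, (1 - d - B.indicator (1 : ℝ → ℝ) τ) ∂ν = 1 - d - ν.real B := by
    rw [integral_sub (integrable_const _) hi, integral_indicator_one hBm]
    simp
  change _ ≤ ∫ τ, (1 - d - B.indicator (1 : ℝ → ℝ) τ) ∂ν
  rw [h3]
  linarith

end Oscillating

end Averages

end

/-! ### The law of one attempt -/

noncomputable section

lemma continuous_evolution {m : Type} [Fintype m] [DecidableEq m] (A : Matrix m m ℂ) :
    Continuous (evolution A) := by
  let _ : NormedAlgebra ℚ (Matrix m m ℂ) := NormedAlgebra.restrictScalars ℚ ℂ _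
  exact NormedSpace.exp_continuous.comp
    ((continuous_const.mul Complex.continuous_ofReal).smul continuous_const)

lemma continuous_normSq {m : Type} [Fintype m] : Continuous (normSq (m := m)) :=
  (continuous_norm.comp (PiLp.continuous_toLp 2 _)).pow 2

lemma normSq_nonneg {m : Type} [Fintype m] (v : m → ℂ) : 0 ≤ normSq v := sq_nonneg _

namespace System

variable {ι : Type} [Fintype ι] [DecidableEq ι] (S : System ι)
  (δX δY : Matrix (ι × Bath) (ι × Bath) ℂ)

lemma continuous_outcomeProb (o : Outcome) : Continuous fun τ => S.outcomeProb δX δY τ o := by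
  have h1 : Continuous (S.evolved δX) :=
    (continuous_evolution _).matrix_mulVec continuous_const
  have h2 : Continuous (S.verified δX δY) := continuous_const.matrix_mulVec h1
  cases o
  · exact continuous_normSq.comp (continuous_const.matrix_mulVec h1)
  all_goals exact continuous_normSq.comp (continuous_const.matrix_mulVec h2)

lemma outcomeProb_nonneg (τ : ℝ) (o : Outcome) : 0 ≤ S.outcomeProb δX δY τ o := by
  cases o <;> exact normSq_nonneg _

section TimeLaw

variable {Ωs : ℝ}

lemma volume_timeInterval (Ωs : ℝ) :
    volume (Set.Icc (Real.pi / Ωs) (2 * Real.pi / Ωs)) = ENNReal.ofReal (Real.pi / Ωs) := by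
  rw [Real.volume_Icc]
  congr 1
  ring

lemma isProbabilityMeasure_timeLaw (h : 0 < Ωs) : IsProbabilityMeasure (timeLaw Ωs) := by
  refine ProbabilityTheory.cond_isProbabilityMeasure_of_finite ?_ ?_
  · rw [volume_timeInterval]
    simpa using div_pos Real.pi_pos h
  · rw [volume_timeInterval]
    exact ENNReal.ofReal_ne_top

lemma ae_timeLaw (Ωs : ℝ) :
    ∀ᵐ τ ∂(timeLaw Ωs), τ ∈ Set.Icc (Real.pi / Ωs) (2 * Real.pi / Ωs) :=
  ProbabilityTheory.ae_cond_mem measurableSet_Icc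

/-- The count of nodes gives the probability bound `(1 + 2 Ωs / w) x`. It stays below `4 x` for
every `w ≥ 3 Ωs / 4`, so `w` may exceed `Ωs` by any factor. -/
lemma spread_timeLaw (h : 0 < Ωs) {w : ℝ} (hw : Ωs * (3 / 4) ≤ w) : Spread (timeLaw Ωs) w := by
  intro x hx
  have hπ := Real.pi_pos
  have hw0 : 0 < w := lt_of_lt_of_le (by positivity) hw
  have hL : 0 < Real.pi / Ωs := div_pos hπ h
  rw [timeLaw, ProbabilityTheory.cond_apply measurableSet_Icc, volume_timeInterval]
  have h1 := volume_abs_sin_lt_le (a := Real.pi / Ωs) (b := 2 * Real.pi / Ωs) hw0 hx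
    (by rw [mul_div_assoc]; linarith)
  refine (mul_le_mul_right h1 _).trans ?_
  rw [← ENNReal.ofReal_inv_of_pos hL, ← ENNReal.ofReal_mul (by positivity)]
  refine ENNReal.ofReal_le_ofReal ?_
  have e : (Real.pi / Ωs)⁻¹ *
      ((w * (2 * Real.pi / Ωs - Real.pi / Ωs) / Real.pi + 2) * (Real.pi * x / w))
      = x + 2 * (Ωs / w) * x := by
    field_simp
    ring
  have h2 : Ωs / w ≤ 4 / 3 := by
    rw [div_le_iff₀ hw0]
    linarith
  rw [e]
  nlinarith

end TimeLaw

lemma attemptLaw_apply (Ωs : ℝ) {E : Set (ℝ × Outcome)} (hE : MeasurableSet E) :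
    S.attemptLaw δX δY Ωs E = ∑ o, ∫⁻ τ in {τ | (τ, o) ∈ E},
      ENNReal.ofReal (S.outcomeProb δX δY τ o) ∂(timeLaw Ωs) := by
  rw [attemptLaw, Measure.finsetSum_apply]
  refine Finset.sum_congr rfl fun o _ => ?_
  have hm : Measurable fun τ : ℝ => (τ, o) := by fun_prop
  rw [Measure.map_apply hm hE, withDensity_apply _ (hm hE)]
  rfl

lemma measurableSet_outcome (s : Set Outcome) : MeasurableSet {a : ℝ × Outcome | a.2 ∈ s} :=
  measurable_snd (t := s) trivial

open Classical in
lemma attemptLaw_outcome (Ωs : ℝ) (s : Set Outcome) :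
    S.attemptLaw δX δY Ωs {a | a.2 ∈ s} = ∑ o, if o ∈ s then
      ∫⁻ τ, ENNReal.ofReal (S.outcomeProb δX δY τ o) ∂(timeLaw Ωs) else 0 := by
  rw [S.attemptLaw_apply _ _ _ (measurableSet_outcome s)]
  refine Finset.sum_congr rfl fun o _ => ?_
  by_cases h : o ∈ s <;> simp [h]

lemma ae_attemptLaw (Ωs : ℝ) : ∀ᵐ a ∂(S.attemptLaw δX δY Ωs),
    a.1 ∈ Set.Icc (Real.pi / Ωs) (2 * Real.pi / Ωs) := by
  have hE : MeasurableSet {a : ℝ × Outcome |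
      a.1 ∈ Set.Icc (Real.pi / Ωs) (2 * Real.pi / Ωs)}ᶜ :=
    (measurable_fst measurableSet_Icc).compl
  rw [ae_iff]
  change S.attemptLaw δX δY Ωs {a : ℝ × Outcome |
      a.1 ∈ Set.Icc (Real.pi / Ωs) (2 * Real.pi / Ωs)}ᶜ = 0
  rw [S.attemptLaw_apply _ _ _ hE]
  refine Finset.sum_eq_zero fun o _ => setLIntegral_measure_zero _ _ ?_
  exact ae_iff.mp (ae_timeLaw Ωs)

section

variable {S δX δY} {Ωs : ℝ}
  (hp : Integrable (fun τ => S.outcomeProb δX δY τ .acceptedGround) (timeLaw Ωs))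
  (hq : Integrable (fun τ => S.outcomeProb δX δY τ .acceptedExcited) (timeLaw Ωs))
include hp

lemma attemptLaw_ground : S.attemptLaw δX δY Ωs {a | a.2 = .acceptedGround}
    = ENNReal.ofReal (∫ τ, S.outcomeProb δX δY τ .acceptedGround ∂(timeLaw Ωs)) := by
  rw [ofReal_integral_eq_lintegral_ofReal hp
    (.of_forall fun τ => S.outcomeProb_nonneg δX δY τ _)]
  have := S.attemptLaw_outcome δX δY Ωs {.acceptedGround}
  simpa using this

include hq

lemma attemptLaw_accepted : S.attemptLaw δX δY Ωs {a | a.2.IsAccepted}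
    = ENNReal.ofReal (∫ τ, S.outcomeProb δX δY τ .acceptedGround ∂(timeLaw Ωs)
        + ∫ τ, S.outcomeProb δX δY τ .acceptedExcited ∂(timeLaw Ωs)) := by
  have h0 (o : Outcome) : ∀ τ, 0 ≤ S.outcomeProb δX δY τ o :=
    fun τ => S.outcomeProb_nonneg δX δY τ o
  rw [ENNReal.ofReal_add (integral_nonneg (h0 _)) (integral_nonneg (h0 _)),
    ofReal_integral_eq_lintegral_ofReal hp (.of_forall (h0 _)),
    ofReal_integral_eq_lintegral_ofReal hq (.of_forall (h0 _))]
  have h1 := S.attemptLaw_outcome δX δY Ωs {o | o.IsAccepted}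
  have hu : (Finset.univ : Finset Outcome)
      = {.noTransition, .rejected, .acceptedGround, .acceptedExcited} := rfl
  rw [hu] at h1
  simpa [Outcome.IsAccepted] using h1

lemma pAccept_eq : S.pAccept δX δY Ωs
    = ∫ τ, S.outcomeProb δX δY τ .acceptedGround ∂(timeLaw Ωs)
        + ∫ τ, S.outcomeProb δX δY τ .acceptedExcited ∂(timeLaw Ωs) := by
  rw [pAccept, measureReal_def, attemptLaw_accepted hp hq, ENNReal.toReal_ofReal]
  exact add_nonneg (integral_nonneg fun τ => S.outcomeProb_nonneg δX δY τ _)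
    (integral_nonneg fun τ => S.outcomeProb_nonneg δX δY τ _)

/-- Conditioning on acceptance alone weights each time by its acceptance probability, which produces
a ratio of averages and not an average of ratios. -/
lemma pSuccess_eq : S.pSuccess δX δY Ωs
    = (∫ τ, S.outcomeProb δX δY τ .acceptedGround ∂(timeLaw Ωs)) /
      (∫ τ, S.outcomeProb δX δY τ .acceptedGround ∂(timeLaw Ωs)
        + ∫ τ, S.outcomeProb δX δY τ .acceptedExcited ∂(timeLaw Ωs)) := by
  have hm : MeasurableSet {a : ℝ × Outcome | a.2.IsAccepted} :=
    measurableSet_outcome {o | o.IsAccepted}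
  have hi : {a : ℝ × Outcome | a.2.IsAccepted} ∩ {a | a.2 = .acceptedGround}
      = {a | a.2 = .acceptedGround} :=
    Set.inter_eq_right.mpr fun a ha => Or.inl ha
  rw [pSuccess, measureReal_def, ProbabilityTheory.cond_apply hm, hi, ENNReal.toReal_mul,
    ENNReal.toReal_inv, attemptLaw_ground hp, ENNReal.toReal_ofReal
      (integral_nonneg fun τ => S.outcomeProb_nonneg δX δY τ _), ← measureReal_def]
  change (S.pAccept δX δY Ωs)⁻¹ * _ = _
  rw [pAccept_eq hp hq, mul_comm, div_eq_mul_inv]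

end

end System

end

/-! ### Independent repetitions and the expected total time -/

noncomputable section

section Repetition

variable {W α : Type} [MeasurableSpace W] [MeasurableSpace α] {μ : Measure W}
  [IsProbabilityMeasure μ] {a : ℕ → W → α} {law : Measure α}

/-- The probability that none of the first `n` independent attempts lies in `s`. -/
lemma measure_forall_lt_notMem (ha : ∀ n, Measurable (a n))
    (hi : ProbabilityTheory.iIndepFun a μ) (hlaw : ∀ n, μ.map (a n) = law)
    {s : Set α} (hs : MeasurableSet s) (n : ℕ) :
    μ {w | ∀ m < n, a m w ∉ s} = (1 - law s) ^ n := by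
  have e : {w | ∀ m < n, a m w ∉ s} = ⋂ m ∈ Finset.range n, a m ⁻¹' sᶜ := by
    ext w; simp
  have hc (m : ℕ) : μ (a m ⁻¹' sᶜ) = 1 - law s := by
    rw [Set.preimage_compl, prob_compl_eq_one_sub (ha m hs), ← hlaw m,
      Measure.map_apply (ha m) hs]
  rw [e, hi.measure_inter_preimage_eq_mul (sets := fun _ => sᶜ) _ fun _ _ => hs.compl,
    Finset.prod_congr rfl fun m _ => hc m]
  simp

/-- The expected number of independent attempts until the first one that lies in `s`. -/
lemma tsum_measure_forall_lt_notMem (ha : ∀ n, Measurable (a n))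
    (hi : ProbabilityTheory.iIndepFun a μ) (hlaw : ∀ n, μ.map (a n) = law)
    {s : Set α} (hs : MeasurableSet s) :
    ∑' n, μ {w | ∀ m < n, a m w ∉ s} = (law s)⁻¹ := by
  simp_rw [measure_forall_lt_notMem ha hi hlaw hs]
  -- Needed because subtraction in `ℝ≥0∞` is truncated. It follows from `law` being the distribution
  -- of `a 0`, without summing the outcome probabilities.
  have h1 : law s ≤ 1 := by
    rw [← hlaw 0, Measure.map_apply (ha 0) hs]
    exact prob_le_one
  rw [ENNReal.tsum_geometric, ENNReal.sub_sub_cancel ENNReal.one_ne_top h1]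

lemma measurableSet_forall_lt_notMem (ha : ∀ n, Measurable (a n)) {s : Set α}
    (hs : MeasurableSet s) (n : ℕ) : MeasurableSet {w | ∀ m < n, a m w ∉ s} := by
  simp only [Set.ofPred_forall]
  exact .iInter fun m => .iInter fun _ => (ha m hs).compl

open Classical in
/-- Wald's identity for a cost of each attempt that lies almost surely between two bounds. -/
theorem lintegral_cost_bounds (ha : ∀ n, Measurable (a n))
    (hi : ProbabilityTheory.iIndepFun a μ) (hlaw : ∀ n, μ.map (a n) = law)
    {s : Set α} (hs : MeasurableSet s) {d : α → ℝ≥0∞} (hd : Measurable d) {l u : ℝ≥0∞}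
    (hl : ∀ᵐ x ∂law, l ≤ d x) (hu : ∀ᵐ x ∂law, d x ≤ u) :
    l * (law s)⁻¹ ≤ ∫⁻ w, ∑' n, (if ∀ m < n, a m w ∉ s then d (a n w) else 0) ∂μ ∧
      ∫⁻ w, ∑' n, (if ∀ m < n, a m w ∉ s then d (a n w) else 0) ∂μ ≤ u * (law s)⁻¹ := by
  have hmeas (n : ℕ) : Measurable fun w => if ∀ m < n, a m w ∉ s then d (a n w) else 0 :=
    Measurable.ite (measurableSet_forall_lt_notMem ha hs n) (hd.comp (ha n)) measurable_const
  have hc (c : ℝ≥0∞) (n : ℕ) : ∫⁻ w, (if ∀ m < n, a m w ∉ s then c else 0) ∂μ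
      = c * μ {w | ∀ m < n, a m w ∉ s} := by
    rw [← lintegral_indicator_const (measurableSet_forall_lt_notMem ha hs n)]
    simp only [Set.indicator_apply, Set.mem_ofPred_eq]
  -- By Tonelli the expectation is a sum over attempts. Each cost enters only through its almost
  -- sure bounds, so independence serves only to compute the probability that an attempt is made.
  rw [lintegral_tsum fun n => (hmeas n).aemeasurable,
    ← tsum_measure_forall_lt_notMem ha hi hlaw hs, ← ENNReal.tsum_mul_left,
    ← ENNReal.tsum_mul_left]
  have hl' (n : ℕ) : ∀ᵐ w ∂μ, l ≤ d (a n w) :=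
    ae_of_ae_map (p := fun x => l ≤ d x) (ha n).aemeasurable (by rwa [hlaw n])
  have hu' (n : ℕ) : ∀ᵐ w ∂μ, d (a n w) ≤ u :=
    ae_of_ae_map (p := fun x => d x ≤ u) (ha n).aemeasurable (by rwa [hlaw n])
  constructor <;> refine ENNReal.tsum_le_tsum fun n => ?_ <;> rw [← hc]
  · refine lintegral_mono_ae ?_
    filter_upwards [hl' n] with w hw
    split_ifs
    exacts [hw, le_rfl]
  · refine lintegral_mono_ae ?_
    filter_upwards [hu' n] with w hw
    split_ifs
    exacts [hw, le_rfl]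

end Repetition

namespace System

variable {ι : Type} [Fintype ι] [DecidableEq ι] {S : System ι}
  {δX δY : Matrix (ι × Bath) (ι × Bath) ℂ} {Ωs : ℝ}

lemma measurable_duration (S : System ι) : Measurable S.duration := by
  refine measurable_fst.add ?_
  have : Measurable fun o : Outcome => (match o with
    | .noTransition => 0
    | _ => S.verificationTime : ℝ) := fun _ _ => trivial
  exact this.comp measurable_snd

lemma le_duration (h : 0 < S.Ω₀) (a : ℝ × Outcome) : a.1 ≤ S.duration a := by
  have : 0 ≤ S.verificationTime := by rw [verificationTime]; have := Real.pi_pos; positivity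
  obtain ⟨t, o⟩ := a
  cases o <;> simp only [duration] <;> linarith

lemma duration_le (h : 0 < S.Ω₀) (a : ℝ × Outcome) :
    S.duration a ≤ a.1 + Real.pi / (2 * S.Ω₀) := by
  change _ ≤ a.1 + S.verificationTime
  have : 0 ≤ S.verificationTime := by rw [verificationTime]; have := Real.pi_pos; positivity
  obtain ⟨t, o⟩ := a
  cases o <;> simp only [duration] <;> linarith

/-- The expected total simulation time in terms of the acceptance probability. -/
theorem lintegral_totalTime_bounds (hΩs : 0 < Ωs) (h : Ωs ≤ S.Ω₀) {W : Type} [MeasurableSpace W]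
    {μ : Measure W} [IsProbabilityMeasure μ] {a : ℕ → W → ℝ × Outcome}
    (ha : ∀ n, Measurable (a n)) (hi : ProbabilityTheory.iIndepFun a μ)
    (hlaw : ∀ n, μ.map (a n) = S.attemptLaw δX δY Ωs) :
    ENNReal.ofReal (Real.pi / Ωs) * (S.attemptLaw δX δY Ωs {a | a.2.IsAccepted})⁻¹
        ≤ ∫⁻ w, S.totalTime (fun n => a n w) ∂μ ∧
      ∫⁻ w, S.totalTime (fun n => a n w) ∂μ ≤ ENNReal.ofReal (5 / 2 * (Real.pi / Ωs)) *
        (S.attemptLaw δX δY Ωs {a | a.2.IsAccepted})⁻¹ := by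
  have hΩ₀ : 0 < S.Ω₀ := hΩs.trans_le h
  have hm : MeasurableSet {a : ℝ × Outcome | a.2.IsAccepted} :=
    measurableSet_outcome {o | o.IsAccepted}
  refine lintegral_cost_bounds ha hi hlaw hm S.measurable_duration.ennreal_ofReal ?_ ?_
  · filter_upwards [S.ae_attemptLaw δX δY Ωs] with x hx
    exact ENNReal.ofReal_le_ofReal (hx.1.trans (le_duration hΩ₀ x))
  · filter_upwards [S.ae_attemptLaw δX δY Ωs] with x hx
    refine ENNReal.ofReal_le_ofReal ((duration_le hΩ₀ x).trans ?_)
    -- Since `Ωs ≤ Ω₀`, the verification adds at most half of `π / Ωs` to the sampled time, which is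
    -- at most `2 π / Ωs`.
    have h1 : Real.pi / (2 * S.Ω₀) ≤ Real.pi / (2 * Ωs) := by
      have := Real.pi_pos
      gcongr
    have h2 : Real.pi / (2 * Ωs) = 1 / 2 * (Real.pi / Ωs) := by field_simp
    have h3 := hx.2
    rw [mul_div_assoc] at h3
    linarith

end System

end

/-! ### Assembly with explicit constants -/

noncomputable section

namespace System

variable {ι : Type} [Fintype ι] [DecidableEq ι] {S : System ι}
  {δX δY : Matrix (ι × Bath) (ι × Bath) ℂ} {K κ ε Ωs : ℝ}

lemma norm_f₁_le_one (h : 0 < S.Ω) : ‖S.f₁‖ ≤ 1 := by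
  rw [← inner_vone_vF]
  exact (norm_inner_le_norm _ _).trans (by rw [norm_one_vec h, norm_vF, one_mul])

/-- The two accepted outcomes oscillate with the time of the first evolution. -/
theorem exists_oscillating (hΔ : 0 < S.Δ) (hΩs : 0 < Ωs) (h : Ωs < S.Ω) (hr : S.r ≤ 1 / 1000)
    (hκ : 0 < κ) (hX : δX.IsHermitian) (hY : δY.IsHermitian) (EX : S.ErrorBound S.X δX S.Ω)
    (EY : S.ErrorBound S.Y δY S.Ω₀) (VB : S.VerificationBound δY κ) :
    ∃ w : ℝ, Spread (timeLaw Ωs) w ∧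
      Oscillating (fun τ => S.outcomeProb δX δY τ .acceptedGround)
        (fun τ => S.outcomeProb δX δY τ .acceptedExcited) w ‖S.f₁‖ S.r (6 * (4 + κ)) := by
  have hΩ := hΩs.trans h
  obtain ⟨w, hw, hτ⟩ := outcomeProb_bounds hΔ hΩ hr hκ hX hY EX EY VB
  refine ⟨w, spread_timeLaw hΩs ?_, S.continuous_outcomeProb δX δY _,
    S.continuous_outcomeProb δX δY _, fun τ => S.outcomeProb_nonneg δX δY τ _,
    fun τ => (hτ τ).1, fun τ => (hτ τ).2⟩
  rw [abs_le] at hw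
  have : S.r * S.Ω ≤ 1 / 1000 * S.Ω := by gcongr
  linarith

end System

end

end QSC

theorem theorem4 (K κ : ℝ) (hK : 0 < K) (hκ : 0 < κ) :
    ∃ c C ε₀ : ℝ, 0 < c ∧ 0 < C ∧ 0 < ε₀ ∧
      ∀ (ι : Type) [Fintype ι] [DecidableEq ι] (S : QSC.System ι)
        (δX δY : Matrix (ι × QSC.Bath) (ι × QSC.Bath) ℂ) (Ωs ε : ℝ),
        δX.IsHermitian → δY.IsHermitian →
        0 < S.Δ →
        S.ErrorBound S.X δX S.Ω →
        S.ErrorBound S.Y δY S.Ω₀ →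
        S.VerificationBound δY κ →
        0 < Ωs → Ωs < S.Ω →
        0 < ε → ε < ε₀ →
        S.r ≤ K * (‖S.f₁‖ * ε ^ (3 / 2 : ℝ)) →
        (c * ‖S.f₁‖ ^ 2 ≤ S.pAccept δX δY Ωs ∧ S.pAccept δX δY Ωs ≤ C * ‖S.f₁‖ ^ 2) ∧
        1 - C * ε ≤ S.pSuccess δX δY Ωs ∧
        1 - C * ε ≤ ∫ τ, S.pSuccessAt δX δY τ ∂(QSC.System.timeLaw Ωs) ∧
        ∀ (W : Type) [MeasurableSpace W] (μ : MeasureTheory.Measure W)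
          [MeasureTheory.IsProbabilityMeasure μ] (a : ℕ → W → ℝ × QSC.Outcome),
          (∀ n, Measurable (a n)) →
          ProbabilityTheory.iIndepFun a μ →
          (∀ n, μ.map (a n) = S.attemptLaw δX δY Ωs) →
          ENNReal.ofReal (c / (‖S.f₁‖ ^ 3 * ε ^ (3 / 2 : ℝ) * S.Δ)) ≤
              ∫⁻ w, S.totalTime (fun n => a n w) ∂μ ∧
            ∫⁻ w, S.totalTime (fun n => a n w) ∂μ ≤
              ENNReal.ofReal (C / (‖S.f₁‖ ^ 2 * Ωs)) := by
  have hπ := Real.pi_pos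
  set M := 6 * (4 + κ) with hM
  have hM0 : 0 < M := by positivity
  set C₁ := 4 + (M * K) ^ 2 with hC₁
  have hC₁0 : 0 < C₁ := by positivity
  -- `1 / 512` and `C₁` bound the acceptance probability over `f²`; `512 (M K)²` comes from the
  -- ratio of averages, and `1280 π = 5/2 * 512 π` from the total time. `ε < 1 / 8` makes `420 r ≤ f
  -- / 16`, and the other bound on `ε` yields `840 r ≤ ε f`.
  refine ⟨min (1 / 512) (Real.pi / (C₁ * K)), C₁ + 512 * (M * K) ^ 2 + 1280 * Real.pi,
    min (1 / 8) ((1 / (840 * K)) ^ 2), by positivity, by positivity, by positivity, ?_⟩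
  intro ι _ _ S δX δY Ωs ε hX hY hΔ EX EY VB hΩs hΩ hε hεlt hr
  set f := ‖S.f₁‖ with hf
  set x := ε ^ (3 / 2 : ℝ) with hx
  have hx0 : 0 < x := Real.rpow_pos_of_pos hε _
  have hε8 : ε < 1 / 8 := hεlt.trans_le (min_le_left _ _)
  have hx2 : x ^ 2 = ε ^ 3 := by
    rw [hx, ← Real.rpow_natCast, ← Real.rpow_mul hε.le, ← Real.rpow_natCast]
    norm_num
  have hKx : 840 * K * x ≤ ε := by
    have h1 : ε ≤ (1 / (840 * K)) ^ 2 := (hεlt.trans_le (min_le_right _ _)).le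
    refine le_of_sq_le_sq ?_ hε.le
    rw [mul_pow, hx2]
    have h2 : (840 * K) ^ 2 * ε ≤ 1 := by
      rw [div_pow, one_pow, le_div_iff₀ (by positivity)] at h1
      linarith
    nlinarith [sq_nonneg ε]
  have hΩ0 : 0 < S.Ω := hΩs.trans hΩ
  have hΩ₀ : S.Ω ≤ S.Ω₀ := QSC.System.Ω_le_Ω₀
  have hΩ₀0 : 0 < S.Ω₀ := hΩ0.trans_le hΩ₀
  have hr0 : 0 < S.r := div_pos hΩ₀0 hΔ
  have hf1 : f ≤ 1 := QSC.System.norm_f₁_le_one hΩ0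
  -- If the overlap vanished, the hypothesis on `r` would contradict `0 < r`.
  have hf0 : 0 < f := by
    by_contra h
    have : f = 0 := le_antisymm (not_lt.mp h) (norm_nonneg _)
    rw [this] at hr
    linarith
  have hrf : 840 * S.r ≤ ε * f := by
    have : 840 * K * x * f ≤ ε * f := by gcongr
    linarith
  have hεf : ε * f ≤ 1 / 8 * f := by gcongr
  have hMr : (M * S.r) ^ 2 ≤ (M * K) ^ 2 * f ^ 2 * ε ^ 3 := by
    have : M * S.r ≤ M * (K * (f * x)) := by gcongr
    calc (M * S.r) ^ 2 ≤ (M * (K * (f * x))) ^ 2 := by gcongr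
      _ = _ := by rw [← hx2]; ring
  have hε1 : ε ^ 3 ≤ 1 := pow_le_one₀ hε.le (by linarith)
  have hε2 : ε ^ 3 ≤ ε := by nlinarith [sq_nonneg ε]
  obtain ⟨w, hw, osc⟩ := QSC.System.exists_oscillating hΔ hΩs hΩ (by linarith) hκ hX hY EX EY VB
  have := QSC.System.isProbabilityMeasure_timeLaw hΩs
  have hp := osc.integrable_left (ν := QSC.System.timeLaw Ωs) hf0 (by linarith)
  have hq := osc.integrable_right (ν := QSC.System.timeLaw Ωs)
  have hp1 := osc.le_integral_left hw hf0 (by linarith)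
  have hp2 := osc.integral_left_le (ν := QSC.System.timeLaw Ωs) hf0 (by linarith)
  have hq1 : 0 ≤ ∫ τ, S.outcomeProb δX δY τ .acceptedExcited ∂(QSC.System.timeLaw Ωs) :=
    MeasureTheory.integral_nonneg osc.nonneg_right
  have hq2 := osc.integral_right_le (ν := QSC.System.timeLaw Ωs)
  have hpq : ∫ τ, S.outcomeProb δX δY τ .acceptedGround ∂(QSC.System.timeLaw Ωs)
      + ∫ τ, S.outcomeProb δX δY τ .acceptedExcited ∂(QSC.System.timeLaw Ωs) ≤ C₁ * f ^ 2 := by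
    have : (M * K) ^ 2 * f ^ 2 * ε ^ 3 ≤ (M * K) ^ 2 * f ^ 2 * 1 := by gcongr
    rw [hC₁]
    linarith
  have hpacc := QSC.System.pAccept_eq hp hq
  have hacc := QSC.System.attemptLaw_accepted hp hq
  refine ⟨⟨?_, ?_⟩, ?_, ?_, ?_⟩
  · rw [hpacc]
    have : min (1 / 512) (Real.pi / (C₁ * K)) * f ^ 2 ≤ 1 / 512 * f ^ 2 := by
      gcongr
      exact min_le_left _ _
    linarith
  · rw [hpacc]
    refine hpq.trans ?_
    gcongr
    have : 0 ≤ 512 * (M * K) ^ 2 := by positivity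
    linarith
  · rw [QSC.System.pSuccess_eq hp hq]
    refine le_trans ?_ (osc.le_ratio hw hf0 (by linarith))
    have : 512 * (M * S.r) ^ 2 / f ^ 2 ≤ 512 * (M * K) ^ 2 * ε := by
      rw [div_le_iff₀ (by positivity)]
      have : (M * K) ^ 2 * f ^ 2 * ε ^ 3 ≤ (M * K) ^ 2 * f ^ 2 * ε := by gcongr
      linarith
    have : 0 ≤ C₁ * ε := by positivity
    have : 0 ≤ 1280 * Real.pi * ε := by positivity
    linarith
  -- The threshold is `y = ε`: the times near a node cost `4 ε`, and the others cost `r² / (ε² f²)`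
  -- up to constants, which is of order `ε³ / ε² = ε`.
  · refine le_trans ?_ (osc.le_integral_ratio hw hf0 hε (by linarith))
    have : 4 * (M * S.r) ^ 2 / (ε ^ 2 * f ^ 2) ≤ 4 * (M * K) ^ 2 * ε := by
      rw [div_le_iff₀ (by positivity)]
      linarith
    have : 4 * ε ≤ C₁ * ε := by
      gcongr
      rw [hC₁]
      linarith [sq_nonneg (M * K)]
    have : 0 ≤ (M * K) ^ 2 * ε := by positivity
    have : 0 ≤ 1280 * Real.pi * ε := by positivity
    linarith
  · intro W _ μ _ a ha hi hlaw
    obtain ⟨h1, h2⟩ := QSC.System.lintegral_totalTime_bounds hΩs (hΩ.le.trans hΩ₀) ha hi hlaw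
    set P := ∫ τ, S.outcomeProb δX δY τ .acceptedGround ∂(QSC.System.timeLaw Ωs)
      + ∫ τ, S.outcomeProb δX δY τ .acceptedExcited ∂(QSC.System.timeLaw Ωs) with hP
    have hPl : f ^ 2 / 512 ≤ P := by linarith
    have hP0 : 0 < P := lt_of_lt_of_le (by positivity) hPl
    rw [hacc, ← ENNReal.ofReal_inv_of_pos hP0, ← ENNReal.ofReal_mul (by positivity)] at h1 h2
    refine ⟨le_trans (ENNReal.ofReal_le_ofReal ?_) h1, h2.trans (ENNReal.ofReal_le_ofReal ?_)⟩
    -- The lower bound on the time uses `Ωs < Ω ≤ Ω₀ = r Δ`: a small `r` forces a slow oscillation.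
    · have hrK : Ωs ≤ K * (f * x) * S.Δ := by
        have : S.Ω₀ = S.r * S.Δ := QSC.System.Ω₀_eq hΔ
        have : S.r * S.Δ ≤ K * (f * x) * S.Δ := by gcongr
        linarith
      calc min (1 / 512) (Real.pi / (C₁ * K)) / (f ^ 3 * x * S.Δ)
          ≤ Real.pi / (C₁ * K) / (f ^ 3 * x * S.Δ) := by
            gcongr
            exact min_le_right _ _
        _ = Real.pi / (K * (f * x) * S.Δ) * (C₁ * f ^ 2)⁻¹ := by field_simp
        _ ≤ Real.pi / Ωs * P⁻¹ := by gcongr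
    · calc 5 / 2 * (Real.pi / Ωs) * P⁻¹ ≤ 5 / 2 * (Real.pi / Ωs) * (f ^ 2 / 512)⁻¹ := by gcongr
        _ = 1280 * Real.pi / (f ^ 2 * Ωs) := by field_simp; norm_num
        _ ≤ _ := by
          gcongr
          have : 0 ≤ 512 * (M * K) ^ 2 := by positivity
          linarith
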